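/- **Definitions.** For $\tau\ge 0$ let $\omega_0=e^{2\pi i/2^{\tau}}$ and $F_\tau=\mathbb{Q}(\omega_0,z)$, where $z$ is an indeterminate. If $K/F$ is a cyclic Galois extension of degree $\ell$ and $\sigma$ generates $\mathrm{Gal}(K/F)$, the cyclic algebra $(K/F,\sigma,z)=K\oplus Kx\oplus\dots\oplus Kx^{\ell-1}$ (with $x^\ell=z$ and $xb=\sigma(b)x$ for $b\in K$), if it is a division algebra, is called a cyclic division algebra of index $\ell$; its elements are written as $\ell\times\ell$ matrices over $K$ by letting $b\in K$ correspond to $\mathrm{diag}(b,\sigma(b),\dots,\sigma^{\ell-1}(b))$ and $x$ to the matrix with ones above the diagonal and $z$ in the lower left corner. A homogeneous $n$-variate ABP of width $r$ and degree $\tilde d$ over $F$ is a layered directed graph with layers $0,\dots,\tilde d$ of at most $r$ vertices each, with edges from each layer to the next labelled by homogeneous $F$-linear forms in the noncommuting variables $x_1,\dots,x_n$, a source in layer $0$ and a sink in layer $\tilde d$; it computes the sum over all source-to-sink paths of the ordered product of the labels. A set $\mathcal H\subseteq D^n$, $D$ an $F$-algebra, is a hitting set for a class of polynomials in $F\langle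 x_1,\dots,x_n\rangle$ if for each $f$ in the class, $f\ne 0$ if and only if $f(\underline q)\neq 0$ for some $\underline q\in\mathcal H$. **Theorem.** There are an algorithm, an absolute constant $C$ and a function $L=L(p,n,\tilde d)$ such that for all primes $p$ and integers $n,r,\tilde d\ge 1$, with $d^*=\max(\tilde d,2)$ (so that $d^*=\tilde d$ unless $\tilde d=1$), the following holds. 1. $L\le C\,p\log_p(n d^*)$; note that $L$ does not depend on $r$. 2. There are integers $\tau,m\geq 0$ with $2^\tau>r^{3p}$, an intermediate field $F_\tau\subseteq K\subseteq F_\tau(\zeta)$, where $\zeta=e^{2\pi i/(2^\tau p^m)}$, and a generator $\sigma$ of the Galois group of the cyclic extension $K/F_\tau$ of degree $p^L$, such that $D=(K/F_\tau,\sigma,z)$ is a cyclic division algebra of index $p^L$. 3. On input $(p,n,r,\tilde d)$, the algorithm prints a hitting set $\mathcal H\subseteq D^n$, with at most $(nrd^*)^{C p\log_2 d^*}$ listed points, for the class of noncommutative polynomials over $F_\tau$ computed by homogeneous $n$-variate ABPs of width $r$ and degree $\tilde d$, and it halts within $(nrd^*)^{C p\log_2 d^*}$ steps. Here the points are printed as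 tuples of $p^L\times p^L$ matrices, each entry being a polynomial $\sum_{j<Z,\,e<2^\tau p^m}c_{je}\,\zeta^e z^j$ given by the list of all its rational coefficients $c_{je}$ (each as a numerator and a nonzero denominator), preceded by the numbers $\tau,m,L,Z$ and the number of points. The steps are those of a random access machine with integer registers, the operations $+,-,\times$, integer division and remainder, and logarithmic cost (every operation is charged the total bit length of the numbers, including addresses, that it handles). -/

import Mathlib

/-! ## A random access machine with logarithmic cost

Programs are structured (`while`) programs over integer variables and integer arrays indexed by
integers; every operation is charged the total bit length of the numbers it handles. -/

/-- The bit length of an integer. -/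
def bitLength (a : ℤ) : ℕ := Nat.size a.natAbs

/-- The arithmetic operations of the machine (`div` and `mod` are integer division with
remainder). -/
inductive RamOp where
  | add
  | sub
  | mul
  | div
  | mod

def RamOp.apply : RamOp → ℤ → ℤ → ℤ
  | .add, a, b => a + b
  | .sub, a, b => a - b
  | .mul, a, b => a * b
  | .div, a, b => a / b
  | .mod, a, b => a % b

/-- Arithmetic expressions: constants, variables, array cells, binary operations. -/
inductive RamExpr where
  | const (c : ℤ)
  | var (x : ℕ)
  | cell (A : ℕ) (i : RamExpr)
  | op (o : RamOp) (e₁ e₂ : RamExpr)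

/-- A configuration of the memory, together with the list of numbers printed so far. -/
structure RamState where
  vars : ℕ → ℤ
  arrays : ℕ → ℤ → ℤ
  output : List ℤ

def RamExpr.eval (s : RamState) : RamExpr → ℤ
  | .const c => c
  | .var x => s.vars x
  | .cell A i => s.arrays A (i.eval s)
  | .op o e₁ e₂ => o.apply (e₁.eval s) (e₂.eval s)

/-- The cost of evaluating an expression: each node costs one plus the bit lengths of the numbers
it handles (for an array access these include the address). -/
def RamExpr.cost (s : RamState) : RamExpr → ℕ
  | .const c => 1 + bitLength c
  | .var x => 1 + bitLength (s.vars x)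
  | .cell A i => i.cost s + 1 + bitLength (i.eval s) + bitLength (s.arrays A (i.eval s))
  | .op _ e₁ e₂ => e₁.cost s + e₂.cost s + 1 + bitLength (e₁.eval s) + bitLength (e₂.eval s)

/-- Programs. Tests ask whether the value of an expression is positive. -/
inductive RamProg where
  | skip
  | assign (x : ℕ) (e : RamExpr)
  | store (A : ℕ) (i e : RamExpr)
  | emit (e : RamExpr)
  | seq (P Q : RamProg)
  | ifPos (e : RamExpr) (P Q : RamProg)
  | whilePos (e : RamExpr) (P : RamProg)

/-- `RamExec P s s' t`: the program `P`, started in the state `s`, halts in the state `s'` after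
`t` units of time. -/
inductive RamExec : RamProg → RamState → RamState → ℕ → Prop where
  | skip (s : RamState) : RamExec .skip s s 1
  | assign (x : ℕ) (e : RamExpr) (s : RamState) :
      RamExec (.assign x e) s { s with vars := Function.update s.vars x (e.eval s) }
        (e.cost s + 1 + bitLength (e.eval s))
  | store (A : ℕ) (i e : RamExpr) (s : RamState) :
      RamExec (.store A i e) s
        { s with arrays := Function.update s.arrays A
                  (Function.update (s.arrays A) (i.eval s) (e.eval s)) }
        (i.cost s + e.cost s + 1 + bitLength (i.eval s) + bitLength (e.eval s))
  | emit (e : RamExpr) (s : RamState) :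
      RamExec (.emit e) s { s with output := s.output ++ [e.eval s] }
        (e.cost s + 1 + bitLength (e.eval s))
  | seq {P Q : RamProg} {s s' s'' : RamState} {t t' : ℕ} :
      RamExec P s s' t → RamExec Q s' s'' t' → RamExec (.seq P Q) s s'' (t + t' + 1)
  | ifPos_true {e : RamExpr} {P Q : RamProg} {s s' : RamState} {t : ℕ} :
      0 < e.eval s → RamExec P s s' t → RamExec (.ifPos e P Q) s s' (e.cost s + t + 1)
  | ifPos_false {e : RamExpr} {P Q : RamProg} {s s' : RamState} {t : ℕ} :
      ¬ 0 < e.eval s → RamExec Q s s' t → RamExec (.ifPos e P Q) s s' (e.cost s + t + 1)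
  | whilePos_true {e : RamExpr} {P : RamProg} {s s' s'' : RamState} {t t' : ℕ} :
      0 < e.eval s → RamExec P s s' t → RamExec (.whilePos e P) s' s'' t' →
        RamExec (.whilePos e P) s s'' (e.cost s + t + t' + 1)
  | whilePos_false {e : RamExpr} {P : RamProg} {s : RamState} :
      ¬ 0 < e.eval s → RamExec (.whilePos e P) s s (e.cost s + 1)

/-- The initial state: the input numbers are in the first variables, everything else is zero. -/
def RamState.init (input : List ℤ) : RamState where
  vars := fun x => input.getD x 0
  arrays := fun _ _ => 0
  output := []

/-- On the given input, the program halts after `t` units of time, having printed `out`. -/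
def RamProg.Prints (P : RamProg) (input out : List ℤ) (t : ℕ) : Prop :=
  ∃ s' : RamState, RamExec P (RamState.init input) s' t ∧ s'.output = out

/-! ## Homogeneous algebraic branching programs in noncommuting variables -/

/-- A homogeneous algebraic branching program over `F` in `n` variables, with layers `0, …, d` of
at most `r` vertices each (all layers are numbered by `Fin r`; a missing edge or vertex amounts to
zero labels). The edge from the vertex `a` of layer `k` to the vertex `b` of layer `k + 1` is
labelled by the linear form `∑ j, coeff k a b j · x_j`. -/
structure HomABP (F : Type*) (n r d : ℕ) where
  coeff : Fin d → Fin r → Fin r → Fin n → F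
  source : Fin r
  sink : Fin r

/-- The linear form that labels an edge. -/
noncomputable def HomABP.label {F : Type*} [Field F] {n r d : ℕ} (A : HomABP F n r d)
    (k : Fin d) (a b : Fin r) : FreeAlgebra F (Fin n) :=
  ∑ j : Fin n, A.coeff k a b j • FreeAlgebra.ι F j

/-- The polynomial computed by the program: the sum, over all paths from the source in layer `0` to
the sink in layer `d`, of the ordered product of the labels of the edges. -/
noncomputable def HomABP.poly {F : Type*} [Field F] {n r d : ℕ} (A : HomABP F n r d) :
    FreeAlgebra F (Fin n) :=
  ∑ v : Fin (d + 1) → Fin r with v 0 = A.source ∧ v (Fin.last d) = A.sink,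
    (List.ofFn fun k : Fin d => A.label k (v k.castSucc) (v k.succ)).prod

/-- The class of noncommutative polynomials computed by homogeneous ABPs of width `r` and
degree `d`. -/
def homABPClass (F : Type*) [Field F] (n r d : ℕ) : Set (FreeAlgebra F (Fin n)) :=
  Set.range (HomABP.poly (F := F) (n := n) (r := r) (d := d))

/-- A set of points of `Aⁿ` is a hitting set for a class of noncommutative polynomials when the
nonzero polynomials of the class are exactly those that do not vanish at some point of it. -/
def IsHittingSet {F A : Type*} [Field F] [Ring A] [Algebra F A] {n : ℕ}
    (𝒞 : Set (FreeAlgebra F (Fin n))) (S : Set (Fin n → A)) : Prop :=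
  ∀ f ∈ 𝒞, f ≠ 0 ↔ ∃ q ∈ S, FreeAlgebra.lift F q f ≠ 0

/-! ## Cyclic algebras -/

section CyclicAlgebra

/-- The matrix of `b ∈ K`: the diagonal matrix with entries `b, σ b, …, σ^(ℓ-1) b`. -/
def cyclicDiag {F K : Type*} [Field F] [Field K] [Algebra F K] (σ : K ≃ₐ[F] K) (ℓ : ℕ) (b : K) :
    Matrix (Fin ℓ) (Fin ℓ) K :=
  Matrix.diagonal fun i => (σ ^ (i : ℕ)) b

/-- The matrix of the generator `x` with `x ^ ℓ = a`: ones above the diagonal and `a` in the lower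
left corner. -/
def cyclicShift {K : Type*} [Field K] (ℓ : ℕ) (a : K) : Matrix (Fin ℓ) (Fin ℓ) K :=
  Matrix.of fun i j =>
    if (j : ℕ) = i + 1 then 1 else if (i : ℕ) + 1 = ℓ ∧ (j : ℕ) = 0 then a else 0

/-- The cyclic algebra `(K/F, σ, a) = K ⊕ K x ⊕ ⋯ ⊕ K x^(ℓ-1)`, `x ^ ℓ = a`, `x b = σ(b) x`, in its
matrix representation: the `F`-algebra of `ℓ × ℓ` matrices over `K` generated by the matrices of
the elements of `K` and the matrix of `x`. -/
def cyclicAlgebra {F K : Type*} [Field F] [Field K] [Algebra F K] (σ : K ≃ₐ[F] K) (ℓ : ℕ) (a : F) :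
    Subalgebra F (Matrix (Fin ℓ) (Fin ℓ) K) :=
  Algebra.adjoin F (Set.range (cyclicDiag σ ℓ) ∪ {cyclicShift ℓ (algebraMap F K a)})

/-- `(K/F, σ, a)` is a cyclic division algebra of index `ℓ`: `K/F` is a Galois extension of degree
`ℓ` whose Galois group is generated by `σ`, and nonzero elements are invertible. -/
structure IsCyclicDivisionAlgebra {F K : Type*} [Field F] [Field K] [Algebra F K]
    (σ : K ≃ₐ[F] K) (ℓ : ℕ) (a : F) : Prop where
  isGalois : IsGalois F K
  finrank_eq : Module.finrank F K = ℓ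
  index_pos : 0 < ℓ
  generates : ∀ g : K ≃ₐ[F] K, g ∈ Subgroup.zpowers σ
  isUnit : ∀ y : cyclicAlgebra σ ℓ a, y ≠ 0 → IsUnit y

end CyclicAlgebra

/-! ## The base field and the format of the output -/

/-- The primitive `N`-th root of unity `exp (2πi/N)`, as an element of the field `ℂ(z)`. -/
noncomputable def rootOfUnity (N : ℕ) : RatFunc ℂ :=
  RatFunc.C (Complex.exp (2 * Real.pi * Complex.I / N))

/-- The base field `ℚ(ω₀, z)`, where `ω₀` is a primitive root of unity of order `2 ^ τ`
and `z` is an indeterminate. -/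
noncomputable def baseField (τ : ℕ) : Subfield (RatFunc ℂ) :=
  Subfield.closure {rootOfUnity (2 ^ τ), RatFunc.X}

/-- The indeterminate `z`, as an element of the base field. -/
noncomputable def baseZ (τ : ℕ) : baseField τ :=
  ⟨RatFunc.X, Subfield.subset_closure (by simp)⟩

/-- A table of `H` tuples of `n` matrices of dimension `ℓ`; the entries of the matrices are
polynomials `∑ (u_{je}/w_{je}) ζ^e z^j`, `j < Z`, `e < N`, in `z` and a primitive `N`-th root of
unity `ζ`, and the table holds the pairs `(u_{je}, w_{je})`. -/
abbrev PointTable (H n ℓ Z N : ℕ) : Type :=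
  Fin H → Fin n → Fin ℓ → Fin ℓ → Fin Z → Fin N → ℤ × ℤ

/-- The value of the polynomial `∑ (u_{je}/w_{je}) ζ^e z^j`. -/
noncomputable def entryValue {Z N : ℕ} (c : Fin Z → Fin N → ℤ × ℤ) : RatFunc ℂ :=
  ∑ j : Fin Z, ∑ e : Fin N,
    RatFunc.C (((c j e).1 : ℂ) / ((c j e).2 : ℂ)) * rootOfUnity N ^ (e : ℕ) * RatFunc.X ^ (j : ℕ)

/-- All the numbers in a table, written out one after the other. -/
def PointTable.toList {H n ℓ Z N : ℕ} (c : PointTable H n ℓ Z N) : List ℤ :=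
  (List.finRange H).flatMap fun k => (List.finRange n).flatMap fun i =>
    (List.finRange ℓ).flatMap fun a => (List.finRange ℓ).flatMap fun b =>
      (List.finRange Z).flatMap fun j => (List.finRange N).flatMap fun e =>
        [(c k i a b j e).1, (c k i a b j e).2]

/-! A homogeneous polynomial `f` of degree `d` is evaluated at points with coordinates `b_i x`, `b_i
∈ K`. Moving `x` to the right turns a word `w` into `∏ σ^k(b_{w_k}) · x^d`, and since `d < p^L`, one
matrix entry of the value is the commutative set-multilinear sum `∑_w f_w ∏_k σ^k(b_{w_k})`
(`HomABP.lift_poly_cyclicAlgebra_apply`). It remains to find few families `b_i` whose conjugates act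
like freely chosen values in each position `k`.

Conjugates can be prescribed at a place. For `A > 1` some valuation ring satisfies `ζ ≡ A`, because
the cyclotomic polynomial takes a value other than `±1` at `A`. Replacing `ζ` by `A` in half of the
Fourier inversion formula on `ℤ/N` gives elements with integer coefficients whose conjugate under `ζ
↦ ζ^u` is congruent to `N Φ(u)`, for any integer function `Φ` (`valuation_fourierElement_sub_lt`).
Such an element lies in `K` when `Φ` is invariant under residues with `u^(p-1) = 1`. The choice `A =
N · T!` makes `N` and all positive integers below `T` units at the place.

The coefficient vectors belonging to an interval of positions factor through `r × r` matrices, so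
they span at most `r^2` dimensions, and reduction at the place preserves this. For such polynomials
weights are built by doubling (`exists_isolating_level`): bases of two adjacent intervals give a
bounded set of candidates for their union, and one more small modulus separates these. After about
`log d` levels the word of least weight in the support is unique. Substituting powers `t^weight`
then yields a nonzero univariate polynomial, which is nonzero at some `t < T`. The points enumerate
all choices of moduli and of `t`.

`K` is the fixed field, in the cyclotomic extension, of the automorphisms `ζ ↦ ζ^u` with `u^(p-1) =
1`; its Galois group is generated by `ζ ↦ ζ^g` with `g = 1 + 2^τ p` (`1 + 2^τ` for `p = 2`), of
order `p^L`. The algebra is a division algebra because the degree in `z` is a `σ`-invariant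
valuation with integer values on `K` and value one at `z`: different terms `b_i x^i` have degrees in
different classes of `(1/p^L)ℤ` modulo `ℤ`, so one term dominates (`mulVec_ne_zero_of_mem`).

Finally, the coefficients of the points are iterated sums and products over ranges bounded by the
parameters. Bit lengths grow only additively under each operation, so such expressions run in time
polynomial in the parameters (`FoldExpr.exists_ramExec_compile`, `Printer.exists_ramExec_compile`),
all of which are `(n r d*)^{O(p log d*)}`. -/

/-! ## A language of bounded expressions and its compilation -/

/-- Expressions with bounded iteration: `fold o c x b e` combines the values of `e`, for the
variable `x` running from `0` to (excluding) the value of the variable `b`, by the operation `o`,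
starting from `c`. -/
inductive FoldExpr where
  | const (c : ℤ)
  | var (x : ℕ)
  | op (o : RamOp) (e₁ e₂ : FoldExpr)
  | ite (e e₁ e₂ : FoldExpr)
  | fold (o : RamOp) (c : ℤ) (x b : ℕ) (e : FoldExpr)

/-- The value of an expression in an environment. -/
def FoldExpr.eval (v : ℕ → ℤ) : FoldExpr → ℤ
  | .const c => c
  | .var x => v x
  | .op o e₁ e₂ => o.apply (e₁.eval v) (e₂.eval v)
  | .ite e e₁ e₂ => if 0 < e.eval v then e₁.eval v else e₂.eval v
  | .fold o c x b e => (List.range (v b).toNat).foldl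
      (fun a (i : ℕ) => o.apply a (e.eval (Function.update v x i))) c

/-- A cell of the array that holds the temporary results. -/
def tempCell (k : ℕ) : RamExpr := .cell 0 (.const k)

/-- Storing a temporary result. -/
def tempStore (k : ℕ) (e : RamExpr) : RamProg := .store 0 (.const k) e

/-- A program that computes the value of an expression in the temporary cell `k`, using only the
temporary cells from `k` on, and restoring all variables. -/
def FoldExpr.compile : FoldExpr → ℕ → RamProg
  | .const c, k => tempStore k (.const c)
  | .var x, k => tempStore k (.var x)
  | .op o e₁ e₂, k => .seq (e₁.compile k) (.seq (e₂.compile (k + 1))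
      (tempStore k (.op o (tempCell k) (tempCell (k + 1)))))
  | .ite e e₁ e₂, k => .seq (e.compile k) (.ifPos (tempCell k) (e₁.compile k) (e₂.compile k))
  | .fold o c x b e, k =>
      -- The cells `k`, `k + 1`, `k + 2` hold the accumulator, the old value of `x` and the bound.
      -- The bound is copied before `x` is reset, so `x` and `b` may coincide.
      .seq (tempStore k (.const c)) (.seq (tempStore (k + 1) (.var x))
        (.seq (tempStore (k + 2) (.var b)) (.seq (.assign x (.const 0))
          (.seq (.whilePos (.op .sub (tempCell (k + 2)) (.var x))
            (.seq (e.compile (k + 3))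
              (.seq (tempStore k (.op o (tempCell k) (tempCell (k + 3))))
                (.assign x (.op .add (.var x) (.const 1))))))
            (.assign x (tempCell (k + 1)))))))

/-! ### Growth of bit lengths and the cost of loops -/

theorem bitLength_le_natAbs (a : ℤ) : bitLength a ≤ a.natAbs :=
  Nat.size_le.2 a.natAbs.lt_two_pow_self

theorem bitLength_le_iff {a : ℤ} {n : ℕ} : bitLength a ≤ n ↔ a.natAbs < 2 ^ n := Nat.size_le

theorem natAbs_lt_two_pow_bitLength (a : ℤ) : a.natAbs < 2 ^ bitLength a := Nat.lt_size_self _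

/-- Multiplication is the worst case, where bit lengths add. Division and remainder by zero give `0`
and `a`, so they need no exception. -/
theorem bitLength_apply_le (o : RamOp) (a b : ℤ) :
    bitLength (o.apply a b) ≤ bitLength a + bitLength b + 1 := by
  rw [bitLength_le_iff]
  have ha := natAbs_lt_two_pow_bitLength a
  have hb := natAbs_lt_two_pow_bitLength b
  have h1 : (2 : ℕ) ^ bitLength a ≤ 2 ^ (bitLength a + bitLength b) :=
    Nat.pow_le_pow_right (by norm_num) (by omega)
  have h2 : (2 : ℕ) ^ bitLength b ≤ 2 ^ (bitLength a + bitLength b) :=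
    Nat.pow_le_pow_right (by norm_num) (by omega)
  rw [pow_succ]
  cases o with
  | add => simp only [RamOp.apply]; omega
  | sub => simp only [RamOp.apply]; omega
  | mul =>
    simp only [RamOp.apply, Int.natAbs_mul]
    have := Nat.mul_lt_mul'' ha hb
    rw [← pow_add] at this
    omega
  | div =>
    simp only [RamOp.apply]
    have := Int.natAbs_ediv_le_natAbs a b
    omega
  | mod =>
    simp only [RamOp.apply]
    rcases eq_or_ne b 0 with rfl | hb0
    · simp only [Int.emod_zero]; omega
    · have h3 := Int.emod_nonneg a hb0
      have h4 := Int.emod_lt_abs a hb0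
      rw [Int.abs_eq_natAbs] at h4
      omega

theorem foldl_range_succ {α : Type*} (f : α → ℕ → α) (c : α) (n : ℕ) :
    (List.range (n + 1)).foldl f c = f ((List.range n).foldl f c) n := by
  rw [List.range_succ, List.foldl_append]; rfl

/-- The accumulator of a loop may become exponentially large, as in a factorial, but its length
stays polynomial in the number of rounds and in the length of the summands or factors. -/
theorem bitLength_foldl_le (o : RamOp) (c : ℤ) (f : ℕ → ℤ) (M n : ℕ)
    (h : ∀ i < n, bitLength (f i) ≤ M) :
    bitLength ((List.range n).foldl (fun a i => o.apply a (f i)) c) ≤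
      bitLength c + n * (M + 1) := by
  induction n with
  | zero => simp
  | succ n ih =>
    rw [foldl_range_succ]
    have h1 := bitLength_apply_le o ((List.range n).foldl (fun a i => o.apply a (f i)) c) (f n)
    have h2 := h n (by omega)
    have h3 := ih fun i hi => h i (by omega)
    linarith [add_mul n 1 (M + 1)]

/-- Running a loop with an invariant. -/
theorem exists_ramExec_whilePos {e : RamExpr} {P : RamProg} {n M : ℕ} (Inv : ℕ → RamState → Prop)
    (hstep : ∀ i < n, ∀ s, Inv i s → 0 < e.eval s ∧
      ∃ s' t, RamExec P s s' t ∧ t ≤ M ∧ Inv (i + 1) s')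
    (hcost : ∀ i ≤ n, ∀ s, Inv i s → e.cost s ≤ M)
    (hend : ∀ s, Inv n s → ¬ 0 < e.eval s) (s : RamState) (hs : Inv 0 s) :
    ∃ s' t, RamExec (.whilePos e P) s s' t ∧ t ≤ (n + 1) * (2 * M + 1) ∧ Inv n s' := by
  -- The induction is on the number `m` of rounds that are left.
  have key : ∀ m i, i + m = n → ∀ s, Inv i s →
      ∃ s' t, RamExec (.whilePos e P) s s' t ∧ t ≤ (m + 1) * (2 * M + 1) ∧ Inv n s' := by
    intro m
    induction m with
    | zero =>
      intro i hi s hs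
      obtain rfl : i = n := by omega
      exact ⟨s, _, .whilePos_false (hend s hs), by have := hcost i le_rfl s hs; omega, hs⟩
    | succ m ih =>
      intro i hi s hs
      obtain ⟨hpos, s', t, hP, ht, hs'⟩ := hstep i (by omega) s hs
      obtain ⟨s'', t', hW, ht', hs''⟩ := ih (i + 1) (by omega) s' hs'
      refine ⟨s'', _, .whilePos_true hpos hP hW, ?_, hs''⟩
      have := hcost i (by omega) s hs
      have : (m + 1 + 1) * (2 * M + 1) = (m + 1) * (2 * M + 1) + (2 * M + 1) := by ring
      omega
  exact key n 0 (by omega) s hs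

/-- The result of storing a temporary value. -/
def RamState.setTemp (s : RamState) (k : ℕ) (a : ℤ) : RamState :=
  { s with arrays := Function.update s.arrays 0 (Function.update (s.arrays 0) k a) }

/-- The result of an assignment. -/
def RamState.setVar (s : RamState) (x : ℕ) (a : ℤ) : RamState :=
  { s with vars := Function.update s.vars x a }

/-- The content of a temporary cell. -/
def RamState.temp (s : RamState) (k : ℕ) : ℤ := s.arrays 0 k

@[simp] theorem RamState.temp_setTemp (s : RamState) (k j : ℕ) (a : ℤ) :
    (s.setTemp k a).temp j = if j = k then a else s.temp j := by
  by_cases h : j = k <;> simp [RamState.temp, RamState.setTemp, h]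

@[simp] theorem RamState.vars_setTemp (s : RamState) (k : ℕ) (a : ℤ) :
    (s.setTemp k a).vars = s.vars := rfl

@[simp] theorem RamState.output_setTemp (s : RamState) (k : ℕ) (a : ℤ) :
    (s.setTemp k a).output = s.output := rfl

@[simp] theorem RamState.temp_setVar (s : RamState) (x j : ℕ) (a : ℤ) :
    (s.setVar x a).temp j = s.temp j := rfl

@[simp] theorem RamState.vars_setVar (s : RamState) (x : ℕ) (a : ℤ) :
    (s.setVar x a).vars = Function.update s.vars x a := rfl

@[simp] theorem RamState.output_setVar (s : RamState) (x : ℕ) (a : ℤ) :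
    (s.setVar x a).output = s.output := rfl

@[simp] theorem eval_tempCell (s : RamState) (k : ℕ) : (tempCell k).eval s = s.temp k := rfl

theorem cost_tempCell (s : RamState) (k : ℕ) :
    (tempCell k).cost s ≤ 2 + 2 * k + bitLength (s.temp k) := by
  have h := bitLength_le_natAbs (k : ℤ)
  simp only [tempCell, RamExpr.cost, RamExpr.eval, RamState.temp]
  simp only [Int.natAbs_natCast] at h
  omega

theorem ramExec_tempStore (s : RamState) (k : ℕ) (e : RamExpr) :
    ∃ t, RamExec (tempStore k e) s (s.setTemp k (e.eval s)) t ∧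
      t ≤ e.cost s + 2 + 2 * k + bitLength (e.eval s) := by
  refine ⟨_, .store 0 (.const k) e s, ?_⟩
  have h := bitLength_le_natAbs (k : ℤ)
  simp only [RamExpr.cost, RamExpr.eval, Int.natAbs_natCast] at h ⊢
  omega

theorem ramExec_assign (s : RamState) (x : ℕ) (e : RamExpr) :
    RamExec (.assign x e) s (s.setVar x (e.eval s)) (e.cost s + 1 + bitLength (e.eval s)) :=
  .assign x e s

theorem natAbs_update_le {v : ℕ → ℤ} {V : ℕ} (h : ∀ x, (v x).natAbs ≤ V) (x : ℕ) {a : ℤ}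
    (ha : a.natAbs ≤ V) (y : ℕ) : (Function.update v x a y).natAbs ≤ V := by
  by_cases hy : y = x
  · subst hy; simpa using ha
  · simpa [hy] using h y

theorem le_pow_of_le_pow {V a b : ℕ} (hV : 2 ≤ V) {t : ℕ} (h : t ≤ V ^ a) (hab : a ≤ b) :
    t ≤ V ^ b := h.trans (Nat.pow_le_pow_right (by omega) hab)

theorem le_pow_self_of_two_le {V : ℕ} (hV : 2 ≤ V) (a : ℕ) : a ≤ V ^ a :=
  (Nat.lt_pow_self (by omega)).le

/-- Absorbs the numerical constants of the time bounds below into the exponent. -/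
theorem mul_pow_three_le {W : ℕ} (hW : 2 ≤ W) : 64 * W ^ 3 ≤ W ^ 9 := by
  have : 2 ^ 6 ≤ W ^ 6 := Nat.pow_le_pow_left hW 6
  calc 64 * W ^ 3 ≤ W ^ 6 * W ^ 3 := Nat.mul_le_mul_right _ this
    _ = W ^ 9 := by ring

/-- The compiled program computes the value, in time polynomial in a bound for the variables. -/
theorem FoldExpr.exists_ramExec_compile (e : FoldExpr) : ∀ k : ℕ, ∃ c : ℕ, ∀ V : ℕ, 2 ≤ V →
    ∀ s : RamState, (∀ x, (s.vars x).natAbs ≤ V) →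
      bitLength (e.eval s.vars) ≤ V ^ c ∧
      ∃ s' t, RamExec (e.compile k) s s' t ∧ t ≤ V ^ c ∧ s'.vars = s.vars ∧
        s'.output = s.output ∧ (∀ i < k, s'.temp i = s.temp i) ∧ s'.temp k = e.eval s.vars := by
  induction e with
  | const a =>
    intro k
    refine ⟨2 * bitLength a + 3 + 2 * k, fun V hV s _ => ?_⟩
    have h0 := le_pow_self_of_two_le hV (2 * bitLength a + 3 + 2 * k)
    obtain ⟨t, ht, ht'⟩ := ramExec_tempStore s k (.const a)
    refine ⟨by simp only [FoldExpr.eval]; omega, _, t, ht, ?_, rfl, rfl, ?_, ?_⟩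
    · simp only [RamExpr.cost, RamExpr.eval] at ht'; omega
    · intro i hi; simp [hi.ne]
    · simp [FoldExpr.eval, RamExpr.eval]
  | var x =>
    intro k
    refine ⟨(3 + 2 * k) + 2, fun V hV s hs => ?_⟩
    have h0 := le_pow_self_of_two_le hV (3 + 2 * k)
    have h1 : bitLength (s.vars x) ≤ V := (bitLength_le_natAbs _).trans (hs x)
    have h2 : (3 + 2 * k) + 2 * V ≤ V ^ ((3 + 2 * k) + 2) := by
      rw [pow_add]
      have : 1 ≤ V ^ (3 + 2 * k) := Nat.one_le_pow _ _ (by omega)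
      have h3 : 2 * V ≤ V ^ 2 := by nlinarith
      nlinarith
    obtain ⟨t, ht, ht'⟩ := ramExec_tempStore s k (.var x)
    refine ⟨by simp only [FoldExpr.eval]; omega, _, t, ht, ?_, rfl, rfl, ?_, ?_⟩
    · simp only [RamExpr.cost, RamExpr.eval] at ht'; omega
    · intro i hi; simp [hi.ne]
    · simp [FoldExpr.eval, RamExpr.eval]
  | op o e₁ e₂ ih₁ ih₂ =>
    intro k
    obtain ⟨c₁, h₁⟩ := ih₁ k
    obtain ⟨c₂, h₂⟩ := ih₂ (k + 1)
    refine ⟨(c₁ + c₂ + (k + 1)) * 9, fun V hV s hs => ?_⟩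
    obtain ⟨hb₁, s₁, t₁, hr₁, ht₁, hv₁, ho₁, hc₁, he₁⟩ := h₁ V hV s hs
    obtain ⟨hb₂, s₂, t₂, hr₂, ht₂, hv₂, ho₂, hc₂, he₂⟩ := h₂ V hV s₁ (by rwa [hv₁])
    rw [hv₁] at hb₂ he₂
    set W := V ^ (c₁ + c₂ + (k + 1)) with hW
    have hW2 : 2 ≤ W := hV.trans (by
      calc V = V ^ 1 := (pow_one V).symm
        _ ≤ W := Nat.pow_le_pow_right (by omega) (by omega))
    have hw₁ : V ^ c₁ ≤ W := Nat.pow_le_pow_right (by omega) (by omega)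
    have hw₂ : V ^ c₂ ≤ W := Nat.pow_le_pow_right (by omega) (by omega)
    have hwk : k + 1 ≤ W := le_pow_of_le_pow hV (le_pow_self_of_two_le hV _) (by omega)
    have h3 := mul_pow_three_le hW2
    have h4 : W ≤ W ^ 3 := Nat.le_self_pow (by norm_num) W
    have h5 := bitLength_apply_le o (e₁.eval s.vars) (e₂.eval s.vars)
    rw [pow_mul, ← hW]
    obtain ⟨t, ht, ht'⟩ := ramExec_tempStore s₂ k (.op o (tempCell k) (tempCell (k + 1)))
    have h6 : s₂.temp k = e₁.eval s.vars := by rw [hc₂ k (by omega), he₁]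
    have h7 := cost_tempCell s₂ k
    have h8 := cost_tempCell s₂ (k + 1)
    simp only [RamExpr.cost, RamExpr.eval, eval_tempCell, he₂, h6] at ht ht' h7 h8
    refine ⟨by simp only [FoldExpr.eval]; omega, _, _, hr₁.seq (hr₂.seq ht), by omega,
      by simp [hv₂, hv₁], by simp [ho₂, ho₁], ?_, by simp [FoldExpr.eval]⟩
    intro i hi
    simp [hi.ne, hc₂ i (by omega), hc₁ i hi]
  | ite e e₁ e₂ ih ih₁ ih₂ =>
    intro k
    obtain ⟨c₀, h₀⟩ := ih k
    obtain ⟨c₁, h₁⟩ := ih₁ k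
    obtain ⟨c₂, h₂⟩ := ih₂ k
    refine ⟨(c₀ + c₁ + c₂ + (k + 1)) * 9, fun V hV s hs => ?_⟩
    obtain ⟨hb₀, s₀, t₀, hr₀, ht₀, hv₀, ho₀, hc₀, he₀⟩ := h₀ V hV s hs
    set W := V ^ (c₀ + c₁ + c₂ + (k + 1)) with hW
    have hW2 : 2 ≤ W := hV.trans (by
      calc V = V ^ 1 := (pow_one V).symm
        _ ≤ W := Nat.pow_le_pow_right (by omega) (by omega))
    have hw₀ : V ^ c₀ ≤ W := Nat.pow_le_pow_right (by omega) (by omega)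
    have hw₁ : V ^ c₁ ≤ W := Nat.pow_le_pow_right (by omega) (by omega)
    have hw₂ : V ^ c₂ ≤ W := Nat.pow_le_pow_right (by omega) (by omega)
    have hwk : k + 1 ≤ W := le_pow_of_le_pow hV (le_pow_self_of_two_le hV _) (by omega)
    have h3 := mul_pow_three_le hW2
    have h4 : W ≤ W ^ 3 := Nat.le_self_pow (by norm_num) W
    have h7 := cost_tempCell s₀ k
    rw [he₀] at h7
    rw [pow_mul, ← hW]
    by_cases hpos : 0 < e.eval s.vars
    · obtain ⟨hb₁, s₁, t₁, hr₁, ht₁, hv₁, ho₁, hc₁, he₁⟩ := h₁ V hV s₀ (by rwa [hv₀])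
      rw [hv₀] at hb₁ he₁
      refine ⟨by simp only [FoldExpr.eval, hpos, if_true]; omega, _, _,
        hr₀.seq (.ifPos_true (by simpa [he₀] using hpos) hr₁), by omega,
        by simp [hv₁, hv₀], by simp [ho₁, ho₀], fun i hi => by rw [hc₁ i hi, hc₀ i hi],
        by simp [FoldExpr.eval, hpos, he₁]⟩
    · obtain ⟨hb₁, s₁, t₁, hr₁, ht₁, hv₁, ho₁, hc₁, he₁⟩ := h₂ V hV s₀ (by rwa [hv₀])
      rw [hv₀] at hb₁ he₁
      refine ⟨by simp only [FoldExpr.eval, hpos, if_false]; omega, _, _,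
        hr₀.seq (.ifPos_false (by simpa [he₀] using hpos) hr₁), by omega,
        by simp [hv₁, hv₀], by simp [ho₁, ho₀], fun i hi => by rw [hc₁ i hi, hc₀ i hi],
        by simp [FoldExpr.eval, hpos, he₁]⟩
  | fold o c x b e ih =>
    intro k
    obtain ⟨c₁, h₁⟩ := ih (k + 3)
    refine ⟨(c₁ + bitLength c + (k + 3) + 1) * 2 * 9, fun V hV s hs => ?_⟩
    set U := V ^ (c₁ + bitLength c + (k + 3) + 1) with hU
    have hUV : V ≤ U := by
      calc V = V ^ 1 := (pow_one V).symm
        _ ≤ U := Nat.pow_le_pow_right (by omega) (by omega)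
    have hU1 : V ^ c₁ ≤ U := Nat.pow_le_pow_right (by omega) (by omega)
    have hU2 : bitLength c ≤ U := le_pow_of_le_pow hV (le_pow_self_of_two_le hV _) (by omega)
    have hU3 : k + 3 ≤ U := le_pow_of_le_pow hV (le_pow_self_of_two_le hV _) (by omega)
    set n := (s.vars b).toNat with hn
    have hnV : n ≤ V := by have := hs b; omega
    set acc : ℕ → ℤ := fun m => (List.range m).foldl
      (fun a (i : ℕ) => o.apply a (e.eval (Function.update s.vars x i))) c with hacc
    have hbody : ∀ i ≤ n, ∀ y, (Function.update s.vars x (i : ℤ) y).natAbs ≤ V := fun i hi =>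
      natAbs_update_le hs x (by simp; omega)
    have hbitbody : ∀ i < n, bitLength (e.eval (Function.update s.vars x (i : ℤ))) ≤ V ^ c₁ :=
      fun i hi => (h₁ V hV (s.setVar x i) (hbody i hi.le)).1
    -- `W` is the square of `U`: there are at most `V ≤ U` rounds, and each adds at most `V ^ c₁ + 1
    -- ≤ U + 1` bits to the accumulator.
    set W := V ^ ((c₁ + bitLength c + (k + 3) + 1) * 2) with hW
    have hWU : W = U * U := by rw [hW, pow_mul, ← hU, sq]
    have hU4 : 4 ≤ U := by
      have : 2 ^ 2 ≤ V ^ (c₁ + bitLength c + (k + 3) + 1) :=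
        (Nat.pow_le_pow_left hV 2).trans (Nat.pow_le_pow_right (by omega) (by omega))
      omega
    have hUW : 4 * U ≤ W := by rw [hWU]; exact Nat.mul_le_mul_right _ hU4
    have hbitacc : ∀ i ≤ n, bitLength (acc i) ≤ 2 * W := by
      intro i hi
      have h := bitLength_foldl_le o c (fun i : ℕ => e.eval (Function.update s.vars x (i : ℤ)))
        (V ^ c₁) i (fun j hj => hbitbody j (by omega))
      have h' : i * (V ^ c₁ + 1) ≤ U * U + U := by
        have : i * (V ^ c₁ + 1) ≤ U * (U + 1) := Nat.mul_le_mul (by omega) (by omega)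
        linarith
      simp only [hacc]
      omega
    have hW3 : W ≤ W ^ 2 := Nat.le_self_pow (by norm_num) W
    have h3 := mul_pow_three_le (W := W) (by omega)
    rw [pow_mul, ← hW]
    -- the initial assignments
    obtain ⟨t₁, hr₁, ht₁⟩ := ramExec_tempStore s k (.const c)
    set s₁ := s.setTemp k ((RamExpr.const c).eval s) with hs₁
    obtain ⟨t₂, hr₂, ht₂⟩ := ramExec_tempStore s₁ (k + 1) (.var x)
    set s₂ := s₁.setTemp (k + 1) ((RamExpr.var x).eval s₁) with hs₂
    obtain ⟨t₃, hr₃, ht₃⟩ := ramExec_tempStore s₂ (k + 2) (.var b)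
    set s₃ := s₂.setTemp (k + 2) ((RamExpr.var b).eval s₂) with hs₃
    have hr₄ := ramExec_assign s₃ x (.const 0)
    set s₄ := s₃.setVar x ((RamExpr.const 0).eval s₃) with hs₄
    -- the loop
    have hvx : bitLength (s.vars x) ≤ V := (bitLength_le_natAbs _).trans (hs x)
    have hvb : bitLength (s.vars b) ≤ V := (bitLength_le_natAbs _).trans (hs b)
    have hbi : ∀ i ≤ n + 1, bitLength (i : ℤ) ≤ 2 * U := fun i hi => by
      have := bitLength_le_natAbs (i : ℤ)
      simp only [Int.natAbs_natCast] at this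
      omega
    obtain ⟨s₅, t₅, hr₅, ht₅, hv₅, ho₅, hc₅, hk₅, hk₅', hk₅''⟩ :=
      exists_ramExec_whilePos (e := .op .sub (tempCell (k + 2)) (.var x))
      (P := .seq (e.compile (k + 3)) (.seq (tempStore k (.op o (tempCell k) (tempCell (k + 3))))
                (.assign x (.op .add (.var x) (.const 1)))))
      (n := n) (M := 15 * W)
      (fun i s' => s'.vars = Function.update s.vars x (i : ℤ) ∧ s'.output = s.output ∧
        (∀ j < k, s'.temp j = s.temp j) ∧ s'.temp k = acc i ∧ s'.temp (k + 1) = s.vars x ∧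
        s'.temp (k + 2) = s.vars b)
      (by
        rintro i hi s' ⟨hv, ho, hc, hk, hk', hk''⟩
        refine ⟨?_, ?_⟩
        · simp only [RamExpr.eval, RamOp.apply, eval_tempCell, hk'', hv, Function.update_self]
          omega
        obtain ⟨hb₁, s₁, t₁, hr₁, ht₁, hv₁, ho₁, hc₁, he₁⟩ := h₁ V hV s'
          (by rw [hv]; exact hbody i hi.le)
        rw [hv] at hb₁ he₁ hv₁
        obtain ⟨t₂, hr₂, ht₂⟩ := ramExec_tempStore s₁ k (.op o (tempCell k) (tempCell (k + 3)))
        have hk₁ : s₁.temp k = acc i := by rw [hc₁ k (by omega), hk]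
        have hacc' : o.apply (acc i) (e.eval (Function.update s.vars x (i : ℤ))) = acc (i + 1) := by
          simp only [hacc, foldl_range_succ]
        have h6 := cost_tempCell s₁ k
        have h7 := cost_tempCell s₁ (k + 3)
        have h8 := hbitacc i hi.le
        have h9 := hbitacc (i + 1) hi
        simp only [RamExpr.cost, RamExpr.eval, eval_tempCell, he₁, hk₁, hacc'] at hr₂ ht₂ h6 h7
        have hr₃ := ramExec_assign (s₁.setTemp k (acc (i + 1))) x (.op .add (.var x) (.const 1))
        have h10 := hbi i (by omega)
        have h11 := hbi (i + 1) (by omega)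
        have h12 : bitLength 1 = 1 := by decide
        push_cast at h11
        simp only [RamExpr.cost, RamExpr.eval, RamOp.apply, RamState.vars_setTemp, hv₁,
          Function.update_self] at hr₃
        refine ⟨_, _, hr₁.seq (hr₂.seq hr₃), by omega, ?_, ?_, ?_, ?_, ?_, ?_⟩
        · simp [hv₁]
        · simp [ho₁, ho]
        · intro j hj
          simp [hj.ne, hc₁ j (by omega), hc j hj]
        · simp
        · simp [hc₁ (k + 1) (by omega), hk']
        · simp [hc₁ (k + 2) (by omega), hk''])
      (by
        rintro i hi s' ⟨hv, ho, hc, hk, hk', hk''⟩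
        have h7 := cost_tempCell s' (k + 2)
        have h10 := hbi i (by omega)
        simp only [RamExpr.cost, RamExpr.eval, eval_tempCell, hk'', hv, Function.update_self]
          at h7 ⊢
        omega)
      (by
        rintro s' ⟨hv, ho, hc, hk, hk', hk''⟩
        simp only [RamExpr.eval, RamOp.apply, eval_tempCell, hk'', hv, Function.update_self]
        omega)
      s₄ (by
        refine ⟨by simp [hs₄, hs₃, hs₂, hs₁, RamExpr.eval], rfl, fun j hj => ?_, ?_, ?_, ?_⟩
        · simp [hs₄, hs₃, hs₂, hs₁, show j ≠ k by omega, show j ≠ k + 1 by omega,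
            show j ≠ k + 2 by omega]
        · simp [hs₄, hs₃, hs₂, hs₁, hacc, RamExpr.eval]
        · simp [hs₄, hs₃, hs₂, hs₁, RamExpr.eval]
        · simp [hs₄, hs₃, hs₂, hs₁, RamExpr.eval])
    have hr₆ := ramExec_assign s₅ x (tempCell (k + 1))
    have h13 := cost_tempCell s₅ (k + 1)
    have h14 : bitLength 0 = 0 := by decide
    have h15 : (n + 1) * (2 * (15 * W) + 1) ≤ 32 * W ^ 2 := by
      have : (n + 1) * (2 * (15 * W) + 1) ≤ W * (32 * W) := Nat.mul_le_mul (by omega) (by omega)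
      linarith [sq W]
    have h16 : 64 * W ^ 2 ≤ W ^ 9 := by
      have : W ^ 2 ≤ W ^ 3 := Nat.pow_le_pow_right (by omega) (by norm_num)
      omega
    simp only [RamExpr.cost, RamExpr.eval, hs₁, hs₂, hs₃, RamState.vars_setTemp] at ht₁ ht₂ ht₃ hr₄
    simp only [eval_tempCell, hk₅'] at hr₆ h13
    rw [h14] at hr₄
    have h17 := hbitacc n le_rfl
    refine ⟨?_, _, _, hr₁.seq (hr₂.seq (hr₃.seq (hr₄.seq (hr₅.seq hr₆)))), by omega,
      ?_, by simp [ho₅], ?_, ?_⟩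
    · have : bitLength (acc n) ≤ W ^ 9 := by omega
      exact this
    · simp [hv₅]
    · intro j hj; simp [hc₅ j hj]
    · simp only [RamState.temp_setVar, hk₅]; rfl

/-! ### Programs that print lists -/

/-- Printing programs: `forRange x b o` runs `o` for the variable `x` running from `0` to
(excluding) the value of the variable `b`, and `bind x e o` runs `o` with `x` set to the value
of `e`. -/
inductive Printer where
  | emit (e : FoldExpr)
  | seq (o₁ o₂ : Printer)
  | forRange (x b : ℕ) (o : Printer)
  | bind (x : ℕ) (e : FoldExpr) (o : Printer)

/-- The list of numbers printed. -/
def Printer.out : Printer → (ℕ → ℤ) → List ℤ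
  | .emit e, v => [e.eval v]
  | .seq o₁ o₂, v => o₁.out v ++ o₂.out v
  | .forRange x b o, v => (List.range (v b).toNat).flatMap fun i : ℕ =>
      o.out (Function.update v x i)
  | .bind x e o, v => o.out (Function.update v x (e.eval v))

/-- All the values that are bound to variables are at most `V`. -/
def Printer.BoundedBy (V : ℕ) : Printer → (ℕ → ℤ) → Prop
  | .emit _, _ => True
  | .seq o₁ o₂, v => o₁.BoundedBy V v ∧ o₂.BoundedBy V v
  | .forRange x b o, v => ∀ i < (v b).toNat, o.BoundedBy V (Function.update v x (i : ℤ))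
  | .bind x e o, v => (e.eval v).natAbs ≤ V ∧ o.BoundedBy V (Function.update v x (e.eval v))

/-- The program of the random access machine. -/
def Printer.compile : Printer → ℕ → RamProg
  | .emit e, k => .seq (e.compile k) (.emit (tempCell k))
  | .seq o₁ o₂, k => .seq (o₁.compile k) (o₂.compile k)
  | .forRange x b o, k =>
      .seq (tempStore k (.var x)) (.seq (tempStore (k + 1) (.var b)) (.seq (.assign x (.const 0))
        (.seq (.whilePos (.op .sub (tempCell (k + 1)) (.var x))
            (.seq (o.compile (k + 2)) (.assign x (.op .add (.var x) (.const 1)))))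
          (.assign x (tempCell k)))))
  | .bind x e o, k =>
      .seq (tempStore k (.var x)) (.seq (e.compile (k + 1)) (.seq (.assign x (tempCell (k + 1)))
        (.seq (o.compile (k + 1)) (.assign x (tempCell k)))))

/-- The compiled program prints the list, in time polynomial in a bound for the variables. -/
theorem Printer.exists_ramExec_compile (o : Printer) : ∀ k : ℕ, ∃ c : ℕ, ∀ V : ℕ, 2 ≤ V →
    ∀ s : RamState, (∀ x, (s.vars x).natAbs ≤ V) → o.BoundedBy V s.vars →
      ∃ s' t, RamExec (o.compile k) s s' t ∧ t ≤ V ^ c ∧ s'.vars = s.vars ∧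
        s'.output = s.output ++ o.out s.vars ∧ (∀ i < k, s'.temp i = s.temp i) := by
  induction o with
  | emit e =>
    intro k
    obtain ⟨c, h⟩ := e.exists_ramExec_compile k
    refine ⟨(c + (k + 1)) * 9, fun V hV s hs _ => ?_⟩
    obtain ⟨hb, s₁, t₁, hr₁, ht₁, hv₁, ho₁, hc₁, he₁⟩ := h V hV s hs
    set W := V ^ (c + (k + 1)) with hW
    have hW2 : 2 ≤ W := hV.trans (by
      calc V = V ^ 1 := (pow_one V).symm
        _ ≤ W := Nat.pow_le_pow_right (by omega) (by omega))
    have hw : V ^ c ≤ W := Nat.pow_le_pow_right (by omega) (by omega)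
    have hwk : k + 1 ≤ W := le_pow_of_le_pow hV (le_pow_self_of_two_le hV _) (by omega)
    have h3 := mul_pow_three_le hW2
    have h4 : W ≤ W ^ 3 := Nat.le_self_pow (by norm_num) W
    have h7 := cost_tempCell s₁ k
    rw [he₁] at h7
    rw [pow_mul, ← hW]
    refine ⟨_, _, hr₁.seq (.emit _ _), ?_, hv₁, ?_, hc₁⟩
    · simp only [eval_tempCell, he₁]; omega
    · simp [Printer.out, ho₁, he₁]
  | seq o₁ o₂ ih₁ ih₂ =>
    intro k
    obtain ⟨c₁, h₁⟩ := ih₁ k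
    obtain ⟨c₂, h₂⟩ := ih₂ k
    refine ⟨c₁ + c₂ + 2, fun V hV s hs hB => ?_⟩
    obtain ⟨s₁, t₁, hr₁, ht₁, hv₁, ho₁, hc₁⟩ := h₁ V hV s hs hB.1
    obtain ⟨s₂, t₂, hr₂, ht₂, hv₂, ho₂, hc₂⟩ := h₂ V hV s₁ (by rwa [hv₁]) (by rw [hv₁]; exact hB.2)
    refine ⟨s₂, _, hr₁.seq hr₂, ?_, by rw [hv₂, hv₁], ?_, fun i hi => by rw [hc₂ i hi, hc₁ i hi]⟩
    · have hw₁ : V ^ c₁ ≤ V ^ (c₁ + c₂) := Nat.pow_le_pow_right (by omega) (by omega)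
      have hw₂ : V ^ c₂ ≤ V ^ (c₁ + c₂) := Nat.pow_le_pow_right (by omega) (by omega)
      have : 1 ≤ V ^ (c₁ + c₂) := Nat.one_le_pow _ _ (by omega)
      have h4 : 2 ^ 2 ≤ V ^ 2 := Nat.pow_le_pow_left hV 2
      rw [pow_add _ _ 2]
      nlinarith
    · rw [ho₂, ho₁, hv₁, List.append_assoc]; rfl
  | forRange x b o ih =>
    intro k
    obtain ⟨c₁, h₁⟩ := ih (k + 2)
    refine ⟨(c₁ + (k + 3) + 1) * 9, fun V hV s hs hB => ?_⟩
    set W := V ^ (c₁ + (k + 3) + 1) with hW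
    have hVW : V ≤ W := by
      calc V = V ^ 1 := (pow_one V).symm
        _ ≤ W := Nat.pow_le_pow_right (by omega) (by omega)
    have hW1 : V ^ c₁ ≤ W := Nat.pow_le_pow_right (by omega) (by omega)
    have hW2 : k + 3 ≤ W := le_pow_of_le_pow hV (le_pow_self_of_two_le hV _) (by omega)
    set n := (s.vars b).toNat with hn
    have hnV : n ≤ V := by have := hs b; omega
    have hbody : ∀ i ≤ n, ∀ y, (Function.update s.vars x (i : ℤ) y).natAbs ≤ V := fun i hi =>
      natAbs_update_le hs x (by simp; omega)
    have h3 := mul_pow_three_le (W := W) (by omega)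
    rw [pow_mul, ← hW]
    obtain ⟨t₂, hr₂, ht₂⟩ := ramExec_tempStore s k (.var x)
    set s₂ := s.setTemp k ((RamExpr.var x).eval s) with hs₂
    obtain ⟨t₃, hr₃, ht₃⟩ := ramExec_tempStore s₂ (k + 1) (.var b)
    set s₃ := s₂.setTemp (k + 1) ((RamExpr.var b).eval s₂) with hs₃
    have hr₄ := ramExec_assign s₃ x (.const 0)
    set s₄ := s₃.setVar x ((RamExpr.const 0).eval s₃) with hs₄
    have hvx : bitLength (s.vars x) ≤ V := (bitLength_le_natAbs _).trans (hs x)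
    have hvb : bitLength (s.vars b) ≤ V := (bitLength_le_natAbs _).trans (hs b)
    have hbi : ∀ i ≤ n + 1, bitLength (i : ℤ) ≤ 2 * W := fun i hi => by
      have := bitLength_le_natAbs (i : ℤ)
      simp only [Int.natAbs_natCast] at this
      omega
    obtain ⟨s₅, t₅, hr₅, ht₅, hv₅, ho₅, hc₅, hk₅, hk₅'⟩ :=
      exists_ramExec_whilePos (e := .op .sub (tempCell (k + 1)) (.var x))
      (P := .seq (o.compile (k + 2)) (.assign x (.op .add (.var x) (.const 1))))
      (n := n) (M := 15 * W)
      (fun i s' => s'.vars = Function.update s.vars x (i : ℤ) ∧ s'.output = s.output ++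
          ((List.range i).flatMap fun i : ℕ => o.out (Function.update s.vars x i)) ∧
        (∀ j < k, s'.temp j = s.temp j) ∧ s'.temp k = s.vars x ∧
        s'.temp (k + 1) = s.vars b)
      (by
        rintro i hi s' ⟨hv, ho, hc, hk', hk''⟩
        refine ⟨?_, ?_⟩
        · simp only [RamExpr.eval, RamOp.apply, eval_tempCell, hk'', hv, Function.update_self]
          omega
        obtain ⟨s₁, t₁, hr₁, ht₁, hv₁, ho₁, hc₁⟩ := h₁ V hV s'
          (by rw [hv]; exact hbody i hi.le) (by rw [hv]; exact hB i hi)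
        rw [hv] at hv₁ ho₁
        have hr₃ := ramExec_assign s₁ x (.op .add (.var x) (.const 1))
        have h10 := hbi i (by omega)
        have h11 := hbi (i + 1) (by omega)
        have h12 : bitLength 1 = 1 := by decide
        push_cast at h11
        simp only [RamExpr.cost, RamExpr.eval, RamOp.apply, hv₁, Function.update_self] at hr₃
        refine ⟨_, _, hr₁.seq hr₃, by omega, ?_, ?_, ?_, ?_, ?_⟩
        · simp [hv₁]
        · simp [ho₁, ho, List.range_succ]
        · intro j hj
          simp [hc₁ j (by omega), hc j hj]
        · simp [hc₁ k (by omega), hk']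
        · simp [hc₁ (k + 1) (by omega), hk''])
      (by
        rintro i hi s' ⟨hv, ho, hc, hk', hk''⟩
        have h7 := cost_tempCell s' (k + 1)
        have h10 := hbi i (by omega)
        simp only [RamExpr.cost, RamExpr.eval, eval_tempCell, hk'', hv, Function.update_self]
          at h7 ⊢
        omega)
      (by
        rintro s' ⟨hv, ho, hc, hk', hk''⟩
        simp only [RamExpr.eval, RamOp.apply, eval_tempCell, hk'', hv, Function.update_self]
        omega)
      s₄ (by
        refine ⟨by simp [hs₄, hs₃, hs₂, RamExpr.eval], by simp [hs₄, hs₃, hs₂],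
          fun j hj => ?_, ?_, ?_⟩
        · simp [hs₄, hs₃, hs₂, show j ≠ k by omega, show j ≠ k + 1 by omega]
        · simp [hs₄, hs₃, hs₂, RamExpr.eval]
        · simp [hs₄, hs₃, hs₂, RamExpr.eval])
    have hr₆ := ramExec_assign s₅ x (tempCell k)
    have h13 := cost_tempCell s₅ k
    have h14 : bitLength 0 = 0 := by decide
    have h15 : (n + 1) * (2 * (15 * W) + 1) ≤ 33 * W ^ 2 := by
      have h16 : 2 ^ 4 ≤ V ^ (c₁ + (k + 3) + 1) :=
        (Nat.pow_le_pow_left hV 4).trans (Nat.pow_le_pow_right (by omega) (by omega))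
      have : (n + 1) * (2 * (15 * W) + 1) ≤ (W + 1) * (31 * W) :=
        Nat.mul_le_mul (by omega) (by omega)
      nlinarith
    have h16 : 64 * W ^ 2 ≤ W ^ 9 := by
      have : W ^ 2 ≤ W ^ 3 := Nat.pow_le_pow_right (by omega) (by norm_num)
      omega
    have hWW : W ≤ W ^ 2 := Nat.le_self_pow (by norm_num) W
    simp only [RamExpr.cost, RamExpr.eval, hs₂, hs₃, RamState.vars_setTemp] at ht₂ ht₃ hr₄
    simp only [eval_tempCell, hk₅] at hr₆ h13
    rw [h14] at hr₄
    refine ⟨_, _, hr₂.seq (hr₃.seq (hr₄.seq (hr₅.seq hr₆))), by omega, ?_, ?_, ?_⟩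
    · simp [hv₅]
    · simp [ho₅, Printer.out, hn]
    · intro j hj; simp [hc₅ j hj]
  | bind x e o ih =>
    intro k
    obtain ⟨c, h⟩ := e.exists_ramExec_compile (k + 1)
    obtain ⟨c₁, h₁⟩ := ih (k + 1)
    refine ⟨(c + c₁ + (k + 3) + 1) * 9, fun V hV s hs hB => ?_⟩
    set W := V ^ (c + c₁ + (k + 3) + 1) with hW
    have hVW : V ≤ W := by
      calc V = V ^ 1 := (pow_one V).symm
        _ ≤ W := Nat.pow_le_pow_right (by omega) (by omega)
    have hW0 : V ^ c ≤ W := Nat.pow_le_pow_right (by omega) (by omega)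
    have hW1 : V ^ c₁ ≤ W := Nat.pow_le_pow_right (by omega) (by omega)
    have hW2 : k + 3 ≤ W := le_pow_of_le_pow hV (le_pow_self_of_two_le hV _) (by omega)
    have h3 := mul_pow_three_le (W := W) (by omega)
    have h4 : W ≤ W ^ 3 := Nat.le_self_pow (by norm_num) W
    rw [pow_mul, ← hW]
    have hvx : bitLength (s.vars x) ≤ V := (bitLength_le_natAbs _).trans (hs x)
    obtain ⟨t₂, hr₂, ht₂⟩ := ramExec_tempStore s k (.var x)
    set s₂ := s.setTemp k ((RamExpr.var x).eval s) with hs₂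
    obtain ⟨hb₃, s₃, t₃, hr₃, ht₃, hv₃, ho₃, hc₃, he₃⟩ := h V hV s₂ hs
    have hr₄ := ramExec_assign s₃ x (tempCell (k + 1))
    have h7 := cost_tempCell s₃ (k + 1)
    have he₃' : s₃.temp (k + 1) = e.eval s.vars := he₃
    have hb₃' : bitLength (e.eval s.vars) ≤ V ^ c := hb₃
    have hv₃' : s₃.vars = s.vars := hv₃
    simp only [eval_tempCell, he₃'] at hr₄ h7
    set s₄ := s₃.setVar x (e.eval s.vars) with hs₄
    have hv₄ : s₄.vars = Function.update s.vars x (e.eval s.vars) := by simp [hs₄, hv₃']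
    obtain ⟨s₅, t₅, hr₅, ht₅, hv₅, ho₅, hc₅⟩ := h₁ V hV s₄
      (by rw [hv₄]; exact natAbs_update_le hs x hB.1) (by rw [hv₄]; exact hB.2)
    have hr₆ := ramExec_assign s₅ x (tempCell k)
    have h8 := cost_tempCell s₅ k
    have hk₅ : s₅.temp k = s.vars x := by
      rw [hc₅ k (by omega), hs₄, RamState.temp_setVar, hc₃ k (by omega), hs₂]
      simp [RamExpr.eval]
    simp only [eval_tempCell, hk₅] at hr₆ h8
    simp only [RamExpr.cost, RamExpr.eval] at ht₂
    refine ⟨_, _, hr₂.seq (hr₃.seq (hr₄.seq (hr₅.seq hr₆))), by omega, ?_, ?_, ?_⟩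
    · simp [hv₅, hv₄]
    · simp [ho₅, hs₄, ho₃, hs₂, Printer.out, hv₃']
    · intro j hj
      rw [RamState.temp_setVar, hc₅ j (by omega), hs₄, RamState.temp_setVar, hc₃ j (by omega), hs₂]
      simp [hj.ne]

/-! ## Isolating weights -/

section Isolation

variable {κ : Type*} [Field κ] {d n : ℕ}

/-- The coefficients of the words that agree with `x` on the block `I`, as a function of the
context. -/
def blockVec (f : (Fin d → Fin n) → κ) (I : Finset (Fin d)) (x : Fin d → Fin n) :
    (Fin d → Fin n) → κ :=
  fun y => f (I.piecewise x y)

/-- The weight of the block `I` of a word. -/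
def blockWeight (w : Fin d → Fin n → ℕ) (I : Finset (Fin d)) (x : Fin d → Fin n) : ℕ :=
  ∑ k ∈ I, w k (x k)

/-- Any `R + 1` of the coefficient vectors of the block `I` are linearly dependent. -/
def BlockDependent (f : (Fin d → Fin n) → κ) (I : Finset (Fin d)) (R : ℕ) : Prop :=
  ∀ g : Fin (R + 1) → Fin d → Fin n, ∃ c : Fin (R + 1) → κ, c ≠ 0 ∧
    ∀ y, ∑ i, c i * f (I.piecewise (g i) y) = 0

/-- `C` is a set of words on the block `I` (continued by `y₀`) such that all other coefficient
vectors are combinations of vectors of smaller weight. -/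
def SpansBlock (f : (Fin d → Fin n) → κ) (y₀ : Fin d → Fin n) (w : Fin d → Fin n → ℕ)
    (I : Finset (Fin d)) (C : Finset (Fin d → Fin n)) : Prop :=
  (∀ x ∈ C, I.piecewise x y₀ = x) ∧ ∀ x, I.piecewise x y₀ ∈ C ∨
    blockVec f I x ∈ Submodule.span κ
      (blockVec f I '' {x' | blockWeight w I x' < blockWeight w I x})

theorem piecewise_piecewise_union {α : Type*} {ι : Type*} [DecidableEq ι] (L R : Finset ι)
    (a b y : ι → α) :
    (L ∪ R).piecewise a y = L.piecewise a (R.piecewise a y) ∧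
      (L ∪ R).piecewise (L.piecewise a b) y = L.piecewise a (R.piecewise b y) := by
  constructor <;> funext k <;> by_cases h1 : k ∈ L <;> by_cases h2 : k ∈ R <;>
    simp [Finset.piecewise, h1, h2]

/-- Fixing the letters on `R` to those of `x` is a linear operation on coefficient vectors, so the
relation for `L` persists. All words involved then have the same weight on `R`, and the inequality
between weights persists as well. -/
theorem blockVec_union_mem_span {f : (Fin d → Fin n) → κ} {w : Fin d → Fin n → ℕ}
    {L R : Finset (Fin d)} (hLR : Disjoint L R) {x : Fin d → Fin n}
    (hx : blockVec f L x ∈ Submodule.span κ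
      (blockVec f L '' {x' | blockWeight w L x' < blockWeight w L x})) :
    blockVec f (L ∪ R) x ∈ Submodule.span κ
      (blockVec f (L ∪ R) '' {x' | blockWeight w (L ∪ R) x' < blockWeight w (L ∪ R) x}) := by
  let Φ : ((Fin d → Fin n) → κ) →ₗ[κ] ((Fin d → Fin n) → κ) :=
    LinearMap.funLeft κ κ (fun y => R.piecewise x y)
  have h1 : Φ (blockVec f L x) = blockVec f (L ∪ R) x := by
    funext y
    simp only [Φ, LinearMap.funLeft_apply, blockVec, (piecewise_piecewise_union L R x x y).1]
  rw [← h1]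
  have h2 := Submodule.mem_map_of_mem (f := Φ) hx
  rw [Submodule.map_span] at h2
  refine Submodule.span_mono ?_ h2
  rintro _ ⟨_, ⟨x', hx', rfl⟩, rfl⟩
  refine ⟨L.piecewise x' x, ?_, ?_⟩
  · simp only [Set.mem_ofPred_eq, blockWeight, Finset.sum_union hLR] at hx' ⊢
    refine add_lt_add_of_lt_of_le ?_ (le_of_eq ?_)
    · refine lt_of_eq_of_lt (Finset.sum_congr rfl fun k hk => ?_) hx'
      simp [hk]
    · refine Finset.sum_congr rfl fun k hk => ?_
      simp [Finset.disjoint_right.1 hLR hk]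
  · funext y
    simp only [Φ, LinearMap.funLeft_apply, blockVec, (piecewise_piecewise_union L R x' x y).2]

/-- Spanning sets of two blocks give one of their union. -/
theorem SpansBlock.union {f : (Fin d → Fin n) → κ} {y₀ : Fin d → Fin n} {w : Fin d → Fin n → ℕ}
    {L R : Finset (Fin d)} (hLR : Disjoint L R) {C₁ C₂ : Finset (Fin d → Fin n)}
    (h₁ : SpansBlock f y₀ w L C₁) (h₂ : SpansBlock f y₀ w R C₂) :
    SpansBlock f y₀ w (L ∪ R) (Finset.image₂ (fun a b => L.piecewise a b) C₁ C₂) := by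
  constructor
  · intro x hx
    obtain ⟨a, ha, b, hb, rfl⟩ := Finset.mem_image₂.1 hx
    rw [(piecewise_piecewise_union L R a b y₀).2, h₂.1 b hb]
  · intro x
    -- If both parts of `x` are candidates, so is their concatenation; otherwise the relation for
    -- one part extends to the union.
    rcases h₁.2 x with h | h
    · rcases h₂.2 x with h' | h'
      · refine Or.inl (Finset.mem_image₂.2 ⟨_, h, _, h', ?_⟩)
        rw [(piecewise_piecewise_union L R x x y₀).1]
        funext k
        by_cases hk : k ∈ L <;> simp [hk]
      · right
        rw [Finset.union_comm]
        exact blockVec_union_mem_span hLR.symm h'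
    · exact Or.inr (blockVec_union_mem_span hLR h)

/-- A spanning set for a block of length at most one. -/
theorem spansBlock_of_subset_singleton {f : (Fin d → Fin n) → κ} {y₀ : Fin d → Fin n}
    {w : Fin d → Fin n → ℕ} {I : Finset (Fin d)} (hI : ∀ k ∈ I, ∀ l ∈ I, k = l) (hn : 0 < n) :
    ∃ C : Finset (Fin d → Fin n), C.card ≤ n ∧ SpansBlock f y₀ w I C := by
  refine ⟨Finset.univ.image fun j : Fin n => I.piecewise (fun _ => j) y₀,
    Finset.card_image_le.trans (by simp), ?_, fun x => Or.inl ?_⟩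
  · intro x hx
    obtain ⟨j, -, rfl⟩ := Finset.mem_image.1 hx
    simp
  · refine Finset.mem_image.2 ?_
    by_cases h : ∃ k, k ∈ I
    · obtain ⟨k, hk⟩ := h
      refine ⟨x k, Finset.mem_univ _, ?_⟩
      funext l
      by_cases hl : l ∈ I
      · obtain rfl := hI l hl k hk; simp [hl]
      · simp only [Finset.piecewise, hl, if_false]
    · refine ⟨⟨0, hn⟩, Finset.mem_univ _, ?_⟩
      funext l
      have hl : l ∉ I := fun hl => h ⟨l, hl⟩
      simp [hl]

/-- Refining the weight by one that separates the candidates, one obtains a spanning set that is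
bounded by the dimension. -/
theorem SpansBlock.exists_refinement {f : (Fin d → Fin n) → κ} {y₀ : Fin d → Fin n}
    {w w' : Fin d → Fin n → ℕ} {I : Finset (Fin d)} {C : Finset (Fin d → Fin n)} {B R : ℕ}
    (h : SpansBlock f y₀ w I C)
    (hsep : ∀ a ∈ C, ∀ b ∈ C, a ≠ b → blockWeight w' I a ≠ blockWeight w' I b)
    (hB : ∀ x, blockWeight w' I x < B) (hdep : BlockDependent f I R) :
    ∃ C' : Finset (Fin d → Fin n), C'.card ≤ R ∧
      SpansBlock f y₀ (fun k j => w' k j + B * w k j) I C' ∧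
      Set.InjOn (blockWeight (fun k j => w' k j + B * w k j) I) C' := by
  classical
  set W := blockWeight (fun k j => w' k j + B * w k j) I with hW
  have hWeq : ∀ x, W x = blockWeight w' I x + B * blockWeight w I x := fun x => by
    simp only [hW, blockWeight, Finset.sum_add_distrib, Finset.mul_sum]
  -- The old weight is the leading digit in base `B`, so it decides comparisons before the new one.
  have hWlt : ∀ x x', blockWeight w I x' < blockWeight w I x → W x' < W x := by
    intro x x' hlt
    rw [hWeq, hWeq]
    have h1 := hB x'
    have h2 : B * (blockWeight w I x' + 1) ≤ B * blockWeight w I x := Nat.mul_le_mul_left _ hlt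
    rw [mul_add] at h2
    omega
  have hinj : Set.InjOn W (C : Set (Fin d → Fin n)) := by
    intro a ha b hb hab
    by_contra hne
    refine hsep a ha b hb hne ?_
    rw [hWeq, hWeq] at hab
    have := congrArg (· % B) hab
    simpa [Nat.add_mul_mod_self_left, Nat.mod_eq_of_lt (hB _)] using this
  have hpw : ∀ x, blockVec f I (I.piecewise x y₀) = blockVec f I x ∧
      W (I.piecewise x y₀) = W x := fun x => by
    constructor
    · funext y; simp [blockVec]
    · simp only [hW, blockWeight]
      exact Finset.sum_congr rfl fun k hk => by simp [hk]
  -- Keeping only the candidates that are not combinations of lighter words reduces their number to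
  -- the bound `R` for the dimension.
  set C' := C.filter fun s =>
    blockVec f I s ∉ Submodule.span κ (blockVec f I '' {x' | W x' < W s}) with hC'
  have hinj' : Set.InjOn W (C' : Set (Fin d → Fin n)) :=
    hinj.mono fun x hx => (Finset.mem_filter.1 hx).1
  refine ⟨C', ?_, ⟨fun x hx => h.1 x (Finset.mem_filter.1 hx).1, fun x => ?_⟩, hinj'⟩
  · by_contra hcard
    have : R + 1 ≤ C'.card := by omega
    obtain ⟨S, hS, hScard⟩ := Finset.exists_subset_card_eq this
    let g : Fin (R + 1) ≃ S := (Fintype.equivFinOfCardEq (by simpa using hScard)).symm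
    obtain ⟨c, hc, hsum⟩ := hdep fun i => (g i : Fin d → Fin n)
    have hne : (Finset.univ.filter fun i => c i ≠ 0).Nonempty := by
      obtain ⟨i, hi⟩ := Function.ne_iff.1 hc
      exact ⟨i, by simpa using hi⟩
    -- In a relation between `R + 1` members of `C'`, the heaviest one with a nonzero coefficient is
    -- a combination of strictly lighter ones, since the weights are distinct. This contradicts its
    -- membership in `C'`.
    obtain ⟨i, hi, hmax⟩ := Finset.exists_max_image _ (fun i => W (g i)) hne
    have hci : c i ≠ 0 := (Finset.mem_filter.1 hi).2
    refine (Finset.mem_filter.1 (hS (g i).2)).2 ?_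
    have hrel : blockVec f I (g i) = ∑ j ∈ Finset.univ.erase i,
        (-(c i)⁻¹ * c j) • blockVec f I (g j) := by
      funext y
      have h1 := hsum y
      rw [← Finset.add_sum_erase _ _ (Finset.mem_univ i)] at h1
      simp only [Finset.sum_apply, Pi.smul_apply, smul_eq_mul, blockVec, mul_assoc]
      rw [← Finset.mul_sum]
      field_simp
      linear_combination h1
    rw [hrel]
    refine Submodule.sum_mem _ fun j hj => ?_
    by_cases hcj : c j = 0
    · simp [hcj]
    refine Submodule.smul_mem _ _ (Submodule.subset_span ⟨_, ?_, rfl⟩)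
    have hle := hmax j (by simpa using hcj)
    refine lt_of_le_of_ne hle fun heq => (Finset.mem_erase.1 hj).1 (g.injective (Subtype.ext ?_))
    exact hinj' (hS (g j).2) (hS (g i).2) heq
  · by_cases hx : blockVec f I x ∈ Submodule.span κ (blockVec f I '' {x' | W x' < W x})
    · exact Or.inr hx
    · left
      rcases h.2 x with h' | h'
      · refine Finset.mem_filter.2 ⟨h', ?_⟩
        rwa [(hpw x).1, (hpw x).2]
      · exact absurd (Submodule.span_mono (Set.image_mono fun x' hx' => hWlt x x' hx') h') hx

/-! ### Separation of words by small moduli -/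

/-- Put `m = X + 3`. If all numbers up to `2m` divided `P`, so would the central binomial
coefficient, whose prime power factors are at most `2m`. But it is at least `4^m / (2m)`, which
exceeds `2^X`. -/
theorem exists_le_not_dvd {P X : ℕ} (hP : P ≠ 0) (hX : P ≤ 2 ^ X) :
    ∃ q, 1 ≤ q ∧ q ≤ 2 * (X + 3) ∧ ¬ q ∣ P := by
  by_contra! hall
  have hdvd : Nat.centralBinom (X + 3) ∣ P := by
    rw [Nat.dvd_iff_prime_pow_dvd_dvd]
    intro p k hp hk
    rcases Nat.eq_zero_or_pos k with rfl | hk0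
    · simp
    have h1 : k ≤ (Nat.centralBinom (X + 3)).factorization p :=
      (hp.pow_dvd_iff_le_factorization (Nat.centralBinom_ne_zero _)).1 hk
    have h2 : p ^ (Nat.centralBinom (X + 3)).factorization p ≤ 2 * (X + 3) :=
      Nat.pow_factorization_choose_le (by omega)
    exact hall _ (Nat.pos_of_ne_zero (pow_ne_zero _ hp.ne_zero))
      ((Nat.pow_le_pow_right hp.pos h1).trans h2)
  have h1 := Nat.le_of_dvd (Nat.pos_of_ne_zero hP) hdvd
  have h2 := Nat.four_pow_le_two_mul_self_mul_centralBinom (X + 3) (by omega)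
  have h3 : (4 : ℕ) ^ (X + 3) = 2 ^ X * 2 ^ X * 64 := by
    rw [pow_add, show (4 : ℕ) = 2 * 2 by norm_num, mul_pow]; norm_num
  have h4 : 2 * (X + 3) * Nat.centralBinom (X + 3) ≤ 2 * (X + 3) * 2 ^ X :=
    Nat.mul_le_mul_left _ (h1.trans hX)
  have h5 : X < 2 ^ X := Nat.lt_two_pow_self
  have h6 : 0 < 2 ^ X := by positivity
  have h7 : 2 ^ X * (64 * 2 ^ X) ≤ 2 ^ X * (2 * (X + 3)) := by
    calc 2 ^ X * (64 * 2 ^ X) = 4 ^ (X + 3) := by rw [h3]; ring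
      _ ≤ 2 ^ X * (2 * (X + 3)) := by linarith
  have h8 := Nat.le_of_mul_le_mul_left h7 h6
  omega

/-- The number with the given digits. -/
def wordValue (x : Fin d → Fin n) : ℕ := ∑ k, (x k : ℕ) * n ^ (k : ℕ)

theorem wordValue_injective : Function.Injective (wordValue (d := d) (n := n)) := by
  intro x y h
  apply finFunctionFinEquiv.injective
  apply Fin.ext
  simpa [finFunctionFinEquiv_apply, wordValue] using h

theorem wordValue_lt (x : Fin d → Fin n) : wordValue x < n ^ d := by
  have := (finFunctionFinEquiv x).2
  simpa [finFunctionFinEquiv_apply, wordValue] using this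

/-- The weight of a letter in a given position, modulo `q`. -/
def modWeight (q : ℕ) (k : Fin d) (j : Fin n) : ℕ := ((j : ℕ) * n ^ (k : ℕ)) % q

/-- Modulo `q`, the block weight is the value of the word in base `n` up to the contribution of the
positions outside `I`, which both words share because they continue `y₀`. -/
theorem modWeight_separates {q : ℕ} {I : Finset (Fin d)} {y₀ a b : Fin d → Fin n}
    (ha : I.piecewise a y₀ = a) (hb : I.piecewise b y₀ = b)
    (h : blockWeight (modWeight q) I a = blockWeight (modWeight q) I b) :
    wordValue a ≡ wordValue b [MOD q] := by
  have key : ∀ x : Fin d → Fin n, I.piecewise x y₀ = x → wordValue x ≡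
      blockWeight (modWeight q) I x + ∑ k ∈ Iᶜ, (y₀ k : ℕ) * n ^ (k : ℕ) [MOD q] := by
    intro x hx
    rw [wordValue, ← Finset.sum_add_sum_compl I]
    refine Nat.ModEq.add ?_ ?_
    · exact (Nat.ModEq.sum fun k _ => (Nat.mod_modEq _ _).symm)
    · refine Nat.ModEq.sum fun k hk => ?_
      rw [← hx, Finset.piecewise_eq_of_notMem _ _ _ (Finset.mem_compl.1 hk)]
  exact (key a ha).trans (h ▸ (key b hb).symm)

/-- It suffices that `q` does not divide the product of all differences of values, and `n ^ d ≤ 2 ^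
(n * d)` bounds this product. -/
theorem exists_modulus (S : Finset (Fin d → Fin n)) {s : ℕ} (hS : S.card ≤ s) :
    ∃ q, 1 ≤ q ∧ q ≤ 2 * (n * d * s ^ 2 + 3) ∧
      ∀ a ∈ S, ∀ b ∈ S, a ≠ b → ¬ wordValue a ≡ wordValue b [MOD q] := by
  set P := ∏ ab ∈ S.offDiag, ((wordValue ab.1 : ℤ) - wordValue ab.2).natAbs with hP
  have hP0 : P ≠ 0 := by
    rw [hP, Finset.prod_ne_zero_iff]
    rintro ⟨a, b⟩ hab
    have hne := (Finset.mem_offDiag.1 hab).2.2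
    have : wordValue a ≠ wordValue b := fun h => hne (wordValue_injective h)
    simp only
    omega
  have hPX : P ≤ 2 ^ (n * d * s ^ 2) := by
    have h1 : ∀ ab ∈ S.offDiag, ((wordValue ab.1 : ℤ) - wordValue ab.2).natAbs ≤ 2 ^ (n * d) := by
      rintro ⟨a, b⟩ -
      have h1 := wordValue_lt a
      have h2 := wordValue_lt b
      have h3 : n ^ d ≤ 2 ^ (n * d) := by
        rw [pow_mul]; exact Nat.pow_le_pow_left Nat.lt_two_pow_self.le d
      simp only
      omega
    calc P ≤ (2 ^ (n * d)) ^ S.offDiag.card := by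
          simpa using Finset.prod_le_pow_card _ _ _ h1
      _ = 2 ^ (n * d * S.offDiag.card) := by rw [← pow_mul]
      _ ≤ 2 ^ (n * d * s ^ 2) := by
          refine Nat.pow_le_pow_right (by norm_num) (Nat.mul_le_mul_left _ ?_)
          rw [Finset.offDiag_card, sq]
          exact (Nat.sub_le _ _).trans (Nat.mul_le_mul hS hS)
  obtain ⟨q, hq1, hq2, hq⟩ := exists_le_not_dvd hP0 hPX
  refine ⟨q, hq1, hq2, fun a ha b hb hab hmod => hq ?_⟩
  refine dvd_trans ?_ (Finset.dvd_prod_of_mem _ (Finset.mem_offDiag.2 ⟨ha, hb, hab⟩ :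
    (a, b) ∈ S.offDiag))
  have := (Nat.modEq_iff_dvd.1 hmod.symm)
  exact Int.natCast_dvd.1 this

theorem blockWeight_modWeight_lt {q Q : ℕ} (hq : 1 ≤ q) (hqQ : q ≤ Q) (hd : 0 < d)
    (I : Finset (Fin d)) (x : Fin d → Fin n) : blockWeight (modWeight q) I x < d * Q := by
  have h1 : blockWeight (modWeight q) I x ≤ ∑ k ∈ I, (q - 1) :=
    Finset.sum_le_sum fun k _ => by
      have := Nat.mod_lt ((x k : ℕ) * n ^ (k : ℕ)) (show q > 0 by omega)
      simp only [modWeight]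
      omega
  rw [Finset.sum_const, smul_eq_mul] at h1
  have h2 : I.card ≤ d := by simpa using Finset.card_le_univ I
  calc _ ≤ I.card * (q - 1) := h1
    _ ≤ d * (q - 1) := Nat.mul_le_mul_right _ h2
    _ < d * Q := Nat.mul_lt_mul_of_pos_left (by omega) hd

/-! ### Weights for all levels -/

/-- The weight of a letter that is built from `l` moduli, which are the digits of `u`. -/
def levelWeight (Q B l u : ℕ) (k : Fin d) (j : Fin n) : ℕ :=
  ∑ i ∈ Finset.range l, B ^ i * modWeight (1 + u / Q ^ i % Q) k j

/-- The seed `Q * u + (q - 1)` puts a new lowest digit before those of `u`. Digits run from `0` to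
`Q - 1` and moduli from `1` to `Q`, whence the shift by one. The newest modulus is the least
significant part of the weight. -/
theorem levelWeight_succ {Q : ℕ} (B l u : ℕ) {q : ℕ} (hq : 1 ≤ q) (hqQ : q ≤ Q) (k : Fin d)
    (j : Fin n) : levelWeight Q B (l + 1) (Q * u + (q - 1)) k j =
      modWeight q k j + B * levelWeight Q B l u k j := by
  rw [levelWeight, Finset.sum_range_succ', add_comm, levelWeight, Finset.mul_sum]
  congr 1
  · rw [pow_zero, pow_zero, one_mul, Nat.div_one, Nat.mul_add_mod, Nat.mod_eq_of_lt (by omega)]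
    congr 1
    omega
  · refine Finset.sum_congr rfl fun i _ => ?_
    rw [pow_succ' Q, ← Nat.div_div_eq_div_mul, Nat.mul_add_div (by omega),
      Nat.div_eq_of_lt (show q - 1 < Q by omega), pow_succ', add_zero, mul_assoc]

theorem sum_digits_lt {B l : ℕ} {D : ℕ → ℕ} (h : ∀ i, D i < B) :
    ∑ i ∈ Finset.range l, B ^ i * D i < B ^ l := by
  induction l with
  | zero => simp
  | succ l ih =>
    rw [Finset.sum_range_succ, pow_succ]
    have h1 : B ^ l * (D l + 1) ≤ B ^ l * B := Nat.mul_le_mul_left _ (h l)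
    rw [mul_add, mul_one] at h1
    omega

theorem blockWeight_levelWeight_lt {Q l u : ℕ} (hQ : 0 < Q) (hd : 0 < d) (I : Finset (Fin d))
    (x : Fin d → Fin n) : blockWeight (levelWeight Q (d * Q) l u) I x < (d * Q) ^ l := by
  have : blockWeight (levelWeight Q (d * Q) l u) I x = ∑ i ∈ Finset.range l,
      (d * Q) ^ i * blockWeight (modWeight (1 + u / Q ^ i % Q)) I x := by
    simp only [blockWeight, levelWeight, Finset.mul_sum]
    exact Finset.sum_comm
  rw [this]
  refine sum_digits_lt fun i => blockWeight_modWeight_lt (by omega) ?_ hd I x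
  have := Nat.mod_lt (u / Q ^ i) hQ
  omega

/-- The positions from `a` to (excluding) `b`. -/
def posInterval (d a b : ℕ) : Finset (Fin d) := Finset.univ.filter fun k => a ≤ k ∧ (k : ℕ) < b

theorem posInterval_union {a c b : ℕ} (hac : a ≤ c) (hcb : c ≤ b) :
    posInterval d a b = posInterval d a c ∪ posInterval d c b := by
  ext k
  simp only [posInterval, Finset.mem_union, Finset.mem_filter, Finset.mem_univ, true_and]
  omega

theorem disjoint_posInterval (a c b : ℕ) :
    Disjoint (posInterval d a c) (posInterval d c b) := by
  rw [Finset.disjoint_left]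
  intro k
  simp only [posInterval, Finset.mem_filter, Finset.mem_univ, true_and]
  omega

/-- Adding one more modulus, the weight isolates a basis of every block for which a bounded set of
candidates is known. -/
theorem exists_next_level {f : (Fin d → Fin n) → κ} {y₀ : Fin d → Fin n} {w : Fin d → Fin n → ℕ}
    {R c Q : ℕ} (hd : 0 < d) (hdep : ∀ a b, BlockDependent f (posInterval d a b) R)
    (hQ : 2 * (n * d * ((d + 1) ^ 2 * c) ^ 2 + 3) ≤ Q) (p : ℕ → ℕ → Prop)
    (h : ∀ a b, a ≤ d → b ≤ d → p a b → ∃ C : Finset (Fin d → Fin n), C.card ≤ c ∧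
      SpansBlock f y₀ w (posInterval d a b) C) :
    ∃ q, 1 ≤ q ∧ q ≤ Q ∧ ∀ a b, a ≤ d → b ≤ d → p a b →
      ∃ C : Finset (Fin d → Fin n), C.card ≤ R ∧
        SpansBlock f y₀ (fun k j => modWeight q k j + d * Q * w k j) (posInterval d a b) C ∧
        Set.InjOn (blockWeight (fun k j => modWeight q k j + d * Q * w k j)
          (posInterval d a b)) C := by
  classical
  have h' : ∀ ab : ℕ × ℕ, ∃ C : Finset (Fin d → Fin n), C.card ≤ c ∧
      (ab.1 ≤ d → ab.2 ≤ d → p ab.1 ab.2 → SpansBlock f y₀ w (posInterval d ab.1 ab.2) C) := by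
    rintro ⟨a, b⟩
    by_cases hab : a ≤ d ∧ b ≤ d ∧ p a b
    · obtain ⟨C, hC, hC'⟩ := h a b hab.1 hab.2.1 hab.2.2
      exact ⟨C, hC, fun _ _ _ => hC'⟩
    · exact ⟨∅, by simp, fun h1 h2 h3 => absurd ⟨h1, h2, h3⟩ hab⟩
  choose C hC hC' using h'
  -- One modulus has to serve all intervals at once, so their candidates are collected in a single
  -- set; this is the source of the factor `(d + 1) ^ 2`.
  set S := (Finset.range (d + 1) ×ˢ Finset.range (d + 1)).biUnion C with hS
  have hScard : S.card ≤ (d + 1) ^ 2 * c := by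
    refine (Finset.card_biUnion_le_card_mul _ _ _ fun ab _ => hC ab).trans ?_
    rw [Finset.card_product, Finset.card_range, sq]
  obtain ⟨q, hq1, hq2, hq⟩ := exists_modulus S hScard
  refine ⟨q, hq1, hq2.trans hQ, fun a b ha hb hab => ?_⟩
  have hsp := hC' (a, b) ha hb hab
  have hsub : C (a, b) ⊆ S := Finset.subset_biUnion_of_mem C (x := (a, b)) (by
    simp only [Finset.mem_product, Finset.mem_range]; omega)
  exact hsp.exists_refinement (fun x hx y hy hne heq => hq x (hsub hx) y (hsub hy) hne
      (modWeight_separates (hsp.1 x hx) (hsp.1 y hy) heq))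
    (blockWeight_modWeight_lt hq1 (hq2.trans hQ) hd _) (hdep a b)

/-- An interval of length at most `2 ^ (l + 1)` is cut after `2 ^ l` positions. The bases of the two
pieces give `R * R` candidates, and one further modulus brings these back to `R`. The induction
starts with single positions, where all `n` letters are candidates; `n * R ^ 2` covers both cases.
-/
theorem exists_isolating_level {f : (Fin d → Fin n) → κ} {y₀ : Fin d → Fin n} {R Q : ℕ}
    (hd : 0 < d) (hn : 0 < n) (hR : 0 < R)
    (hdep : ∀ a b, BlockDependent f (posInterval d a b) R)
    (hQ : 2 * (n * d * ((d + 1) ^ 2 * (n * R ^ 2)) ^ 2 + 3) ≤ Q) (l : ℕ) :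
    ∃ u < Q ^ (l + 1), ∀ a b, a ≤ d → b ≤ d → b ≤ a + 2 ^ l →
      ∃ C : Finset (Fin d → Fin n), C.card ≤ R ∧
        SpansBlock f y₀ (levelWeight Q (d * Q) (l + 1) u) (posInterval d a b) C ∧
        Set.InjOn (blockWeight (levelWeight Q (d * Q) (l + 1) u : Fin d → Fin n → ℕ)
          (posInterval d a b)) C := by
  have hn2 : n ≤ n * R ^ 2 := Nat.le_mul_of_pos_right _ (by positivity)
  have hR2 : R * R ≤ n * R ^ 2 := by rw [← sq]; exact Nat.le_mul_of_pos_left _ hn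
  induction l with
  | zero =>
    obtain ⟨q, hq1, hq2, hq⟩ := exists_next_level (y₀ := y₀) (w := fun _ _ => 0) hd hdep hQ
      (fun a b => b ≤ a + 1) (fun a b _ _ hab => by
        obtain ⟨C, hC, hC'⟩ := spansBlock_of_subset_singleton (f := f) (y₀ := y₀)
          (w := fun _ _ => 0) (I := posInterval d a b) (by
            intro k hk l hl
            simp only [posInterval, Finset.mem_filter, Finset.mem_univ, true_and] at hk hl
            exact Fin.ext (by omega)) hn
        exact ⟨C, hC.trans hn2, hC'⟩)
    refine ⟨Q * 0 + (q - 1), by rw [zero_add, pow_one]; omega, fun a b ha hb hab => ?_⟩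
    have hw : (levelWeight Q (d * Q) (0 + 1) (Q * 0 + (q - 1)) : Fin d → Fin n → ℕ) =
        fun k j => modWeight q k j + d * Q * 0 := by
      funext k j
      rw [levelWeight_succ _ _ _ hq1 hq2]
      simp [levelWeight]
    rw [hw]
    exact hq a b ha hb (by simpa using hab)
  | succ l ih =>
    obtain ⟨u, hu, ih⟩ := ih
    obtain ⟨q, hq1, hq2, hq⟩ := exists_next_level (y₀ := y₀)
      (w := levelWeight Q (d * Q) (l + 1) u) hd hdep hQ
      (fun a b => b ≤ a + 2 ^ (l + 1)) (fun a b ha hb hab => by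
        by_cases hle : b ≤ a + 2 ^ l
        · obtain ⟨C, hC, hC', -⟩ := ih a b ha hb hle
          exact ⟨C, (hC.trans (Nat.le_mul_self R)).trans hR2, hC'⟩
        · rw [pow_succ] at hab
          obtain ⟨C₁, h₁, h₁', -⟩ := ih a (a + 2 ^ l) ha (by omega) le_rfl
          obtain ⟨C₂, h₂, h₂', -⟩ := ih (a + 2 ^ l) b (by omega) hb (by omega)
          refine ⟨Finset.image₂ (fun x y => (posInterval d a (a + 2 ^ l)).piecewise x y) C₁ C₂,
            ((Finset.card_image₂_le _ C₁ C₂).trans (Nat.mul_le_mul h₁ h₂)).trans hR2, ?_⟩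
          rw [posInterval_union (show a ≤ a + 2 ^ l by omega) (show a + 2 ^ l ≤ b by omega)]
          exact h₁'.union (disjoint_posInterval _ _ _) h₂')
    refine ⟨Q * u + (q - 1), ?_, fun a b ha hb hab => ?_⟩
    · have : Q * (u + 1) ≤ Q * Q ^ (l + 1) := Nat.mul_le_mul_left _ hu
      rw [mul_add, ← pow_succ'] at this
      omega
    · have hw : (levelWeight Q (d * Q) (l + 1 + 1) (Q * u + (q - 1)) : Fin d → Fin n → ℕ) =
          fun k j => modWeight q k j + d * Q * levelWeight Q (d * Q) (l + 1) u k j := by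
        funext k j
        rw [levelWeight_succ _ _ _ hq1 hq2]
      rw [hw]
      exact hq a b ha hb hab

/-- A nonzero set-multilinear polynomial with coefficient dimension at most `R` is nonzero at one
of the points given by the weights. -/
theorem exists_eval_ne_zero {f : (Fin d → Fin n) → κ} (hf : f ≠ 0) {R Q l : ℕ}
    (hd : 0 < d) (hn : 0 < n) (hR : 0 < R)
    (hdep : ∀ a b, BlockDependent f (posInterval d a b) R)
    (hQ : 2 * (n * d * ((d + 1) ^ 2 * (n * R ^ 2)) ^ 2 + 3) ≤ Q) (hl : d ≤ 2 ^ l)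
    (hchar : ∀ c : ℕ, 0 < c → c < (d * Q) ^ (l + 1) → (c : κ) ≠ 0) :
    ∃ u < Q ^ (l + 1), ∃ t < (d * Q) ^ (l + 1),
      ∑ x, f x * ∏ k, (t : κ) ^ levelWeight Q (d * Q) (l + 1) u k (x k) ≠ 0 := by
  classical
  obtain ⟨u, hu, h⟩ := exists_isolating_level (y₀ := fun _ => ⟨0, hn⟩) hd hn hR hdep hQ l
  obtain ⟨C, -, hC, hinj⟩ := h 0 d (Nat.zero_le _) le_rfl (by omega)
  have hI : posInterval d 0 d = Finset.univ := by
    ext k; simp [posInterval]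
  rw [hI] at hC hinj
  set W := blockWeight (levelWeight Q (d * Q) (l + 1) u : Fin d → Fin n → ℕ) Finset.univ with hW
  have hWlt : ∀ x, W x < (d * Q) ^ (l + 1) := blockWeight_levelWeight_lt (by omega) hd _
  refine ⟨u, hu, ?_⟩
  have hne : (Finset.univ.filter fun x => f x ≠ 0).Nonempty := by
    obtain ⟨x, hx⟩ := Function.ne_iff.1 hf
    exact ⟨x, by simpa using hx⟩
  obtain ⟨x₀, hx₀, hmin⟩ := Finset.exists_min_image _ W hne
  have hfx₀ : f x₀ ≠ 0 := (Finset.mem_filter.1 hx₀).2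
  -- A word of the support with the least weight must be in `C`: otherwise its coefficient would be
  -- a combination of coefficients of lighter words, which all vanish. As the weight is injective on
  -- `C`, the lightest word is unique.
  have hmem : ∀ x, f x ≠ 0 → W x = W x₀ → x ∈ C := by
    intro x hx hWx
    rcases hC.2 x with h1 | h1
    · simpa using h1
    · exfalso
      have h2 : blockVec f Finset.univ x = 0 := by
        have : Submodule.span κ (blockVec f Finset.univ ''
            {x' | W x' < W x}) ≤ ⊥ := by
          rw [Submodule.span_le]
          rintro _ ⟨x', hx', rfl⟩
          have hfx' : f x' = 0 := by
            by_contra hne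
            have := hmin x' (by simpa using hne)
            simp only [Set.mem_ofPred_eq] at hx'
            omega
          simp only [SetLike.mem_coe, Submodule.mem_bot]
          funext y
          simpa [blockVec] using hfx'
        simpa using this h1
      exact hx (by simpa [blockVec] using congrFun h2 x)
  have huniq : ∀ x, f x ≠ 0 → W x = W x₀ → x = x₀ := fun x hx hWx =>
    hinj (hmem x hx hWx) (hmem x₀ hfx₀ rfl) hWx
  -- The polynomial in `t` obtained by the substitution; no other word contributes to its
  -- coefficient in degree `W x₀`.
  set P : Polynomial κ := ∑ x, Polynomial.monomial (W x) (f x) with hP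
  have hcoeff : P.coeff (W x₀) = f x₀ := by
    rw [hP, Polynomial.finsetSum_coeff, Finset.sum_eq_single x₀]
    · simp
    · intro x _ hx
      rw [Polynomial.coeff_monomial]
      by_cases hWx : W x = W x₀
      · rw [if_pos hWx]
        by_contra hfx
        exact hx (huniq x hfx hWx)
      · rw [if_neg hWx]
    · simp
  have hP0 : P ≠ 0 := fun h0 => hfx₀ (by rw [← hcoeff, h0, Polynomial.coeff_zero])
  have hdeg : P.natDegree < (d * Q) ^ (l + 1) := by
    refine lt_of_le_of_lt (Polynomial.natDegree_sum_le_of_forall_le (n := (d * Q) ^ (l + 1) - 1)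
      _ _ fun x _ => ?_) (Nat.sub_lt (lt_of_le_of_lt (Nat.zero_le _) (hWlt x₀)) one_pos)
    have := hWlt x
    exact (Polynomial.natDegree_monomial_le _).trans (by omega)
  by_contra! hall
  refine hP0 (Polynomial.eq_zero_of_natDegree_lt_card_of_eval_eq_zero P
    (f := fun t : Fin ((d * Q) ^ (l + 1)) => ((t : ℕ) : κ)) ?_ ?_ (by simpa using hdeg))
  · intro s t hst
    simp only at hst
    by_contra hne
    rcases lt_or_gt_of_ne (fun h => hne (Fin.ext h) : (s : ℕ) ≠ t) with hlt | hlt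
    · refine hchar (t - s) (by omega) (by omega) ?_
      rw [Nat.cast_sub hlt.le, hst, sub_self]
    · refine hchar (s - t) (by omega) (by omega) ?_
      rw [Nat.cast_sub hlt.le, hst, sub_self]
  · intro t
    rw [← hall t t.2, hP, Polynomial.eval_finsetSum]
    refine Finset.sum_congr rfl fun x _ => ?_
    rw [Polynomial.eval_monomial, Finset.prod_pow_eq_pow_sum]
    rfl

end Isolation

/-! ## Reduction at a place -/

section Place

variable {E : Type*} [Field E]

/-- There is a place at which a given root of unity is congruent to a given integer. -/
theorem exists_valuationSubring_of_isPrimitiveRoot [CharZero E] {ζ : E} {N : ℕ}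
    (hζ : IsPrimitiveRoot ζ N) (hN : 1 < N) {A : ℕ} (hA : 1 < A) :
    ∃ O : ValuationSubring E, O.valuation (ζ - A) < 1 := by
  let S : Subring E := (Polynomial.aeval (R := ℤ) ζ).toRingHom.range
  have hmem : ∀ h : Polynomial ℤ, Polynomial.aeval ζ h ∈ S := fun h => ⟨h, rfl⟩
  let a : S := ⟨ζ - A, Polynomial.X - Polynomial.C (A : ℤ), by simp⟩
  -- If `ζ - A` were a unit of `ℤ[ζ]`, then `X - A` would be invertible modulo the cyclotomic
  -- polynomial, and evaluation at `A` would make the value of that polynomial at `A` a unit. Its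
  -- absolute value exceeds `A - 1 ≥ 1`.
  have hI : Ideal.span {a} ≠ ⊤ := by
    rw [Ne, Ideal.span_singleton_eq_top]
    rintro hu
    obtain ⟨⟨_, h, rfl⟩, hb⟩ := hu.exists_right_inv
    have h1 : (ζ - A) * Polynomial.aeval ζ h = 1 := congrArg Subtype.val hb
    have h2 : Polynomial.aeval ζ ((Polynomial.X - Polynomial.C (A : ℤ)) * h - 1) = 0 := by
      simp [h1]
    have h3 : Polynomial.cyclotomic N ℤ ∣ (Polynomial.X - Polynomial.C (A : ℤ)) * h - 1 := by
      rw [Polynomial.cyclotomic_eq_minpoly hζ (by omega)]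
      exact minpoly.isIntegrallyClosed_dvd (hζ.isIntegral (by omega)) h2
    obtain ⟨g, hg⟩ := h3
    have h4 := congrArg (Polynomial.eval (A : ℤ)) hg
    simp only [Polynomial.eval_sub, Polynomial.eval_mul, Polynomial.eval_X, Polynomial.eval_C,
      sub_self, zero_mul, Polynomial.eval_one, zero_sub] at h4
    have h5 : (Polynomial.eval (A : ℤ) (Polynomial.cyclotomic N ℤ)).natAbs ∣ 1 := by
      rw [← Int.natAbs_one, Int.natAbs_dvd_natAbs]
      exact ⟨-Polynomial.eval (A : ℤ) g, by linarith⟩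
    have h6 := Polynomial.sub_one_lt_natAbs_cyclotomic_eval hN (q := A) (by omega)
    rw [Nat.dvd_one.1 h5] at h6
    omega
  -- Chevalley's theorem: a proper ideal of a subring of a field consists of nonunits of some
  -- valuation ring containing the subring.
  obtain ⟨O, -, hO⟩ := Ideal.image_subset_nonunits_valuationSubring _ hI
  exact ⟨O, (ValuationSubring.mem_nonunits_iff O).1
    (hO ⟨a, Ideal.mem_span_singleton_self a, rfl⟩)⟩

theorem ValuationSubring.valuation_natCast_le_one (O : ValuationSubring E) (c : ℕ) :
    O.valuation (c : E) ≤ 1 :=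
  (O.valuation_le_one_iff _).2 (natCast_mem O c)

theorem ValuationSubring.valuation_intCast_le_one (O : ValuationSubring E) (c : ℤ) :
    O.valuation (c : E) ≤ 1 :=
  (O.valuation_le_one_iff _).2 (intCast_mem O c)

theorem valuation_eq_one_of_pow_eq_one {Γ : Type*} [LinearOrderedCommGroupWithZero Γ]
    (v : Valuation E Γ) {ζ : E} {N : ℕ} (hN : N ≠ 0) (h : ζ ^ N = 1) : v ζ = 1 := by
  have := congrArg v h
  rw [map_pow, map_one] at this
  rcases lt_trichotomy (v ζ) 1 with h1 | h1 | h1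
  · exact absurd this (pow_lt_one₀ zero_le h1 hN).ne
  · exact h1
  · exact absurd this (one_lt_pow₀ h1 hN).ne'

/-- If `c` were a nonunit at the place, so would be its multiple `A`, hence also `ζ`, which is a
root of unity. A highly divisible `A` thus excludes all small residue characteristics. -/
theorem valuation_natCast_eq_one_of_dvd (O : ValuationSubring E) {ζ : E} {N A c : ℕ} (hN : N ≠ 0)
    (hζ : ζ ^ N = 1) (hA : O.valuation (ζ - A) < 1) (hc : c ∣ A) : O.valuation (c : E) = 1 := by
  refine le_antisymm (O.valuation_natCast_le_one c) (not_lt.1 fun hlt => ?_)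
  obtain ⟨b, rfl⟩ := hc
  have h1 : O.valuation ((c * b : ℕ) : E) < 1 := by
    rw [Nat.cast_mul, map_mul]
    exact mul_lt_one_of_lt_of_le hlt (O.valuation_natCast_le_one b)
  have h2 := O.valuation.map_add_lt hA h1
  rw [sub_add_cancel, valuation_eq_one_of_pow_eq_one _ hN hζ] at h2
  exact lt_irrefl _ h2

/-- Scaling a nonzero family so that its entries are integral and one of them is `1`. -/
theorem exists_normalization (O : ValuationSubring E) {ι : Type*} [Fintype ι] {c : ι → E}
    (hc : c ≠ 0) : ∃ s : E, (∀ i, s * c i ∈ O) ∧ ∃ i, s * c i = 1 := by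
  obtain ⟨i₀, hi₀⟩ := Function.ne_iff.1 hc
  obtain ⟨i, -, hi⟩ := Finset.exists_max_image Finset.univ (fun i => O.valuation (c i))
    ⟨i₀, Finset.mem_univ _⟩
  have hci : c i ≠ 0 := by
    intro h0
    have := hi i₀ (Finset.mem_univ _)
    rw [h0, map_zero, le_zero_iff, map_eq_zero] at this
    exact hi₀ this
  refine ⟨(c i)⁻¹, fun j => ?_, i, inv_mul_cancel₀ hci⟩
  rw [← O.valuation_le_one_iff, map_mul, map_inv₀]
  have h1 : O.valuation (c i) ≠ 0 := (map_ne_zero _).2 hci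
  rw [inv_mul_le_iff₀ (zero_lt_iff.2 h1), mul_one]
  exact hi j (Finset.mem_univ _)

theorem residue_eq_zero_iff_valuation (O : ValuationSubring E) (x : O) :
    IsLocalRing.residue O x = 0 ↔ O.valuation (x : E) < 1 := by
  rw [IsLocalRing.residue_eq_zero_iff, ValuationSubring.valuation_lt_one_iff]

/-- The rank does not grow under reduction: a relation can be scaled to have integral coefficients,
one of them `1`, and then its reduction is not trivial. -/
theorem BlockDependent.residue {d n R : ℕ} (O : ValuationSubring E) {f : (Fin d → Fin n) → O}
    {I : Finset (Fin d)} (h : BlockDependent (fun x => (f x : E)) I R) :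
    BlockDependent (fun x => IsLocalRing.residue O (f x)) I R := by
  intro g
  obtain ⟨c, hc, hsum⟩ := h g
  obtain ⟨s, hs, i, hi⟩ := exists_normalization O hc
  refine ⟨fun j => IsLocalRing.residue O ⟨s * c j, hs j⟩, ?_, fun y => ?_⟩
  · intro h0
    have h1 := congrFun h0 i
    have h2 : (⟨s * c i, hs i⟩ : O) = 1 := Subtype.ext hi
    simp [h2] at h1
  · simp only [← map_mul, ← map_sum]
    have : ∑ j, (⟨s * c j, hs j⟩ : O) * f (I.piecewise (g j) y) = 0 := by
      apply Subtype.ext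
      have := congrArg (s * ·) (hsum y)
      simp only [Finset.mul_sum, mul_zero, ← mul_assoc] at this
      simpa using this
    rw [this, map_zero]

/-- A nonzero set-multilinear polynomial with coefficient dimension at most `R` is nonzero at one
of the given points, if these reduce to the points given by isolating weights. -/
theorem exists_eval_ne_zero_of_valuationSubring (O : ValuationSubring E) {d n R Q l N : ℕ}
    {f : (Fin d → Fin n) → E} (hf : f ≠ 0) (hd : 0 < d) (hn : 0 < n) (hR : 0 < R)
    (hdep : ∀ a b, BlockDependent f (posInterval d a b) R)
    (hQ : 2 * (n * d * ((d + 1) ^ 2 * (n * R ^ 2)) ^ 2 + 3) ≤ Q) (hl : d ≤ 2 ^ l)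
    (hchar : ∀ c : ℕ, 0 < c → c < (d * Q) ^ (l + 1) → O.valuation (c : E) = 1)
    (hN : O.valuation (N : E) = 1) (y : ℕ → ℕ → Fin d → Fin n → E)
    (hy : ∀ u t k j, O.valuation
      (y u t k j - N * (t : E) ^ levelWeight Q (d * Q) (l + 1) u k j) < 1) :
    ∃ u < Q ^ (l + 1), ∃ t < (d * Q) ^ (l + 1), ∑ x, f x * ∏ k, y u t k (x k) ≠ 0 := by
  -- The scaling makes `f` integral with nonzero reduction, so the result on isolating weights
  -- applies over the residue field.
  obtain ⟨s, hs, x₀, hx₀⟩ := exists_normalization O hf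
  have hs0 : s ≠ 0 := by rintro rfl; simp at hx₀
  let F : (Fin d → Fin n) → O := fun x => ⟨s * f x, hs x⟩
  have hFdep : ∀ a b, BlockDependent (fun x => IsLocalRing.residue O (F x))
      (posInterval d a b) R := by
    intro a b
    refine BlockDependent.residue O fun g => ?_
    obtain ⟨c, hc, hsum⟩ := hdep a b g
    refine ⟨c, hc, fun y => ?_⟩
    have := congrArg (s * ·) (hsum y)
    simp only [Finset.mul_sum, mul_zero] at this
    rw [← this]
    exact Finset.sum_congr rfl fun i _ => by simp only [F]; ring
  have hres : ∀ c : ℕ, O.valuation (c : E) = 1 → ((c : ℕ) : IsLocalRing.ResidueField O) ≠ 0 := by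
    intro c hc h0
    rw [← map_natCast (IsLocalRing.residue O), residue_eq_zero_iff_valuation] at h0
    have h1 : (((c : ℕ) : O) : E) = c := by simp
    rw [h1, hc] at h0
    exact lt_irrefl _ h0
  obtain ⟨u, hu, t, ht, hne⟩ := exists_eval_ne_zero
    (f := fun x => IsLocalRing.residue O (F x)) (by
      intro h0
      have h1 := congrFun h0 x₀
      have h2 : F x₀ = 1 := Subtype.ext hx₀
      simp [h2] at h1) hd hn hR hFdep hQ hl (fun c h1 h2 => hres c (hchar c h1 h2))
  refine ⟨u, hu, t, ht, fun h0 => hne ?_⟩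
  have hyO : ∀ k j, y u t k j ∈ O := by
    intro k j
    rw [← O.valuation_le_one_iff]
    have h1 : O.valuation ((N : E) * (t : E) ^ levelWeight Q (d * Q) (l + 1) u k j) ≤ 1 := by
      have := O.valuation_natCast_le_one (N * t ^ levelWeight Q (d * Q) (l + 1) u k j)
      simpa using this
    have h2 := O.valuation.map_add_le (hy u t k j).le h1
    rwa [sub_add_cancel] at h2
  let Y : Fin d → Fin n → O := fun k j => ⟨y u t k j, hyO k j⟩
  have hY : ∀ k j, IsLocalRing.residue O (Y k j) =
      (N : IsLocalRing.ResidueField O) * (t : IsLocalRing.ResidueField O) ^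
        levelWeight Q (d * Q) (l + 1) u k j := by
    intro k j
    have h1 : IsLocalRing.residue O (Y k j - (N : O) * (t : O) ^
        levelWeight Q (d * Q) (l + 1) u k j) = 0 := by
      rw [residue_eq_zero_iff_valuation]
      simpa [Y] using hy u t k j
    rw [map_sub, sub_eq_zero] at h1
    simpa using h1
  have h1 : ∑ x, F x * ∏ k, Y k (x k) = 0 := by
    apply Subtype.ext
    have := congrArg (s * ·) h0
    simp only [Finset.mul_sum, mul_zero, ← mul_assoc] at this
    simpa [F, Y] using this
  have h2 := congrArg (IsLocalRing.residue O) h1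
  simp only [map_sum, map_mul, map_prod, hY, map_zero, Finset.prod_mul_distrib,
    Finset.prod_const] at h2
  -- Every value carries the factor `N`; together they give `N ^ d`, which is nonzero in the residue
  -- field.
  have h3 : (N : IsLocalRing.ResidueField O) ^ (Finset.univ : Finset (Fin d)).card *
      ∑ x, IsLocalRing.residue O (F x) * ∏ k, (t : IsLocalRing.ResidueField O) ^
        levelWeight Q (d * Q) (l + 1) u k (x k) = 0 := by
    rw [← h2, Finset.mul_sum]
    exact Finset.sum_congr rfl fun x _ => by ring
  exact (mul_eq_zero.1 h3).resolve_left (pow_ne_zero _ (hres N hN))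

/-! ### Elements with prescribed residues -/

/-- The element of the cyclotomic field whose conjugates are congruent to `N * Φ h` at the place
where `ζ` is congruent to `A`. -/
def fourierElement (ζ : E) (N A : ℕ) [NeZero N] (Φ : ZMod N → ℤ) : E :=
  ∑ e : ZMod N, ((∑ h : ZMod N, Φ h * (A : ℤ) ^ (-(h * e)).val : ℤ) : E) * ζ ^ e.val

/-- The substitution `e ↦ u e`, `h ↦ h u⁻¹` preserves the product `h * e`, so a conjugation merely
translates `Φ`. In this way the conjugates of a single element see different values of `Φ`. -/
theorem fourierElement_map {ζ : E} {N A : ℕ} [NeZero N] (hζ : ζ ^ N = 1) (Φ : ZMod N → ℤ)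
    {G : Type*} [FunLike G E E] [RingHomClass G E E] (s : G) (u : (ZMod N)ˣ)
    (hs : s ζ = ζ ^ (u : ZMod N).val) :
    s (fourierElement ζ N A Φ) = fourierElement ζ N A fun h => Φ (h * u) := by
  simp only [fourierElement, map_sum, map_mul, map_intCast, map_pow, hs]
  refine Fintype.sum_equiv (Units.mulLeft u) _ _ fun e => ?_
  congr 1
  · congr 1
    refine Fintype.sum_equiv (Units.mulRight u⁻¹) _ _ fun h => ?_
    simp [mul_assoc]
  · simp only [Units.mulLeft_apply]
    rw [← pow_mul, ZMod.val_mul]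
    exact pow_eq_pow_mod _ hζ

/-- With `ζ` in place of `A`, orthogonality of characters makes the double sum exactly `N * Φ 1`.
The difference is an integral multiple of `ζ - A`, because `A ^ m - ζ ^ m` is. -/
theorem valuation_fourierElement_sub_lt (O : ValuationSubring E) {ζ : E} {N A : ℕ} [NeZero N]
    (hζ : IsPrimitiveRoot ζ N) (hA : O.valuation (ζ - A) < 1) (Φ : ZMod N → ℤ) :
    O.valuation (fourierElement ζ N A Φ - N * Φ 1) < 1 := by
  have hN : N ≠ 0 := NeZero.ne N
  have hvζ : O.valuation ζ = 1 := valuation_eq_one_of_pow_eq_one _ hN hζ.pow_eq_one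
  have h1 : (N : E) * Φ 1 =
      ∑ e : ZMod N, ∑ h : ZMod N, (Φ h : E) * ζ ^ (-(h * e)).val * ζ ^ e.val := by
    rw [Finset.sum_comm]
    have hψ := AddChar.zmodChar_primitive_of_primitive_root N hζ
    have h2 : ∀ h : ZMod N, ∑ e : ZMod N, (Φ h : E) * ζ ^ (-(h * e)).val * ζ ^ e.val =
        Φ h * if 1 - h = 0 then (N : E) else 0 := by
      intro h
      have h3 := AddChar.sum_mulShift (1 - h) hψ
      rw [ZMod.card] at h3
      push_cast at h3
      rw [← h3, Finset.mul_sum]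
      refine Finset.sum_congr rfl fun e _ => ?_
      rw [mul_assoc, ← AddChar.zmodChar_apply hζ.pow_eq_one, ← AddChar.zmodChar_apply
        hζ.pow_eq_one, ← AddChar.map_add_eq_mul]
      congr 2
      ring
    rw [Finset.sum_congr rfl fun h _ => h2 h, Finset.sum_eq_single 1]
    · simp [mul_comm]
    · intro h _ hne
      rw [if_neg (fun h0 => hne (sub_eq_zero.1 h0).symm), mul_zero]
    · simp
  have h2 : fourierElement ζ N A Φ - N * Φ 1 = ∑ e : ZMod N, ∑ h : ZMod N,
      (Φ h : E) * ζ ^ e.val * ((A : E) ^ (-(h * e)).val - ζ ^ (-(h * e)).val) := by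
    rw [h1, fourierElement, ← Finset.sum_sub_distrib]
    refine Finset.sum_congr rfl fun e _ => ?_
    push_cast
    rw [Finset.sum_mul, ← Finset.sum_sub_distrib]
    exact Finset.sum_congr rfl fun h _ => by ring
  rw [h2]
  refine O.valuation.map_sum_lt one_ne_zero fun e _ => O.valuation.map_sum_lt one_ne_zero
    fun h _ => ?_
  obtain ⟨b, hb⟩ : ∃ b : E, O.valuation b ≤ 1 ∧
      (A : E) ^ (-(h * e)).val - ζ ^ (-(h * e)).val = b * (ζ - A) := by
    refine ⟨-∑ i ∈ Finset.range (-(h * e)).val, (A : E) ^ i * ζ ^ ((-(h * e)).val - 1 - i),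
      ?_, ?_⟩
    · rw [Valuation.map_neg]
      refine O.valuation.map_sum_le fun i _ => ?_
      rw [map_mul, map_pow, map_pow, hvζ, one_pow, mul_one]
      exact pow_le_one₀ zero_le (O.valuation_natCast_le_one A)
    · rw [← (Commute.all (A : E) ζ).geom_sum₂_mul]
      ring
  rw [hb.2, map_mul, map_mul, map_mul, map_pow, hvζ, one_pow, mul_one, ← mul_assoc]
  exact (mul_le_of_le_one_left' (mul_le_one₀ (O.valuation_intCast_le_one _) zero_le hb.1)).trans_lt hA

end Place

/-! ## Cyclic algebras are division algebras when a valuation obstructs norms -/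

section CyclicDivision

variable {F K : Type*} [Field F] [Field K] [Algebra F K]

theorem cyclicShift_mul_apply_succ {ℓ : ℕ} (z : K) (Y : Matrix (Fin ℓ) (Fin ℓ) K) (i k j : Fin ℓ)
    (hk : (k : ℕ) = i + 1) : (cyclicShift ℓ z * Y) i j = Y k j := by
  rw [Matrix.mul_apply, Finset.sum_eq_single k]
  · simp [cyclicShift, hk]
  · intro l _ hl
    have h1 : (l : ℕ) ≠ i + 1 := fun h => hl (Fin.ext (h.trans hk.symm))
    have h2 : ¬ ((i : ℕ) + 1 = ℓ) := by have := k.2; omega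
    simp [cyclicShift, h1, h2]
  · simp

theorem mul_cyclicShift_apply_succ {ℓ : ℕ} (z : K) (Y : Matrix (Fin ℓ) (Fin ℓ) K) (i k j : Fin ℓ)
    (hk : (j : ℕ) = k + 1) : (Y * cyclicShift ℓ z) i j = Y i k := by
  rw [Matrix.mul_apply, Finset.sum_eq_single k]
  · simp [cyclicShift, hk]
  · intro l _ hl
    have h1 : (j : ℕ) ≠ l + 1 := fun h => hl (Fin.ext (by omega))
    have h2 : ¬ ((j : ℕ) = 0) := by omega
    simp [cyclicShift, h1, h2]
  · simp

theorem mul_cyclicShift_apply_zero {ℓ : ℕ} (z : K) (Y : Matrix (Fin ℓ) (Fin ℓ) K) (i k j : Fin ℓ)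
    (hj : (j : ℕ) = 0) (hk : (k : ℕ) + 1 = ℓ) : (Y * cyclicShift ℓ z) i j = Y i k * z := by
  rw [Matrix.mul_apply, Finset.sum_eq_single k]
  · have h1 : ¬ (j : ℕ) = k + 1 := by omega
    simp only [cyclicShift, Matrix.of_apply, if_neg h1, if_pos (And.intro hk hj)]
  · intro l _ hl
    have h2 : ¬ ((l : ℕ) + 1 = ℓ) := fun h => hl (Fin.ext (by omega))
    simp [cyclicShift, hj, h2]
  · simp

theorem cyclicShift_mul_cyclicDiag {σ : K ≃ₐ[F] K} {ℓ : ℕ} (hσ : σ ^ ℓ = 1) (z b : K) :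
    cyclicShift ℓ z * cyclicDiag σ ℓ b = (cyclicDiag σ ℓ b).map σ * cyclicShift ℓ z := by
  ext i j
  have hmap : (cyclicDiag σ ℓ b).map σ = Matrix.diagonal fun i : Fin ℓ => σ ((σ ^ (i : ℕ)) b) := by
    rw [cyclicDiag, Matrix.diagonal_map (map_zero σ)]
  rw [hmap, cyclicDiag, Matrix.mul_diagonal, Matrix.diagonal_mul, ← AlgEquiv.mul_apply, ← pow_succ']
  by_cases h1 : (j : ℕ) = i + 1
  · rw [h1, mul_comm]
  · by_cases h2 : (i : ℕ) + 1 = ℓ ∧ (j : ℕ) = 0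
    · rw [h2.1, h2.2, hσ, pow_zero, mul_comm]
    · simp [cyclicShift, h1, h2]

/-- The elements of the cyclic algebra satisfy `x y = σ(y) x`, where `σ` acts on the entries. -/
theorem cyclicShift_mul_of_mem {σ : K ≃ₐ[F] K} {ℓ : ℕ} (hσ : σ ^ ℓ = 1) {z : F}
    {Y : Matrix (Fin ℓ) (Fin ℓ) K} (hY : Y ∈ cyclicAlgebra σ ℓ z) :
    cyclicShift ℓ (algebraMap F K z) * Y = Y.map σ * cyclicShift ℓ (algebraMap F K z) := by
  rw [cyclicAlgebra] at hY
  have hadd : ∀ Y Y' : Matrix (Fin ℓ) (Fin ℓ) K, (Y + Y').map σ = Y.map σ + Y'.map σ :=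
    fun Y Y' => Matrix.map_add σ (map_add σ) Y Y'
  have hmul : ∀ Y Y' : Matrix (Fin ℓ) (Fin ℓ) K, (Y * Y').map σ = Y.map σ * Y'.map σ :=
    fun Y Y' => by
      ext i j
      simp [Matrix.mul_apply]
  induction hY using Algebra.adjoin_induction with
  | mem Y hY =>
    rcases hY with ⟨b, rfl⟩ | rfl
    · exact cyclicShift_mul_cyclicDiag hσ _ b
    · congr 1
      ext i j
      simp only [cyclicShift, Matrix.map_apply, Matrix.of_apply]
      split_ifs <;> simp
  | algebraMap c =>
    have : (algebraMap F (Matrix (Fin ℓ) (Fin ℓ) K) c).map σ =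
        algebraMap F (Matrix (Fin ℓ) (Fin ℓ) K) c := by
      ext i j
      simp only [Matrix.map_apply, Matrix.algebraMap_matrix_apply]
      split_ifs <;> simp
    rw [this]
    exact (Algebra.commutes c _).symm
  | add Y Y' _ _ h h' => rw [hadd, mul_add, add_mul, h, h']
  | mul Y Y' _ _ h h' => rw [hmul, ← mul_assoc, h, mul_assoc, h', mul_assoc]

variable {Γ : Type*} [LinearOrderedCommGroupWithZero Γ] (v : Valuation K Γ)

theorem valuation_sum_ne_zero {ι : Type*} [Fintype ι] {f : ι → K} (i : ι)
    (hi : f i ≠ 0) (h : ∀ j, j ≠ i → v (f j) < v (f i)) : ∑ j, f j ≠ 0 := by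
  classical
  intro h0
  rw [← Finset.add_sum_erase _ _ (Finset.mem_univ i)] at h0
  have h1 : v (∑ j ∈ Finset.univ.erase i, f j) < v (f i) :=
    v.map_sum_lt ((map_ne_zero v).2 hi) fun j hj => h j (Finset.ne_of_mem_erase hj)
  rw [← neg_eq_of_add_eq_zero_right h0, v.map_neg] at h1
  exact lt_irrefl _ h1

/-- The valuations of the entries in the rows of an element of a cyclic algebra are determined by
those in the first row. -/
theorem valuation_entry_of_mem {σ : K ≃ₐ[F] K} {ℓ : ℕ} [NeZero ℓ] (hσ : σ ^ ℓ = 1) {z : F}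
    (hv : ∀ b, v (σ b) = v b) {Y : Matrix (Fin ℓ) (Fin ℓ) K} (hY : Y ∈ cyclicAlgebra σ ℓ z)
    (a c : Fin ℓ) : v (Y a c) ^ ℓ * v (algebraMap F K z) ^ (c : ℕ) =
      v (algebraMap F K z) ^ (a : ℕ) *
        (v (Y 0 (c - a)) ^ ℓ * v (algebraMap F K z) ^ ((c - a : Fin ℓ) : ℕ)) := by
  have hcomm := cyclicShift_mul_of_mem hσ hY
  set γ := v (algebraMap F K z) with hγ
  -- By `x Y = σ(Y) x`, each row is the previous one with `σ` applied and moved by one column.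
  -- Wrapping around gives a factor `z`, whose `ℓ`-th power compensates for the jump of the column
  -- index from `ℓ - 1` to `0`.
  have key : ∀ m : ℕ, ∀ a : Fin ℓ, (a : ℕ) = m → ∀ c : Fin ℓ,
      v (Y a c) ^ ℓ * γ ^ (c : ℕ) =
        γ ^ (a : ℕ) * (v (Y 0 (c - a)) ^ ℓ * γ ^ ((c - a : Fin ℓ) : ℕ)) := by
    intro m
    induction m with
    | zero =>
      intro a ha c
      obtain rfl : a = 0 := Fin.ext (by simpa using ha)
      simp
    | succ m ih =>
      intro a ha c
      have hℓ : m + 1 < ℓ := ha ▸ a.2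
      have hone : ((1 : Fin ℓ) : ℕ) = 1 := by
        rw [Fin.val_one', Nat.mod_eq_of_lt (by omega)]
      let a' : Fin ℓ := ⟨m, by omega⟩
      have ha' : a = a' + 1 := Fin.ext (by
        rw [Fin.val_add, hone, ha]
        exact (Nat.mod_eq_of_lt hℓ).symm)
      have hrow : ∀ j, Y a j = (Y.map σ * cyclicShift ℓ (algebraMap F K z)) a' j := fun j => by
        rw [← hcomm, cyclicShift_mul_apply_succ _ Y a' a j ha]
      have hih := ih a' rfl (c - 1)
      have hsub : c - a = c - 1 - a' := by rw [ha', add_comm, sub_sub]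
      rw [hsub, ha, pow_succ', mul_assoc, ← hih, hrow]
      by_cases hc : (c : ℕ) = 0
      · have hc1 : ((c - 1 : Fin ℓ) : ℕ) + 1 = ℓ := by
          obtain rfl : c = 0 := Fin.ext (by simpa using hc)
          rw [Fin.val_sub, hone]
          simp only [Fin.val_zero, add_zero]
          rw [Nat.mod_eq_of_lt (by omega)]
          omega
        rw [mul_cyclicShift_apply_zero _ _ a' (c - 1) c hc hc1, hc, map_mul, Matrix.map_apply, hv,
          mul_pow, ← hγ]
        conv_lhs => rw [show γ ^ ℓ = γ ^ (((c - 1 : Fin ℓ) : ℕ) + 1) by rw [hc1]]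
        rw [pow_succ, pow_zero, mul_one]
        rw [← mul_assoc, mul_comm _ γ]
      · have hc1 : (c : ℕ) = ((c - 1 : Fin ℓ) : ℕ) + 1 := by
          rw [Fin.val_sub_one_of_ne_zero (fun h => hc (by simp [h]))]
          omega
        rw [mul_cyclicShift_apply_succ _ _ a' (c - 1) c hc1, Matrix.map_apply, hv]
        conv_lhs => rw [hc1, pow_succ]
        rw [← mul_assoc, mul_comm _ γ]
  exact key a a rfl c

/-- Nonzero elements of the cyclic algebra have no kernel. -/
theorem mulVec_ne_zero_of_mem {σ : K ≃ₐ[F] K} {ℓ : ℕ} (hσ : σ ^ ℓ = 1) {z : F}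
    (hz : z ≠ 0) (hv : ∀ b, v (σ b) = v b)
    (hγ : ∀ b c : K, b ≠ 0 → c ≠ 0 → ∀ i < ℓ, ∀ j < ℓ, v b ^ ℓ * v (algebraMap F K z) ^ i =
      v c ^ ℓ * v (algebraMap F K z) ^ j → i = j)
    {Y : Matrix (Fin ℓ) (Fin ℓ) K} (hY : Y ∈ cyclicAlgebra σ ℓ z) (hY0 : Y ≠ 0) {u : Fin ℓ → K}
    (hu : u ≠ 0) : Y.mulVec u ≠ 0 := by
  obtain ⟨c₁, hc₁⟩ := Function.ne_iff.1 hu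
  have : NeZero ℓ := ⟨by have := c₁.2; omega⟩
  have hℓ : ℓ ≠ 0 := NeZero.ne ℓ
  have hent := valuation_entry_of_mem v hσ hv hY
  set γ := v (algebraMap F K z) with hγdef
  have hγ0 : γ ≠ 0 := (map_ne_zero v).2 ((map_ne_zero _).2 hz)
  -- If `Y = ∑ b_i x^i`, then `Ω i` is the `ℓ`-th power of the would-be valuation of `b_i x^i`,
  -- where `x` gets the `ℓ`-th root of `γ`. In `μ`, the exponent `ℓ - c` stands for `-c`.
  set Ω : Fin ℓ → Γ := fun i => v (Y 0 i) ^ ℓ * γ ^ (i : ℕ) with hΩ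
  set μ : Fin ℓ → Γ := fun c => v (u c) ^ ℓ * γ ^ (ℓ - (c : ℕ)) with hμ
  obtain ⟨i₀, -, hi₀⟩ := Finset.exists_max_image Finset.univ Ω ⟨c₁, Finset.mem_univ _⟩
  obtain ⟨c₀, -, hc₀⟩ := Finset.exists_max_image Finset.univ μ ⟨c₁, Finset.mem_univ _⟩
  have hΩ0 : ∀ i, Ω i = 0 ↔ Y 0 i = 0 := fun i => by
    simp [hΩ, hγ0, hℓ]
  have hμ0 : μ c₀ ≠ 0 := by
    intro h0
    have := hc₀ c₁ (Finset.mem_univ _)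
    rw [h0, le_zero_iff] at this
    simp only [hμ, mul_eq_zero, pow_eq_zero_iff', map_eq_zero,
      hγ0, false_and, or_false] at this
    exact hc₁ this.1
  have hΩi₀ : Ω i₀ ≠ 0 := by
    intro h0
    apply hY0
    ext a c
    have h1 := hi₀ (c - a) (Finset.mem_univ _)
    rw [h0, le_zero_iff] at h1
    have h2 := hent a c
    have h3 : v (Y 0 (c - a)) ^ ℓ * γ ^ ((c - a : Fin ℓ) : ℕ) = 0 := h1
    rw [h3, mul_zero, mul_eq_zero, pow_eq_zero_iff hℓ, map_eq_zero] at h2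
    exact h2.resolve_right (pow_ne_zero _ hγ0)
  have hstrict : ∀ i, i ≠ i₀ → Ω i < Ω i₀ := by
    intro i hi
    refine lt_of_le_of_ne (hi₀ i (Finset.mem_univ _)) fun heq => hi (Fin.ext ?_)
    have h1 : Y 0 i₀ ≠ 0 := fun h => hΩi₀ ((hΩ0 _).2 h)
    have h2 : Y 0 i ≠ 0 := fun h => hΩi₀ (heq ▸ (hΩ0 _).2 h)
    exact hγ _ _ h2 h1 i i.2 i₀ i₀.2 heq
  -- In this row, the column `c₀` pairs the two maxima. Since the maximum of `Ω` is attained only at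
  -- `i₀`, that product strictly dominates the others, even if `μ` has ties.
  set a := c₀ - i₀ with ha
  have hca : c₀ - a = i₀ := sub_sub_cancel _ _
  have hterm : ∀ c, v (Y a c * u c) ^ ℓ * γ ^ ℓ = γ ^ (a : ℕ) * (Ω (c - a) * μ c) := by
    intro c
    have h1 : γ ^ ℓ = γ ^ (c : ℕ) * γ ^ (ℓ - (c : ℕ)) := by
      rw [← pow_add, Nat.add_sub_cancel' c.2.le]
    rw [map_mul, mul_pow, h1]
    calc _ = (v (Y a c) ^ ℓ * γ ^ (c : ℕ)) * (v (u c) ^ ℓ * γ ^ (ℓ - (c : ℕ))) := by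
          simp only [mul_assoc, mul_left_comm]
      _ = _ := by rw [hent a c, mul_assoc]
  have hlt : ∀ c, c ≠ c₀ → v (Y a c * u c) < v (Y a c₀ * u c₀) := by
    intro c hc
    have h1 : Ω (c - a) < Ω i₀ := hstrict _ fun h => hc (by rw [← sub_add_cancel c a, h, ← hca,
      sub_add_cancel])
    have h2 : γ ^ (a : ℕ) * (Ω (c - a) * μ c) < γ ^ (a : ℕ) * (Ω i₀ * μ c₀) := by
      refine mul_lt_mul_of_pos_left ?_ (zero_lt_iff.2 (pow_ne_zero _ hγ0))
      calc Ω (c - a) * μ c ≤ Ω (c - a) * μ c₀ :=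
            mul_le_mul_right (hc₀ c (Finset.mem_univ _)) _
        _ < Ω i₀ * μ c₀ := mul_lt_mul_of_pos_right h1 (zero_lt_iff.2 hμ0)
    rw [← hterm c, ← hca, ← hterm c₀] at h2
    exact lt_of_pow_lt_pow_left₀ ℓ zero_le
      (lt_of_mul_lt_mul_right h2 zero_le)
  intro h0
  have h1 := congrFun h0 a
  simp only [Matrix.mulVec, dotProduct, Pi.zero_apply] at h1
  refine valuation_sum_ne_zero v c₀ ?_ hlt h1
  intro h2
  have h3 := hterm c₀
  rw [h2, map_zero, zero_pow hℓ, zero_mul, hca] at h3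
  exact mul_ne_zero (pow_ne_zero _ hγ0) (mul_ne_zero hΩi₀ hμ0) h3.symm

/-- If `y * w = 0`, the columns of `w` lie in the kernel of `y`, so `w = 0`. Left multiplication by
`y` is then injective on a finite-dimensional space, hence surjective, and the right inverse so
obtained is two-sided because `y` can be cancelled on the left. -/
theorem isUnit_of_mem_cyclicAlgebra [FiniteDimensional F K] {σ : K ≃ₐ[F] K} {ℓ : ℕ}
    (hσ : σ ^ ℓ = 1) {z : F} (hz : z ≠ 0) (hv : ∀ b, v (σ b) = v b)
    (hγ : ∀ b c : K, b ≠ 0 → c ≠ 0 → ∀ i < ℓ, ∀ j < ℓ, v b ^ ℓ * v (algebraMap F K z) ^ i =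
      v c ^ ℓ * v (algebraMap F K z) ^ j → i = j)
    (y : cyclicAlgebra σ ℓ z) (hy : y ≠ 0) : IsUnit y := by
  have hreg : ∀ w : cyclicAlgebra σ ℓ z, y * w = 0 → w = 0 := by
    intro w hw
    apply Subtype.ext
    ext i j
    by_contra hne
    have h1 : (fun i => w.1 i j) ≠ 0 := fun h => hne (congrFun h i)
    have h2 : y.1 ≠ 0 := fun h => hy (Subtype.ext h)
    refine mulVec_ne_zero_of_mem v hσ hz hv hγ y.2 h2 h1 ?_
    have h3 : y.1 * w.1 = 0 := congrArg Subtype.val hw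
    funext k
    exact congrFun (congrFun h3 k) j
  have : FiniteDimensional F (Matrix (Fin ℓ) (Fin ℓ) K) := Module.Finite.trans K _
  have : FiniteDimensional F (cyclicAlgebra σ ℓ z) :=
    FiniteDimensional.finiteDimensional_submodule (Subalgebra.toSubmodule (cyclicAlgebra σ ℓ z))
  have hinj : Function.Injective (LinearMap.mulLeft F y) := by
    rw [injective_iff_map_eq_zero]
    exact hreg
  obtain ⟨w, hw⟩ := LinearMap.injective_iff_surjective.1 hinj 1
  rw [LinearMap.mulLeft_apply] at hw
  refine ⟨⟨y, w, hw, ?_⟩, rfl⟩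
  rw [← sub_eq_zero]
  apply hreg
  rw [mul_sub, mul_one, ← mul_assoc, hw, one_mul, sub_self]

/-- The first row of a product of elements `b x`. -/
theorem prod_cyclicDiag_mul_cyclicShift_apply (σ : K ≃ₐ[F] K) {ℓ : ℕ} (z : K) (m : ℕ) :
    ∀ (b : Fin m → K) (i j : Fin ℓ), (j : ℕ) = i + m →
      (List.ofFn fun k => cyclicDiag σ ℓ (b k) * cyclicShift ℓ z).prod i j =
        ∏ k : Fin m, (σ ^ ((i : ℕ) + k)) (b k) := by
  induction m with
  | zero =>
    intro b i j hj
    obtain rfl : j = i := Fin.ext (by simpa using hj)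
    simp
  | succ m ih =>
    intro b i j hj
    have hi : (i : ℕ) + 1 < ℓ := by have := j.2; omega
    rw [List.ofFn_succ, List.prod_cons, mul_assoc, cyclicDiag, Matrix.diagonal_mul,
      cyclicShift_mul_apply_succ z _ i ⟨i + 1, hi⟩ j rfl]
    rw [ih _ _ _ (by simp only; omega), Fin.prod_univ_succ]
    simp only [Fin.val_zero, add_zero, Fin.val_succ]
    congr 1
    refine Finset.prod_congr rfl fun k _ => ?_
    rw [show (i : ℕ) + 1 + k = i + (k + 1) by omega]

end CyclicDivision

/-! ## A cyclic group of residues -/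

section Residues

/-- The exponent of `p` in the modulus `2 ^ τ * p ^ oddExp p` of the residues that are congruent
to `1`. -/
def oddExp (p : ℕ) : ℕ := if 2 < p then 1 else 0

/-- The number `2 ^ τ * p` (for odd `p`) or `2 ^ τ` (for `p = 2`). -/
def baseModulus (p τ : ℕ) : ℕ := 2 ^ τ * p ^ oddExp p

variable {p τ : ℕ}

theorem four_le_baseModulus (hp : p.Prime) (hτ : 2 ≤ τ) : 4 ≤ baseModulus p τ := by
  have h1 : 2 ^ 2 ≤ 2 ^ τ := Nat.pow_le_pow_right (by norm_num) hτ
  have h2 : 1 ≤ p ^ oddExp p := Nat.one_le_pow _ _ hp.pos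
  exact (Nat.mul_le_mul h1 h2)

/-- Lifting of exponents. The divisibility of `baseModulus p τ ^ p` that it needs comes from `4 ∣ 2
^ τ` for `p = 2`, and from `p ∣ baseModulus p τ` together with `p ≥ 3` otherwise. -/
theorem exists_one_add_baseModulus_pow (hp : p.Prime) (hτ : 2 ≤ τ) (i : ℕ) :
    ∃ y, (1 + baseModulus p τ) ^ p ^ i = 1 + p ^ i * baseModulus p τ * (1 + p * y) := by
  have h1 : p ∣ baseModulus p τ ∧ p * baseModulus p τ * p ∣ baseModulus p τ ^ p := by
    rcases hp.eq_two_or_odd' with rfl | hodd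
    · have h4 : 4 ∣ 2 ^ τ := by
        have := pow_dvd_pow 2 hτ; norm_num at this; exact this
      have : baseModulus 2 τ = 2 ^ τ := by simp [baseModulus, oddExp]
      rw [this]
      refine ⟨dvd_pow_self 2 (by omega), ?_⟩
      rw [sq (2 ^ τ), show 2 * 2 ^ τ * 2 = 2 ^ τ * 4 by ring]
      exact mul_dvd_mul_left _ h4
    · have hp3 : 2 < p := by
        have := hp.two_le
        rcases hodd with ⟨k, hk⟩
        omega
      have hdvd : p ∣ baseModulus p τ := by
        simp [baseModulus, oddExp, hp3]
      refine ⟨hdvd, ?_⟩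
      obtain ⟨q, rfl⟩ : ∃ q, p = q + 3 := ⟨p - 3, by omega⟩
      rw [pow_add, show (q + 3) * baseModulus (q + 3) τ * (q + 3) =
        baseModulus (q + 3) τ * (q + 3) ^ 2 by ring]
      refine dvd_mul_of_dvd_right ?_ _
      rw [pow_succ' _ 2]
      exact mul_dvd_mul_left _ (pow_dvd_pow_of_dvd hdvd 2)
  have := ZMod.exists_one_add_mul_pow_prime_pow_eq hp h1.1 h1.2 1 i
  simpa using this

/-- The generator of the group of residues that are congruent to `1`. -/
theorem orderOf_one_add_baseModulus (hp : p.Prime) (hτ : 2 ≤ τ) (l : ℕ) :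
    orderOf (1 + baseModulus p τ : ZMod (baseModulus p τ * p ^ (l + 1))) = p ^ (l + 1) := by
  have : Fact p.Prime := ⟨hp⟩
  have hG := four_le_baseModulus hp hτ
  have hcast : ∀ k : ℕ, ((1 + baseModulus p τ : ZMod (baseModulus p τ * p ^ (l + 1))) ^ k) =
      (((1 + baseModulus p τ) ^ k : ℕ) : ZMod _) := fun k => by push_cast; rfl
  refine orderOf_eq_prime_pow ?_ ?_
  · obtain ⟨y, hy⟩ := exists_one_add_baseModulus_pow hp hτ l
    rw [hcast, hy]
    intro h
    have h1 : (((p ^ l * baseModulus p τ * (1 + p * y) : ℕ)) :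
        ZMod (baseModulus p τ * p ^ (l + 1))) = 0 := by
      rw [Nat.cast_add, Nat.cast_one] at h
      exact add_eq_left.1 h
    rw [ZMod.natCast_eq_zero_iff, pow_succ, ← mul_assoc, mul_comm (p ^ l)] at h1
    have h2 := (Nat.mul_dvd_mul_iff_left (show 0 < baseModulus p τ * p ^ l from
      Nat.mul_pos (by omega) (pow_pos hp.pos _))).1 h1
    rw [Nat.dvd_add_left (dvd_mul_right p y)] at h2
    exact hp.one_lt.ne' (Nat.dvd_one.1 h2)
  · obtain ⟨y, hy⟩ := exists_one_add_baseModulus_pow hp hτ (l + 1)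
    rw [hcast, hy, Nat.cast_add, Nat.cast_one, add_eq_left, ZMod.natCast_eq_zero_iff]
    exact dvd_mul_of_dvd_left (by rw [mul_comm]) _

theorem coprime_pred_pow (hp : p.Prime) (L : ℕ) : Nat.Coprime (p ^ L) (p - 1) := by
  refine Nat.Coprime.pow_left _ ?_
  have : Nat.Coprime (p - 1 + 1) (p - 1) := by simp
  rwa [Nat.sub_add_cancel hp.pos] at this

/-- Up to elements of order dividing `p - 1`, every residue that is congruent to `1` modulo `2 ^ τ`
is a power of the generator. -/
theorem exists_pow_pred_eq (hp : p.Prime) (hτ : 2 ≤ τ) {l N : ℕ}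
    (hN : N = baseModulus p τ * p ^ (l + 1)) (u : (ZMod N)ˣ)
    (hu : (u : ZMod N).val ≡ 1 [MOD 2 ^ τ]) : ∃ k : ℕ, (u : ZMod N) ^ (p - 1) =
      ((1 + baseModulus p τ : ZMod N) ^ k) ^ (p - 1) := by
  have hG := four_le_baseModulus hp hτ
  set G := baseModulus p τ with hGdef
  have hppos : 0 < p ^ (l + 1) := pow_pos hp.pos _
  have hNpos : 0 < N := hN ▸ Nat.mul_pos (by omega) hppos
  have : NeZero N := ⟨hNpos.ne'⟩
  have hord := orderOf_one_add_baseModulus hp hτ l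
  rw [← hGdef, ← hN] at hord
  set g : ZMod N := 1 + G with hg
  -- A counting argument: at most `p ^ (l + 1)` residues are congruent to `1` modulo `G`, and the
  -- elements `(g ^ k) ^ (p - 1)`, `k < p ^ (l + 1)`, are that many distinct ones. So every such
  -- residue has this form, in particular `u ^ (p - 1)`.
  let T : Finset (ZMod N) := (Finset.range (p ^ (l + 1))).image fun y : ℕ => (1 + G * y : ZMod N)
  have hT : ∀ v : ZMod N, v.val ≡ 1 [MOD G] → v ∈ T := by
    intro v hv
    refine Finset.mem_image.2 ⟨v.val / G, ?_, ?_⟩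
    · rw [Finset.mem_range, Nat.div_lt_iff_lt_mul (by omega), mul_comm]
      exact hN ▸ v.val_lt
    · have h1 : v.val % G = 1 := by rw [hv, Nat.mod_eq_of_lt (by omega)]
      have h2 := Nat.mod_add_div v.val G
      rw [h1] at h2
      calc (1 + G * ((v.val / G : ℕ) : ZMod N) : ZMod N) = ((1 + G * (v.val / G) : ℕ) : ZMod N) := by
            push_cast; ring
        _ = v := by rw [h2, ZMod.natCast_zmod_val]
  have hval : ∀ a : ℕ, ((a : ZMod N)).val ≡ a [MOD G] := fun a => by
    rw [ZMod.val_natCast]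
    exact (Nat.mod_modEq a N).of_dvd ⟨_, hN⟩
  have hgmem : ∀ k : ℕ, (g ^ k) ^ (p - 1) ∈ T := by
    intro k
    apply hT
    have : ((g ^ k) ^ (p - 1) : ZMod N) = (((1 + G) ^ (k * (p - 1)) : ℕ) : ZMod N) := by
      rw [hg, ← pow_mul]; push_cast; rfl
    rw [this]
    refine (hval _).trans ?_
    have h1 : 1 + G ≡ 1 [MOD G] := by simp [Nat.ModEq]
    simpa using h1.pow (k * (p - 1))
  have hinj : Set.InjOn (fun k : ℕ => (g ^ k) ^ (p - 1)) (Finset.range (p ^ (l + 1)) : Set ℕ) := by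
    intro j hj k hk hjk
    have hunit : IsUnit g := by
      refine IsUnit.of_pow_eq_one (n := p ^ (l + 1)) ?_ hppos.ne'
      rw [← hord, pow_orderOf_eq_one]
    obtain ⟨w, hw⟩ := hunit
    have hordw : orderOf w = p ^ (l + 1) := by rw [← hord, ← hw, orderOf_units]
    have h1 : w ^ (j * (p - 1)) = w ^ (k * (p - 1)) := by
      apply Units.ext
      simpa [hw, ← pow_mul] using hjk
    rw [pow_eq_pow_iff_modEq, hordw] at h1
    have h2 := Nat.ModEq.cancel_right_of_coprime (coprime_pred_pow hp (l + 1)) h1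
    simp only [Finset.coe_range, Set.mem_Iio] at hj hk
    exact Nat.ModEq.eq_of_lt_of_lt h2 hj hk
  have himg : (Finset.range (p ^ (l + 1))).image (fun k : ℕ => (g ^ k) ^ (p - 1)) = T := by
    refine Finset.eq_of_subset_of_card_le ?_ ?_
    · intro v hv
      obtain ⟨k, -, rfl⟩ := Finset.mem_image.1 hv
      exact hgmem k
    · rw [Finset.card_image_of_injOn hinj]
      exact Finset.card_image_le
  have humem : (u : ZMod N) ^ (p - 1) ∈ T := by
    apply hT
    have h1 : (u : ZMod N) ^ (p - 1) = (((u : ZMod N).val ^ (p - 1) : ℕ) : ZMod N) := by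
      rw [Nat.cast_pow, ZMod.natCast_zmod_val]
    rw [h1]
    refine (hval _).trans ?_
    have h2 : (u : ZMod N).val ^ (p - 1) ≡ 1 [MOD 2 ^ τ] := by
      simpa using hu.pow (p - 1)
    rw [hGdef, baseModulus]
    -- For odd `p`, the congruence modulo the extra factor `p` is Fermat's theorem; for `p = 2`
    -- there is no extra factor.
    by_cases hp2 : 2 < p
    · have hcop : Nat.Coprime (2 ^ τ) (p ^ oddExp p) := by
        refine Nat.Coprime.pow _ _ ?_
        rw [Nat.coprime_primes Nat.prime_two hp]
        omega
      refine (Nat.modEq_and_modEq_iff_modEq_mul hcop).1 ⟨h2, ?_⟩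
      rw [oddExp, if_pos hp2, pow_one]
      have h3 : Nat.Coprime (u : ZMod N).val p := by
        refine Nat.Coprime.coprime_dvd_right ?_ (ZMod.val_coe_unit_coprime u)
        rw [hN, pow_succ]
        exact dvd_mul_of_dvd_right (dvd_mul_left _ _) _
      have h4 := Nat.ModEq.pow_totient h3
      rwa [Nat.totient_prime hp] at h4
    · rw [oddExp, if_neg hp2, pow_zero, mul_one]
      exact h2
  rw [← himg] at humem
  obtain ⟨k, -, hk⟩ := Finset.mem_image.1 humem
  exact ⟨k, hk.symm⟩

end Residues

/-! ## The cyclic extension -/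

section CyclicExtension

open IntermediateField

theorem map_fourierElement {E E' : Type*} [Field E] [Field E'] (s : E →+* E') (ζ : E) (N A : ℕ)
    [NeZero N] (Φ : ZMod N → ℤ) :
    s (fourierElement ζ N A Φ) = fourierElement (s ζ) N A Φ := by
  simp only [fourierElement, map_sum, map_mul, map_intCast, map_pow]

/-- The cyclic extension of degree `p ^ (l + 1)` in a cyclotomic extension. -/
theorem exists_cyclic_subextension {F E : Type*} [Field F] [Field E] [Algebra F E] {N : ℕ}
    [NeZero N] {ζ : E} (hζ : IsPrimitiveRoot ζ N) {p l τ : ℕ} (hp : p.Prime) (hτ : 2 ≤ τ)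
    (hN : N = baseModulus p τ * p ^ (l + 1)) (S : E →ₐ[F] E)
    (hS : S ζ = ζ ^ (1 + baseModulus p τ)) {ω : F}
    (hω : algebraMap F E ω = ζ ^ p ^ (oddExp p + (l + 1))) :
    ∃ (K : IntermediateField F E) (σ : K ≃ₐ[F] K), K ≤ adjoin F {ζ} ∧ IsGalois F K ∧
      Module.finrank F K = p ^ (l + 1) ∧ (∀ g : K ≃ₐ[F] K, g ∈ Subgroup.zpowers σ) ∧
      (∀ x : K, ((σ x : K) : E) = S x) ∧
      ∀ (A : ℕ) (Φ : ZMod N → ℤ), (∀ h u : ZMod N, u ^ (p - 1) = 1 → Φ (h * u) = Φ h) →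
        fourierElement ζ N A Φ ∈ K := by
  have hN0 : N ≠ 0 := NeZero.ne N
  have hint : IsIntegral F ζ := (hζ.isIntegral (Nat.pos_of_ne_zero hN0)).tower_top
  set M := adjoin F {ζ} with hM
  have hcyc : IsCyclotomicExtension {N} F M := by
    change IsCyclotomicExtension {N} F M.toSubalgebra
    rw [hM, adjoin_simple_toSubalgebra_of_isAlgebraic hint.isAlgebraic]
    exact hζ.adjoin_isCyclotomicExtension F
  have : FiniteDimensional F M := adjoin.finiteDimensional hint
  have : IsGalois F M := IsCyclotomicExtension.isGalois {N} F M
  let μ : M := AdjoinSimple.gen F ζ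
  have hμE : (μ : E) = ζ := AdjoinSimple.coe_gen F ζ
  have hμ : IsPrimitiveRoot μ N := by
    rw [← hμE] at hζ
    exact IsPrimitiveRoot.of_map_of_injective (f := algebraMap M E) hζ (algebraMap M E).injective
  let χ : (M ≃ₐ[F] M) →* (ZMod N)ˣ := hμ.autToPow F
  have hχ : ∀ γ : M ≃ₐ[F] M, γ μ = μ ^ (χ γ : ZMod N).val := fun γ =>
    (hμ.autToPow_spec F γ).symm
  have hχinj : Function.Injective χ := hμ.autToPow_injective F
  -- powers of the root of unity
  have hpowinj : ∀ a b : ℕ, μ ^ a = μ ^ b → (a : ZMod N) = b := by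
    intro a b hab
    have hfin : IsOfFinOrder μ := orderOf_pos_iff.1 (hμ.eq_orderOf ▸ Nat.pos_of_ne_zero hN0)
    have hab' := hfin.pow_eq_pow_iff_modEq.1 hab
    rw [← hμ.eq_orderOf] at hab'
    exact (ZMod.natCast_eq_natCast_iff _ _ _).2 hab'
  -- all automorphisms fix the roots of unity in the base field
  have hωμ : algebraMap F M ω = μ ^ p ^ (oddExp p + (l + 1)) := by
    apply Subtype.ext
    rw [← hμE] at hω
    simpa using hω
  have hfix : ∀ γ : M ≃ₐ[F] M, (χ γ : ZMod N).val ≡ 1 [MOD 2 ^ τ] := by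
    intro γ
    have h1 := γ.commutes ω
    rw [hωμ, map_pow, hχ, ← pow_mul, mul_comm, pow_mul] at h1
    have h2 : orderOf (μ ^ p ^ (oddExp p + (l + 1))) = 2 ^ τ := by
      rw [orderOf_pow' _ (pow_ne_zero _ hp.ne_zero), ← hμ.eq_orderOf, hN, baseModulus, mul_assoc,
        ← pow_add, Nat.gcd_eq_right (dvd_mul_left _ _),
        Nat.mul_div_cancel _ (pow_pos hp.pos _)]
    conv_rhs at h1 => rw [← pow_one (μ ^ p ^ (oddExp p + (l + 1)))]
    have hfin : IsOfFinOrder (μ ^ p ^ (oddExp p + (l + 1))) :=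
      orderOf_pos_iff.1 (h2 ▸ pow_pos two_pos τ)
    rw [← h2]
    exact hfin.pow_eq_pow_iff_modEq.1 h1
  let γ₀ : M ≃ₐ[F] M := S.restrictNormal' M
  have hγ₀ : ∀ x : M, ((γ₀ x : M) : E) = S x := fun x => S.restrictNormal_commutes M x
  have hχγ₀ : (χ γ₀ : ZMod N) = 1 + baseModulus p τ := by
    have h1 : γ₀ μ = μ ^ (1 + baseModulus p τ) := by
      apply Subtype.ext
      rw [hγ₀, hμE, hS]
      simp [hμE]
    rw [hχ] at h1
    have h2 := hpowinj _ _ h1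
    rwa [ZMod.natCast_zmod_val, Nat.cast_add, Nat.cast_one] at h2
  -- `K` will be the fixed field of the automorphisms whose cyclotomic character is killed by `p -
  -- 1`. Modulo these, every automorphism is a power of the one induced by `S`.
  let H : Subgroup (M ≃ₐ[F] M) := (powMonoidHom (p - 1) : (ZMod N)ˣ →* (ZMod N)ˣ).ker.comap χ
  have hH : ∀ γ, γ ∈ H ↔ (χ γ : ZMod N) ^ (p - 1) = 1 := by
    intro γ
    rw [Subgroup.mem_comap, MonoidHom.mem_ker, powMonoidHom_apply, ← Units.val_inj]
    simp
  have hHn : H.Normal := by infer_instance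
  let K' : IntermediateField F M := fixedField H
  have hK'gal : IsGalois F K' := inferInstance
  let K : IntermediateField F E := lift K'
  let e : K' ≃ₐ[F] K := liftAlgEquiv K'
  have hKgal : IsGalois F K := IsGalois.of_algEquiv e
  have hKM : K ≤ M := lift_le K'
  have : FiniteDimensional F K := e.toLinearEquiv.finiteDimensional
  let σ : K ≃ₐ[F] K := S.restrictNormal' K
  have hσ : ∀ x : K, ((σ x : K) : E) = S x := fun x => S.restrictNormal_commutes K x
  have hσpow : ∀ (k : ℕ) (x : K), (((σ ^ k) x : K) : E) = ((γ₀ ^ k) ⟨x, hKM x.2⟩ : M) := by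
    intro k
    induction k with
    | zero => intro x; simp
    | succ k ih =>
      intro x
      rw [pow_succ, pow_succ, AlgEquiv.mul_apply, AlgEquiv.mul_apply, ih]
      congr 2
      exact Subtype.ext ((hσ x).trans (hγ₀ ⟨x, hKM x.2⟩).symm)
  have hmemK : ∀ x : M, (x : E) ∈ K ↔ ∀ γ ∈ H, γ x = x := by
    intro x
    rw [show K = lift K' from rfl, mem_lift, mem_fixedField_iff]
  -- the automorphisms of `K` are restrictions
  have hext : ∀ κ : K ≃ₐ[F] K, ∃ γ : M ≃ₐ[F] M, ∀ x : K, ((κ x : K) : E) = (γ ⟨x, hKM x.2⟩ : M) := by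
    intro κ
    obtain ⟨γ, hγ⟩ := AlgEquiv.restrictNormalHom_surjective (F := F) (K₁ := K') M
      ((e.trans κ).trans e.symm)
    refine ⟨γ, fun x => ?_⟩
    have h1 := AlgEquiv.restrictNormal_commutes γ K' (e.symm x)
    have h2 : (AlgEquiv.restrictNormal γ K') (e.symm x) = e.symm (κ x) := by
      have := DFunLike.congr_fun hγ (e.symm x)
      simpa [AlgEquiv.restrictNormalHom] using this
    rw [h2] at h1
    have h3 := congrArg (Subtype.val : M → E) h1
    exact h3
  have hgen : ∀ κ : K ≃ₐ[F] K, ∃ k : ℕ, κ = σ ^ k := by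
    intro κ
    obtain ⟨γ, hγ⟩ := hext κ
    obtain ⟨k, hk⟩ := exists_pow_pred_eq hp hτ hN (χ γ) (hfix γ)
    refine ⟨k, AlgEquiv.ext fun x => Subtype.ext ?_⟩
    rw [hγ, hσpow]
    -- The characters of `γ` and `γ₀ ^ k` have the same power with exponent `p - 1`, so the two
    -- automorphisms agree on `K`.
    have hη : (γ₀ ^ k)⁻¹ * γ ∈ H := by
      rw [Subgroup.mem_comap, MonoidHom.mem_ker, powMonoidHom_apply, map_mul, mul_pow, map_inv,
        inv_pow, inv_mul_eq_one, map_pow, ← Units.val_inj]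
      simp only [Units.val_pow_eq_pow_val, hχγ₀]
      exact hk.symm
    have h1 := (hmemK ⟨x, hKM x.2⟩).1 x.2 _ hη
    have h2 : (γ₀ ^ k) (((γ₀ ^ k)⁻¹ * γ) ⟨x, hKM x.2⟩) = γ ⟨x, hKM x.2⟩ := by
      rw [← AlgEquiv.mul_apply, mul_inv_cancel_left]
    rw [h1] at h2
    rw [h2]
  have hord : orderOf σ = p ^ (l + 1) := by
    have hg := orderOf_one_add_baseModulus hp hτ l
    rw [← hN, ← hχγ₀, orderOf_units] at hg
    apply Nat.dvd_antisymm
    · rw [orderOf_dvd_iff_pow_eq_one]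
      refine AlgEquiv.ext fun x => Subtype.ext ?_
      have h1 : γ₀ ^ p ^ (l + 1) = 1 := by
        apply hχinj
        rw [map_pow, ← hg, pow_orderOf_eq_one, map_one]
      rw [hσpow, h1]
      simp
    -- A power of `γ₀` that is trivial on `K` lies in `H`. Then `p ^ (l + 1)` divides the exponent
    -- times `p - 1`, and the latter is coprime to `p`.
    · have h1 : γ₀ ^ orderOf σ ∈ fixingSubgroup K' := by
        rw [IntermediateField.mem_fixingSubgroup_iff]
        intro x hx
        have hx' : (x : E) ∈ K := (mem_lift x).2 hx
        apply Subtype.ext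
        have h2 := hσpow (orderOf σ) ⟨x, hx'⟩
        rw [pow_orderOf_eq_one] at h2
        exact h2.symm
      rw [fixingSubgroup_fixedField, hH, map_pow, Units.val_pow_eq_pow_val, ← pow_mul,
        ← orderOf_dvd_iff_pow_eq_one, orderOf_units, hg] at h1
      exact (coprime_pred_pow hp (l + 1)).dvd_of_dvd_mul_right h1
  have hzp : ∀ κ : K ≃ₐ[F] K, κ ∈ Subgroup.zpowers σ := fun κ => by
    obtain ⟨k, rfl⟩ := hgen κ
    exact Subgroup.npow_mem_zpowers σ k
  refine ⟨K, σ, hKM, hKgal, ?_, hzp, hσ, fun A Φ hΦ => ?_⟩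
  · rw [← IsGalois.card_aut_eq_finrank, ← hord, ← Nat.card_zpowers,
      (Subgroup.eq_top_iff' _).2 hzp, Nat.card_congr (Subgroup.topEquiv).toEquiv]
  · have h1 : fourierElement ζ N A Φ = (fourierElement μ N A Φ : M) := by
      rw [← hμE]
      exact (map_fourierElement (algebraMap M E) μ N A Φ).symm
    rw [h1, hmemK]
    -- Elements of `H` translate `Φ` by residues under which it is invariant.
    intro γ hγ
    rw [fourierElement_map hμ.pow_eq_one Φ γ (χ γ) (hχ γ)]
    congr 1
    funext h
    exact hΦ h _ ((hH γ).1 hγ)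

end CyclicExtension

/-! ## Automorphisms of the rational function field over `ℂ` -/

section Automorphisms

open Cardinal

/-- Algebraically closed fields with equipotent transcendence bases over a field are isomorphic
over that field. -/
theorem exists_ringEquiv_of_isTranscendenceBasis {R K L ι κ : Type*} [Field R] [Field K] [Field L]
    [Algebra R K] [Algebra R L] [IsAlgClosed K] [IsAlgClosed L] {v : ι → K} {w : κ → L}
    (hv : IsTranscendenceBasis R v) (hw : IsTranscendenceBasis R w) (e : ι ≃ κ) :
    ∃ s : K ≃+* L, ∀ r : R, s (algebraMap R K r) = algebraMap R L r := by
  have := IsAlgClosed.isAlgClosure_of_transcendence_basis v hv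
  have := IsAlgClosed.isAlgClosure_of_transcendence_basis w hw
  let f : Algebra.adjoin R (Set.range v) ≃ₐ[R] Algebra.adjoin R (Set.range w) :=
    (hv.1.aevalEquiv.symm.trans (MvPolynomial.renameEquiv R e)).trans hw.1.aevalEquiv
  refine ⟨IsAlgClosure.equivOfEquiv K L f.toRingEquiv, fun r => ?_⟩
  rw [IsScalarTower.algebraMap_apply R (Algebra.adjoin R (Set.range v)) K,
    IsAlgClosure.equivOfEquiv_algebraMap]
  exact congrArg (algebraMap (Algebra.adjoin R (Set.range w)) L) (f.commutes r)

/-- Over a countable field, every transcendence basis of `ℂ` has the cardinality of the continuum,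
whichever embedding is used; a bijection between bases extends to the algebraic closures. -/
theorem exists_ringEquiv_complex_comp {R : Type} [Field R] (hR : #R ≤ ℵ₀) (i j : R →+* ℂ) :
    ∃ s : ℂ ≃+* ℂ, ∀ r, s (i r) = j r := by
  -- Two fields are needed in this form because `ℂ` carries two different structures of an
  -- `R`-algebra.
  have key : ∀ (K L : Type) [Field K] [Field L] [IsAlgClosed K] [IsAlgClosed L] [Algebra R K]
      [Algebra R L], ℵ₀ < #K → #K = #L →
      ∃ s : K ≃+* L, ∀ r : R, s (algebraMap R K r) = algebraMap R L r := by
    intro K L _ _ _ _ _ _ hK hKL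
    obtain ⟨s, hs⟩ := exists_isTranscendenceBasis R K
    obtain ⟨t, ht⟩ := exists_isTranscendenceBasis R L
    have h1 := IsAlgClosed.cardinal_eq_cardinal_transcendence_basis_of_aleph0_lt' _ hs hR hK
    have h2 := IsAlgClosed.cardinal_eq_cardinal_transcendence_basis_of_aleph0_lt' _ ht hR
      (hKL ▸ hK)
    obtain ⟨e⟩ := Cardinal.eq.1 (h1.symm.trans (hKL.trans h2))
    exact exists_ringEquiv_of_isTranscendenceBasis hs ht e
  exact @key ℂ ℂ _ _ _ _ i.toAlgebra j.toAlgebra (by rw [mk_complex]; exact aleph0_lt_continuum) rfl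

/-- The automorphisms of `ℂ` permute the primitive roots of unity transitively. -/
theorem exists_ringEquiv_complex_of_isPrimitiveRoot {N : ℕ} (hN : 0 < N) {ζ ξ : ℂ}
    (hζ : IsPrimitiveRoot ζ N) (hξ : IsPrimitiveRoot ξ N) : ∃ s : ℂ ≃+* ℂ, s ζ = ξ := by
  have : Fact (Irreducible (Polynomial.cyclotomic N ℚ)) :=
    ⟨Polynomial.cyclotomic.irreducible_rat hN⟩
  have hroot : ∀ x : ℂ, IsPrimitiveRoot x N →
      (Polynomial.cyclotomic N ℚ).eval₂ (algebraMap ℚ ℂ) x = 0 := by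
    intro x hx
    rw [← Polynomial.eval_map, Polynomial.map_cyclotomic]
    exact hx.isRoot_cyclotomic hN
  have hcard : #(AdjoinRoot (Polynomial.cyclotomic N ℚ)) ≤ ℵ₀ := by
    have : Countable (Polynomial ℚ) := by
      rw [← mk_le_aleph0_iff]
      exact (Polynomial.cardinalMk_le_max).trans (by simp)
    exact (Cardinal.mk_le_of_surjective AdjoinRoot.mk_surjective).trans (mk_le_aleph0_iff.2 this)
  obtain ⟨s, hs⟩ := exists_ringEquiv_complex_comp hcard
    (AdjoinRoot.lift (algebraMap ℚ ℂ) ζ (hroot ζ hζ))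
    (AdjoinRoot.lift (algebraMap ℚ ℂ) ξ (hroot ξ hξ))
  refine ⟨s, ?_⟩
  have := hs (AdjoinRoot.root _)
  rwa [AdjoinRoot.lift_root, AdjoinRoot.lift_root] at this

/-- The action of an automorphism of `ℂ` on the coefficients of rational functions. -/
noncomputable def ratFuncMap (s : ℂ ≃+* ℂ) : RatFunc ℂ →+* RatFunc ℂ :=
  RatFunc.mapRingHom (Polynomial.mapRingHom (s : ℂ →+* ℂ))
    (nonZeroDivisors_le_comap_nonZeroDivisors_of_injective _
      (Polynomial.map_injective _ s.injective))

theorem ratFuncMap_algebraMap (s : ℂ ≃+* ℂ) (q : Polynomial ℂ) :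
    ratFuncMap s (algebraMap _ _ q) = algebraMap _ _ (q.map (s : ℂ →+* ℂ)) := by
  have := RatFunc.map_apply_div (Polynomial.mapRingHom (s : ℂ →+* ℂ))
    (nonZeroDivisors_le_comap_nonZeroDivisors_of_injective _
      (Polynomial.map_injective _ s.injective)) q 1
  simpa [ratFuncMap, RatFunc.coe_mapRingHom_eq_coe_map] using this

theorem ratFuncMap_C (s : ℂ ≃+* ℂ) (c : ℂ) : ratFuncMap s (RatFunc.C c) = RatFunc.C (s c) := by
  rw [← RatFunc.algebraMap_C, ratFuncMap_algebraMap, Polynomial.map_C, RatFunc.algebraMap_C]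
  rfl

theorem ratFuncMap_X (s : ℂ ≃+* ℂ) : ratFuncMap s RatFunc.X = RatFunc.X := by
  rw [← RatFunc.algebraMap_X, ratFuncMap_algebraMap, Polynomial.map_X]

/-- This makes the degree valuation on `K` invariant under `σ`. -/
theorem intDegree_ratFuncMap (s : ℂ ≃+* ℂ) (x : RatFunc ℂ) :
    (ratFuncMap s x).intDegree = x.intDegree := by
  induction x using RatFunc.induction_on with
  | f a b hb =>
    rcases eq_or_ne a 0 with rfl | ha
    · simp
    have hinj : ∀ q : Polynomial ℂ, q ≠ 0 → q.map (s : ℂ →+* ℂ) ≠ 0 := fun q hq =>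
      (Polynomial.map_ne_zero_iff s.injective).2 hq
    have h1 : ∀ q : Polynomial ℂ, q ≠ 0 → algebraMap (Polynomial ℂ) (RatFunc ℂ) q ≠ 0 :=
      fun q hq => RatFunc.algebraMap_ne_zero hq
    rw [map_div₀, ratFuncMap_algebraMap, ratFuncMap_algebraMap,
      RatFunc.intDegree_div (h1 _ ha) (h1 _ hb),
      RatFunc.intDegree_div (h1 _ (hinj a ha)) (h1 _ (hinj b hb))]
    simp only [RatFunc.intDegree_polynomial]
    rw [Polynomial.natDegree_map_eq_of_injective s.injective,
      Polynomial.natDegree_map_eq_of_injective s.injective]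

open scoped Classical in
theorem inftyValuation_ratFuncMap (s : ℂ ≃+* ℂ) (x : RatFunc ℂ) :
    RatFunc.inftyValuation ℂ (ratFuncMap s x) = RatFunc.inftyValuation ℂ x := by
  rcases eq_or_ne x 0 with rfl | hx
  · simp
  · have h1 : ratFuncMap s x ≠ 0 := (map_ne_zero _).2 hx
    rw [RatFunc.inftyValuation_apply, RatFunc.inftyValuation_apply,
      RatFunc.inftyValuation_of_nonzero ℂ h1, RatFunc.inftyValuation_of_nonzero ℂ hx,
      intDegree_ratFuncMap]

end Automorphisms

/-! ## The cyclic division algebra -/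

section DivisionAlgebra

theorem isPrimitiveRoot_rootOfUnity {N : ℕ} (hN : N ≠ 0) :
    IsPrimitiveRoot (rootOfUnity N) N :=
  (Complex.isPrimitiveRoot_exp N hN).map_of_injective (f := RatFunc.C) (RingHom.injective _)

theorem rootOfUnity_pow_eq {a b : ℕ} (hb : b ≠ 0) :
    rootOfUnity (a * b) ^ b = rootOfUnity a := by
  rw [rootOfUnity, rootOfUnity, ← map_pow, ← Complex.exp_nat_mul]
  congr 2
  have : (b : ℂ) ≠ 0 := Nat.cast_ne_zero.2 hb
  push_cast
  rcases eq_or_ne (a : ℂ) 0 with ha | ha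
  · simp [ha]
  · field_simp

open scoped Classical in
/-- The cyclic division algebra, with elements that have prescribed residues at suitable places. -/
theorem exists_cyclicDivisionAlgebra {p l τ : ℕ} (hp : p.Prime) (hτ : 2 ≤ τ) (N : ℕ) [NeZero N]
    (hN : N = 2 ^ τ * p ^ (oddExp p + (l + 1))) :
    ∃ (K : IntermediateField (baseField τ) (RatFunc ℂ)) (σ : K ≃ₐ[baseField τ] K),
      K ≤ IntermediateField.adjoin (baseField τ) {rootOfUnity N} ∧
      IsCyclicDivisionAlgebra σ (p ^ (l + 1)) (baseZ τ) ∧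
      ∀ (A : ℕ) (Φ : ZMod N → ℤ), (∀ h u : ZMod N, u ^ (p - 1) = 1 → Φ (h * u) = Φ h) →
        ∃ a : K, ∀ k : ℕ, (((σ ^ k) a : K) : RatFunc ℂ) =
          fourierElement (rootOfUnity N) N A fun h => Φ (h * (1 + baseModulus p τ) ^ k) := by
  have hN0 : N ≠ 0 := NeZero.ne N
  have hN' : N = baseModulus p τ * p ^ (l + 1) := by
    rw [hN, baseModulus, pow_add]; ring
  have hζ := isPrimitiveRoot_rootOfUnity hN0
  set g := 1 + baseModulus p τ with hg
  have hordg := orderOf_one_add_baseModulus hp hτ l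
  rw [← hN'] at hordg
  have hgunit : IsUnit ((g : ℕ) : ZMod N) := by
    refine IsUnit.of_pow_eq_one (n := p ^ (l + 1)) ?_ (pow_ne_zero _ hp.ne_zero)
    rw [hg, Nat.cast_add, Nat.cast_one, ← hordg, pow_orderOf_eq_one]
  have hcop : Nat.Coprime g N := (ZMod.isUnit_iff_coprime g N).1 hgunit
  -- the automorphism
  obtain ⟨s, hs⟩ := exists_ringEquiv_complex_of_isPrimitiveRoot (Nat.pos_of_ne_zero hN0)
    (Complex.isPrimitiveRoot_exp N hN0) ((Complex.isPrimitiveRoot_exp N hN0).pow_of_coprime g hcop)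
  have hsζ : ratFuncMap s (rootOfUnity N) = rootOfUnity N ^ g := by
    rw [rootOfUnity, ratFuncMap_C, hs, map_pow]
  have hω : rootOfUnity (2 ^ τ) = rootOfUnity N ^ p ^ (oddExp p + (l + 1)) := by
    rw [hN, rootOfUnity_pow_eq (pow_ne_zero _ hp.ne_zero)]
  have hω1 : rootOfUnity (2 ^ τ) ^ 2 ^ τ = 1 :=
    (isPrimitiveRoot_rootOfUnity (pow_ne_zero _ two_ne_zero)).pow_eq_one
  have hsω : ratFuncMap s (rootOfUnity (2 ^ τ)) = rootOfUnity (2 ^ τ) := by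
    -- `g` is congruent to `1` modulo `2 ^ τ`, so the automorphism fixes the base field.
    have h1 : rootOfUnity (2 ^ τ) ^ g = rootOfUnity (2 ^ τ) := by
      rw [hg, baseModulus, pow_add, pow_mul, hω1, one_pow, mul_one, pow_one]
    rw [hω, map_pow, hsζ, ← pow_mul, mul_comm, pow_mul, ← hω, h1]
  have hsF : ∀ c ∈ baseField τ, ratFuncMap s c = c := by
    intro c hc
    have h1 : baseField τ ≤ (ratFuncMap s).eqLocusField (RingHom.id _) := by
      rw [baseField, Subfield.closure_le]
      rintro x (rfl | rfl)
      · exact hsω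
      · exact ratFuncMap_X s
    exact h1 hc
  let S : RatFunc ℂ →ₐ[baseField τ] RatFunc ℂ :=
    { ratFuncMap s with commutes' := fun c => hsF c c.2 }
  have hSval : ∀ x, S x = ratFuncMap s x := fun _ => rfl
  have hωF : rootOfUnity (2 ^ τ) ∈ baseField τ := Subfield.subset_closure (by simp)
  obtain ⟨K, σ, hK, hgal, hrank, hgen, hσ, hmem⟩ := exists_cyclic_subextension hζ hp hτ hN' S hsζ
    (ω := ⟨rootOfUnity (2 ^ τ), hωF⟩) hω
  have hpos : 0 < p ^ (l + 1) := pow_pos hp.pos _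
  have hfin : FiniteDimensional (baseField τ) K :=
    Module.finite_of_finrank_pos (by rw [hrank]; exact hpos)
  have hσord : σ ^ p ^ (l + 1) = 1 := by
    rw [← hrank, ← IsGalois.card_aut_eq_finrank]
    exact pow_card_eq_one'
  have hσpow : ∀ (k : ℕ) (x : K), (((σ ^ k) x : K) : RatFunc ℂ) = (ratFuncMap s)^[k] x := by
    intro k
    induction k with
    | zero => intro x; simp
    | succ k ih => intro x; rw [pow_succ, AlgEquiv.mul_apply, ih, hσ, hSval, Function.iterate_succ_apply]
  have hz : baseZ τ ≠ 0 := fun h => RatFunc.X_ne_zero (congrArg Subtype.val h)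
  refine ⟨K, σ, hK, ⟨hgal, hrank, hpos, hgen, ?_⟩, fun A Φ hΦ => ⟨⟨_, hmem A Φ hΦ⟩, fun k => ?_⟩⟩
  -- The degree in `z`. It takes integer values on all of `K` and the value one at `z`, so `p ^ (l +
  -- 1) * deg b + i` determines `i` modulo `p ^ (l + 1)`.
  · let v : Valuation K (WithZero (Multiplicative ℤ)) :=
      (RatFunc.inftyValuation ℂ).comap (algebraMap K (RatFunc ℂ))
    have hv : ∀ b : K, v b = RatFunc.inftyValuation ℂ (b : RatFunc ℂ) := fun _ => rfl
    have hvz : v (algebraMap (baseField τ) K (baseZ τ)) = WithZero.exp 1 :=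
      RatFunc.inftyValuation.X ℂ
    refine isUnit_of_mem_cyclicAlgebra v hσord hz (fun b => ?_) ?_
    · rw [hv, hv, hσ, hSval, inftyValuation_ratFuncMap]
    · intro b c hb hc i hi j hj hij
      have hval : ∀ b : K, b ≠ 0 → v b = WithZero.exp (b : RatFunc ℂ).intDegree := by
        intro b hb
        have h1 : (b : RatFunc ℂ) ≠ 0 := fun h => hb (Subtype.ext h)
        rw [hv, RatFunc.inftyValuation_apply, RatFunc.inftyValuation_of_nonzero ℂ h1]
      rw [hvz, hval b hb, hval c hc, ← WithZero.exp_nsmul, ← WithZero.exp_nsmul,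
        ← WithZero.exp_nsmul, ← WithZero.exp_nsmul, ← WithZero.exp_add, ← WithZero.exp_add,
        WithZero.exp_inj] at hij
      simp only [nsmul_eq_mul, mul_one] at hij
      have h2 := congrArg (· % ((p ^ (l + 1) : ℕ) : ℤ)) hij
      simp only [Int.mul_add_emod_self_left] at h2
      rw [Int.emod_eq_of_lt (by omega) (by omega), Int.emod_eq_of_lt (by omega) (by omega)] at h2
      exact_mod_cast h2
  · rw [hσpow]
    simp only
    induction k with
    | zero => simp
    | succ k ih =>
      rw [Function.iterate_succ_apply', ih, fourierElement_map hζ.pow_eq_one _ _ hgunit.unit]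
      · congr 1
        funext h
        congr 1
        rw [IsUnit.unit_spec, hg, pow_succ']
        push_cast
        ring
      · rw [hsζ, IsUnit.unit_spec, ZMod.val_natCast]
        exact pow_eq_pow_mod _ hζ.pow_eq_one

end DivisionAlgebra

/-! ## Words computed by branching programs -/

section Words

theorem List.prod_ofFn_sum_smul {F B : Type*} [CommSemiring F] [Semiring B] [Algebra F B] {n : ℕ}
    (x : Fin n → B) : ∀ {d : ℕ} (a : Fin d → Fin n → F),
      (List.ofFn fun k => ∑ j, a k j • x j).prod =
        ∑ w : Fin d → Fin n, (∏ k, a k (w k)) • (List.ofFn fun k => x (w k)).prod := by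
  intro d
  induction d with
  | zero => intro a; simp
  | succ d ih =>
    intro a
    rw [List.ofFn_succ, List.prod_cons, ih fun k => a k.succ, Finset.sum_mul_sum,
      ← (Fin.consEquiv fun _ : Fin (d + 1) => Fin n).sum_comp, Fintype.sum_prod_type]
    refine Finset.sum_congr rfl fun j _ => Finset.sum_congr rfl fun w _ => ?_
    rw [smul_mul_smul_comm]
    simp [Fin.consEquiv, Fin.prod_univ_succ, List.ofFn_succ]

/-- The entries of a product of matrices are sums over paths. -/
theorem Matrix.list_prod_ofFn_apply {F ι : Type*} [Semiring F] [Fintype ι] [DecidableEq ι] {d : ℕ} :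
    ∀ (X : Fin d → Matrix ι ι F) (s t : ι), (List.ofFn X).prod s t =
      ∑ v : Fin (d + 1) → ι with v 0 = s ∧ v (Fin.last d) = t,
        (List.ofFn fun k : Fin d => X k (v k.castSucc) (v k.succ)).prod := by
  induction d with
  | zero =>
    intro X s t
    rw [Finset.sum_filter, ← (Equiv.funUnique (Fin 1) ι).symm.sum_comp]
    simp [Matrix.one_apply, ite_and]
  | succ d ih =>
    intro X s t
    rw [List.ofFn_succ, List.prod_cons, Matrix.mul_apply, Finset.sum_filter,
      ← (Fin.consEquiv fun _ : Fin (d + 1 + 1) => ι).sum_comp, Fintype.sum_prod_type]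
    refine Eq.trans ?_ (Finset.sum_eq_single s (fun a _ ha => by simp [Fin.consEquiv, ha])
      (by simp)).symm
    simp_rw [ih, Finset.mul_sum, Finset.sum_filter]
    rw [Finset.sum_comm]
    refine Finset.sum_congr rfl fun v _ => ?_
    rw [Finset.sum_eq_single (v 0) (fun a _ ha => if_neg fun h => ha h.1.symm) (by simp)]
    simp [Fin.consEquiv, List.ofFn_succ, ← Fin.succ_last]

variable {F : Type*} [Field F] {n r d : ℕ}

/-- The coefficient of a word in the polynomial computed by the program. -/
def HomABP.wordCoeff (A : HomABP F n r d) (w : Fin d → Fin n) : F :=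
  (List.ofFn fun k => Matrix.of fun α β => A.coeff k α β (w k)).prod A.source A.sink

theorem HomABP.lift_poly (A : HomABP F n r d) {B : Type*} [Ring B] [Algebra F B] (q : Fin n → B) :
    FreeAlgebra.lift F q A.poly = ∑ w, A.wordCoeff w • (List.ofFn fun k => q (w k)).prod := by
  simp only [HomABP.poly, HomABP.wordCoeff, Matrix.list_prod_ofFn_apply, map_sum, map_list_prod,
    List.map_ofFn, Finset.sum_smul]
  rw [Finset.sum_comm]
  refine Finset.sum_congr rfl fun v _ => ?_
  have := List.prod_ofFn_sum_smul (F := F) q fun (k : Fin d) => A.coeff k (v k.castSucc) (v k.succ)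
  simp only [Matrix.of_apply, List.prod_ofFn (M := F)]
  rw [← this]
  congr 3
  funext k
  simp [HomABP.label]

/-- Evaluation at the generators of the free algebra is the identity, so a polynomial whose word
coefficients all vanish is zero. -/
theorem HomABP.wordCoeff_ne_zero (A : HomABP F n r d) (h : A.poly ≠ 0) : A.wordCoeff ≠ 0 := by
  intro h0
  apply h
  have := A.lift_poly (FreeAlgebra.ι F)
  rw [show FreeAlgebra.lift F (FreeAlgebra.ι F) = AlgHom.id F (FreeAlgebra F (Fin n)) from
    FreeAlgebra.lift_comp_ι (AlgHom.id F _)] at this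
  simpa [h0] using this

/-- Reduces arbitrary bounds to genuine, possibly empty, intervals of layers, at which a path can be
split into three pieces. -/
theorem posInterval_clip (d a b : ℕ) : ∃ a' b', a' ≤ b' ∧ b' ≤ d ∧
    posInterval d a b = posInterval d a' b' := by
  refine ⟨min a d, max (min a d) (min b d), le_max_left _ _, by omega, ?_⟩
  ext k
  have := k.2
  simp only [posInterval, Finset.mem_filter, Finset.mem_univ, true_and]
  omega

/-- The coefficient dimension of a branching program of width `r` is at most `r ^ 2`. -/
theorem HomABP.blockDependent_wordCoeff (A : HomABP F n r d) {E : Type*} [Field E] (φ : F →+* E)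
    (a b : ℕ) : BlockDependent (fun w => φ (A.wordCoeff w)) (posInterval d a b) (r ^ 2) := by
  intro g
  obtain ⟨a, b, hab, hbd, hI⟩ := posInterval_clip d a b
  rw [hI]
  let X : (Fin d → Fin n) → ℕ → Matrix (Fin r) (Fin r) E := fun w k =>
    if h : k < d then Matrix.of fun α β => φ (A.coeff ⟨k, h⟩ α β (w ⟨k, h⟩)) else 1
  let P : (Fin d → Fin n) → ℕ → ℕ → Matrix (Fin r) (Fin r) E := fun w s m =>
    ((List.range' s m).map (X w)).prod
  have hP : ∀ (w w' : Fin d → Fin n) (s m : ℕ),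
      (∀ k : Fin d, s ≤ k → (k : ℕ) < s + m → w k = w' k) → P w s m = P w' s m := by
    intro w w' s m h
    refine congrArg List.prod (List.map_congr_left fun k hk => ?_)
    rw [List.mem_range'_1] at hk
    by_cases hkd : k < d
    · simp only [X, dif_pos hkd, h ⟨k, hkd⟩ hk.1 hk.2]
    · simp only [X, dif_neg hkd]
  have hcoeff : ∀ w, φ (A.wordCoeff w) = P w 0 d A.source A.sink := by
    intro w
    have h1 : P w 0 d = φ.mapMatrix
        (List.ofFn fun k => Matrix.of fun α β => A.coeff k α β (w k)).prod := by
      rw [map_list_prod, List.map_ofFn]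
      refine congrArg List.prod (List.ext_getElem (by simp) fun k h1 h2 => ?_)
      have hk : k < d := by simpa using h1
      ext α β
      simp [X, hk]
    rw [h1]
    rfl
  have hsplit : ∀ w, P w 0 d = P w 0 a * (P w a (b - a) * P w b (d - b)) := by
    intro w
    simp only [P]
    rw [← List.prod_append, ← List.prod_append, ← List.map_append, ← List.map_append]
    congr 2
    have h1 : List.range' a (b - a) ++ List.range' b (d - b) = List.range' a (d - a) := by
      have := List.range'_append_1 (s := a) (m := b - a) (n := d - b)
      rw [show a + (b - a) = b by omega, show b - a + (d - b) = d - a by omega] at this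
      exact this
    have h2 := List.range'_append_1 (s := 0) (m := a) (n := d - a)
    rw [zero_add, show a + (d - a) = d by omega] at h2
    rw [h1, h2]
  -- The letters on the block enter only through the middle factor, on which the coefficient depends
  -- linearly, and matrices form a space of dimension `r ^ 2`.
  have hdep : ¬ LinearIndependent E fun i : Fin (r ^ 2 + 1) => P (g i) a (b - a) := by
    intro h
    have h1 := h.fintype_card_le_finrank
    rw [Module.finrank_matrix] at h1
    simp only [Fintype.card_fin, Module.finrank_self, mul_one, sq] at h1
    omega
  obtain ⟨c, hc, i, hi⟩ := Fintype.not_linearIndependent_iff.1 hdep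
  refine ⟨c, fun h => hi (congrFun h i), fun y => ?_⟩
  have hterm : ∀ i, c i * φ (A.wordCoeff ((posInterval d a b).piecewise (g i) y)) =
      (P y 0 a * (c i • P (g i) a (b - a)) * P y b (d - b)) A.source A.sink := by
    intro i
    rw [hcoeff, hsplit, hP _ y 0 a, hP _ (g i) a (b - a), hP _ y b (d - b), ← mul_assoc,
      Matrix.mul_smul, Matrix.smul_mul, Matrix.smul_apply, smul_eq_mul]
    all_goals
      intro k h1 h2
      have := k.2
      simp only [Finset.piecewise, posInterval, Finset.mem_filter, Finset.mem_univ, true_and]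
    · rw [if_neg (by omega)]
    · rw [if_pos (by omega)]
    · rw [if_neg (by omega)]
  rw [Finset.sum_congr rfl fun i _ => hterm i, ← Matrix.sum_apply, ← Finset.sum_mul,
    ← Finset.mul_sum, hc, mul_zero, zero_mul, Matrix.zero_apply]

/-- An entry of the value of a branching program at a point of the form `(b x)`. -/
theorem HomABP.lift_poly_cyclicAlgebra_apply (A : HomABP F n r d) {K : Type*} [Field K]
    [Algebra F K] (σ : K ≃ₐ[F] K) {ℓ : ℕ} (z : F) (q : Fin n → cyclicAlgebra σ ℓ z) (b : Fin n → K)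
    (hq : ∀ i, (q i).1 = cyclicDiag σ ℓ (b i) * cyclicShift ℓ (algebraMap F K z)) (hd : d < ℓ) :
    (FreeAlgebra.lift F q A.poly).1 ⟨0, by omega⟩ ⟨d, hd⟩ =
      ∑ w, algebraMap F K (A.wordCoeff w) * ∏ k : Fin d, (σ ^ (k : ℕ)) (b (w k)) := by
  have h1 : (FreeAlgebra.lift F q A.poly).1 = ∑ w, A.wordCoeff w • (List.ofFn fun k =>
      cyclicDiag σ ℓ (b (w k)) * cyclicShift ℓ (algebraMap F K z)).prod := by
    rw [A.lift_poly]
    change (cyclicAlgebra σ ℓ z).val _ = _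
    rw [map_sum]
    refine Finset.sum_congr rfl fun w _ => ?_
    rw [map_smul, map_list_prod, List.map_ofFn]
    congr 3
    funext k
    exact hq _
  rw [h1, Matrix.sum_apply]
  refine Finset.sum_congr rfl fun w _ => ?_
  rw [Matrix.smul_apply, prod_cyclicDiag_mul_cyclicShift_apply σ _ d _ _ _ (by simp),
    Algebra.smul_def]
  simp

end Words

/-! ## The table of points -/

section Table

/-- The value, for the seed `k`, of the variable `i` in the position `s` of a word. -/
def pointValue (n Q B lev T k i s : ℕ) : ℕ :=
  (k % T) ^ ∑ j ∈ Finset.range lev, B ^ j * ((i * n ^ s) % (1 + k / T / Q ^ j % Q))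

/-- The coefficient of `ζ ^ e` in the entry of the row `a` of a point. -/
def rowCoeff (p N g A d : ℕ) (Y : ℕ → ℕ) (a e : ℕ) : ℤ :=
  ∑ h ∈ Finset.range N, ∑ s ∈ Finset.range d,
    if (((h : ℤ) * g ^ a) ^ (p - 1) - ((g : ℤ) ^ s) ^ (p - 1)) % N = 0 then
      (Y s : ℤ) * (A : ℤ) ^ (-((h : ℤ) * e) % N).toNat else 0

/-- The values of the exponents `h` that are congruent to powers of `g` up to elements of order
dividing `p - 1`. -/
def residueValue (p N g d : ℕ) (Y : ℕ → ℕ) (h : ZMod N) : ℤ :=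
  ∑ s ∈ Finset.range d, if h ^ (p - 1) = ((g : ZMod N) ^ s) ^ (p - 1) then (Y s : ℤ) else 0

theorem ZMod.sum_eq_sum_range {N : ℕ} [NeZero N] {M : Type*} [AddCommMonoid M] (f : ZMod N → M) :
    ∑ x, f x = ∑ i ∈ Finset.range N, f i := by
  refine Finset.sum_bij' (fun x _ => x.val) (fun i _ => (i : ZMod N)) ?_ ?_ ?_ ?_ ?_
  · exact fun x _ => Finset.mem_range.2 x.val_lt
  · simp
  · simp
  · exact fun i hi => ZMod.val_cast_of_lt (Finset.mem_range.1 hi)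
  · simp

/-- Passes from residues to integer representatives, which gives the formula that the machine
evaluates. -/
theorem fourierElement_residueValue {E : Type*} [Field E] (ζ : E) (p N g A d : ℕ) [NeZero N]
    (Y : ℕ → ℕ) (a : ℕ) :
    fourierElement ζ N A (fun h => residueValue p N g d Y (h * (g : ZMod N) ^ a)) =
      ∑ e ∈ Finset.range N, (rowCoeff p N g A d Y a e : E) * ζ ^ e := by
  rw [fourierElement, ZMod.sum_eq_sum_range]
  refine Finset.sum_congr rfl fun e he => ?_
  rw [ZMod.val_cast_of_lt (Finset.mem_range.1 he), ZMod.sum_eq_sum_range]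
  congr 2
  refine Finset.sum_congr rfl fun h _ => ?_
  rw [residueValue, Finset.sum_mul]
  refine Finset.sum_congr rfl fun s _ => ?_
  have h1 : (-((h : ZMod N) * e)).val = (-((h : ℤ) * e) % N).toNat := by
    have := ZMod.val_intCast (n := N) (-((h : ℤ) * e))
    push_cast at this
    rw [← this, Int.toNat_natCast]
  have h2 : ((h : ZMod N) * g ^ a) ^ (p - 1) = ((g : ZMod N) ^ s) ^ (p - 1) ↔
      (((h : ℤ) * g ^ a) ^ (p - 1) - ((g : ℤ) ^ s) ^ (p - 1)) % N = 0 := by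
    rw [← Int.dvd_iff_emod_eq_zero, ← ZMod.intCast_zmod_eq_zero_iff_dvd, ← sub_eq_zero]
    push_cast
    rfl
  rw [h1, ite_mul, zero_mul]
  exact if_congr h2 rfl rfl

theorem residueValue_mul_of_pow_eq_one {p N g d : ℕ} (Y : ℕ → ℕ) (h u : ZMod N)
    (hu : u ^ (p - 1) = 1) : residueValue p N g d Y (h * u) = residueValue p N g d Y h := by
  simp only [residueValue, mul_pow, hu, mul_one]

/-- Since `p - 1` is coprime to `p`, the element `g ^ (p - 1)` has the same order as `g`, which is
at least `d`. Hence only one term of the sum is nonzero. -/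
theorem residueValue_pow {p N g d l : ℕ} (hp : p.Prime) (hg : orderOf (g : ZMod N) = p ^ (l + 1))
    (hd : d ≤ p ^ (l + 1)) (Y : ℕ → ℕ) {s : ℕ} (hs : s < d) :
    residueValue p N g d Y ((g : ZMod N) ^ s) = Y s := by
  rw [residueValue, Finset.sum_eq_single s, if_pos rfl]
  · intro j hj hjs
    rw [if_neg]
    intro h
    apply hjs
    have hord : orderOf ((g : ZMod N) ^ (p - 1)) = p ^ (l + 1) := by
      rw [Nat.Coprime.orderOf_pow, hg]
      rw [hg]
      exact coprime_pred_pow hp _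
    rw [← pow_mul, ← pow_mul, mul_comm, mul_comm j, pow_mul, pow_mul] at h
    have hj' := Finset.mem_range.1 hj
    exact (pow_injOn_Iio_orderOf (by rw [hord]; exact hs.trans_le hd)
      (by rw [hord]; exact hj'.trans_le hd) h).symm
  · intro h; exact absurd (Finset.mem_range.2 hs) h

/-- The coefficients of an entry of a point. -/
def pointEntry (p n N g A d ℓ Q B lev T k i a b j e : ℕ) : ℤ :=
  if b + ℓ * j = a + 1 then rowCoeff p N g A d (pointValue n Q B lev T k i) a e else 0

/-- The condition `b + ℓ * j = a + 1` describes both places where the shift is nonzero: `j = 0`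
above the diagonal and `j = 1` in the lower left corner, where `z` occurs. Therefore two powers of
`z` suffice. -/
theorem entryValue_pointEntry {p n N g A d ℓ Q B lev T k i : ℕ} [NeZero N] {K : Type*} [Field K]
    [Algebra K (RatFunc ℂ)] {F : Type*} [Field F] [Algebra F K] (σ : K ≃ₐ[F] K) (z x : K)
    (hz : algebraMap K (RatFunc ℂ) z = RatFunc.X)
    (hx : ∀ a, algebraMap K (RatFunc ℂ) ((σ ^ a) x) = fourierElement (rootOfUnity N) N A fun h =>
      residueValue p N g d (pointValue n Q B lev T k i) (h * (g : ZMod N) ^ a)) (a b : Fin ℓ) :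
    algebraMap K (RatFunc ℂ) ((cyclicDiag σ ℓ x * cyclicShift ℓ z) a b) =
      entryValue fun (j : Fin 2) (e : Fin N) =>
        (pointEntry p n N g A d ℓ Q B lev T k i a b j e, 1) := by
  have ha := a.2
  have hb := b.2
  have hsum : ∀ y : RatFunc ℂ, (∑ e : Fin N, RatFunc.C
      (((rowCoeff p N g A d (pointValue n Q B lev T k i) a e : ℤ) : ℂ) / ((1 : ℤ) : ℂ)) *
        rootOfUnity N ^ (e : ℕ) * y) = algebraMap K (RatFunc ℂ) ((σ ^ (a : ℕ)) x) * y := by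
    intro y
    rw [hx, fourierElement_residueValue, Finset.sum_range, Finset.sum_mul]
    simp
  rw [cyclicDiag, Matrix.diagonal_mul, map_mul, entryValue, Fin.sum_univ_two]
  simp only [pointEntry, Fin.val_zero, Fin.val_one, mul_zero, mul_one, add_zero, cyclicShift,
    Matrix.of_apply]
  by_cases h1 : (b : ℕ) = a + 1
  · have h2 : ¬ (b : ℕ) + ℓ = a + 1 := by omega
    simp only [if_pos h1, if_neg h2, hsum]
    simp
  · by_cases h2 : (b : ℕ) + ℓ = a + 1
    · have h3 : (a : ℕ) + 1 = ℓ ∧ (b : ℕ) = 0 := by omega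
      simp only [if_neg h1, if_pos h2, if_pos h3, hsum, hz]
      simp
    · have h3 : ¬ ((a : ℕ) + 1 = ℓ ∧ (b : ℕ) = 0) := by omega
      simp only [if_neg h1, if_neg h2, if_neg h3]
      simp

/-- The points of the table form a hitting set in a cyclic division algebra. -/
theorem exists_isHittingSet {p L τ n r d : ℕ} (hp : p.Prime) (hτ : 2 ≤ τ) (hL : 0 < L) (hn : 0 < n)
    (hr : 0 < r) (hd : 0 < d) (hdl : d < p ^ L) {N : ℕ} (hN : N = 2 ^ τ * p ^ (oddExp p + L))
    {Q B lev T H A : ℕ} (hQ : 2 * (n * d * ((d + 1) ^ 2 * (n * (r ^ 2) ^ 2)) ^ 2 + 3) ≤ Q)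
    (hB : B = d * Q) (hlev : d ≤ 2 ^ lev) (hT : T = B ^ (lev + 1)) (hH : H = Q ^ (lev + 1) * T)
    (hA : 1 < A) (hNA : N ∣ A) (hTA : ∀ c, 0 < c → c < T → c ∣ A) :
    ∃ (K : IntermediateField (baseField τ) (RatFunc ℂ)) (σ : K ≃ₐ[baseField τ] K),
      K ≤ IntermediateField.adjoin (baseField τ) {rootOfUnity N} ∧
      IsCyclicDivisionAlgebra σ (p ^ L) (baseZ τ) ∧
      ∃ q : Fin H → Fin n → cyclicAlgebra σ (p ^ L) (baseZ τ),
        (∀ k i a b, (((q k i).1 a b : K) : RatFunc ℂ) =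
          entryValue fun (j : Fin 2) (e : Fin N) => (pointEntry p n N (1 + baseModulus p τ) A d
            (p ^ L) Q B (lev + 1) T k i a b j e, 1)) ∧
        IsHittingSet (homABPClass (baseField τ) n r d) (Set.range q) := by
  obtain ⟨l, rfl⟩ : ∃ l, L = l + 1 := ⟨L - 1, by omega⟩
  have hN0 : N ≠ 0 := by rw [hN]; have := hp.pos; positivity
  have : NeZero N := ⟨hN0⟩
  obtain ⟨K, σ, hK, hD, hmem⟩ := exists_cyclicDivisionAlgebra hp hτ N hN
  have hg := orderOf_one_add_baseModulus hp hτ l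
  have hN' : baseModulus p τ * p ^ (l + 1) = N := by rw [hN, baseModulus, pow_add]; ring
  rw [hN'] at hg
  have hζ := isPrimitiveRoot_rootOfUnity hN0
  choose x hx using fun (k i : ℕ) => hmem A
    (residueValue p N (1 + baseModulus p τ) d (pointValue n Q B (lev + 1) T k i))
    fun h u hu => residueValue_mul_of_pow_eq_one _ h u hu
  have hcast : ((1 + baseModulus p τ : ℕ) : ZMod N) = 1 + baseModulus p τ := by push_cast; rfl
  rw [← hcast] at hg
  have hmemD : ∀ y : K, cyclicDiag σ (p ^ (l + 1)) y *
      cyclicShift (p ^ (l + 1)) (algebraMap _ K (baseZ τ)) ∈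
        cyclicAlgebra σ (p ^ (l + 1)) (baseZ τ) := fun y =>
    mul_mem (Algebra.subset_adjoin (Or.inl ⟨y, rfl⟩)) (Algebra.subset_adjoin (Or.inr rfl))
  let q : Fin H → Fin n → cyclicAlgebra σ (p ^ (l + 1)) (baseZ τ) := fun k i =>
    ⟨_, hmemD (x k i)⟩
  refine ⟨K, σ, hK, hD, q, fun k i a b => ?_, fun f hf => ⟨fun hne => ?_, ?_⟩⟩
  · exact entryValue_pointEntry σ _ (x k i) rfl
      (fun a => (hx k i a).trans (by rw [hcast])) a b
  · obtain ⟨P, rfl⟩ := hf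
    obtain ⟨O, hO⟩ := exists_valuationSubring_of_isPrimitiveRoot hζ
      (N := N) (by
        rw [hN]
        have h1 : 2 ^ 1 ≤ 2 ^ τ := Nat.pow_le_pow_right (by omega) (by omega)
        have h2 : 1 ≤ p ^ (oddExp p + (l + 1)) := Nat.one_le_pow _ _ hp.pos
        nlinarith) hA
    have hdvd := fun c hc => valuation_natCast_eq_one_of_dvd O (c := c) hN0 hζ.pow_eq_one hO hc
    have hTpos : 0 < T := by
      rw [hT, hB]
      have : 0 < Q := by omega
      positivity
    obtain ⟨u, hu, t, ht, hut⟩ := exists_eval_ne_zero_of_valuationSubring O (N := N)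
      (f := fun w => algebraMap (baseField τ) (RatFunc ℂ) (P.wordCoeff w))
      (fun h => P.wordCoeff_ne_zero hne
        (funext fun w => (map_eq_zero (algebraMap (baseField τ) (RatFunc ℂ))).1 (congrFun h w)))
      hd hn (pow_pos hr 2) (P.blockDependent_wordCoeff _) hQ hlev
      (fun c h1 h2 => hdvd c (hTA c h1 (by rw [hT, hB]; exact h2))) (hdvd N hNA)
      (fun u t s j => fourierElement (rootOfUnity N) N A fun h =>
        residueValue p N (1 + baseModulus p τ) d (fun s => t ^ ∑ i ∈ Finset.range (lev + 1),
          B ^ i * ((j * n ^ s) % (1 + u / Q ^ i % Q)))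
          (h * ((1 + baseModulus p τ : ℕ) : ZMod N) ^ (s : ℕ)))
      -- The conjugate with index `s` translates the function by `g ^ s`, so its residue is `N`
      -- times the value at `g ^ s`, which is the prescribed power of `t`.
      (fun u t s j => by
        have := valuation_fourierElement_sub_lt O hζ hO fun h =>
          residueValue p N (1 + baseModulus p τ) d (fun s => t ^ ∑ i ∈ Finset.range (lev + 1),
            B ^ i * ((j * n ^ s) % (1 + u / Q ^ i % Q)))
            (h * ((1 + baseModulus p τ : ℕ) : ZMod N) ^ (s : ℕ))
        rw [one_mul, residueValue_pow hp hg hdl.le _ s.2, hB] at this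
        rw [hB]
        push_cast at this ⊢
        exact this)
    have hkH : u * T + t < H := by
      rw [hH]
      calc u * T + t < u * T + T := by rw [hT, hB]; exact Nat.add_lt_add_left ht _
        _ = (u + 1) * T := by ring
        _ ≤ _ := Nat.mul_le_mul_right _ hu
    -- The number of a point encodes `u` and `t` as quotient and remainder on division by `T`.
    refine ⟨q ⟨u * T + t, hkH⟩, ⟨_, rfl⟩, fun h0 => hut ?_⟩
    have h1 := P.lift_poly_cyclicAlgebra_apply σ (baseZ τ) (q ⟨u * T + t, hkH⟩)
      (fun i => x (u * T + t) i) (fun i => rfl) hdl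
    rw [h0] at h1
    have h2 := congrArg (algebraMap K (RatFunc ℂ)) h1
    rw [map_sum] at h2
    rw [show (0 : cyclicAlgebra σ (p ^ (l + 1)) (baseZ τ)).1 = 0 from rfl, Matrix.zero_apply,
      map_zero] at h2
    rw [h2]
    refine Finset.sum_congr rfl fun w _ => ?_
    rw [map_mul, ← IsScalarTower.algebraMap_apply, map_prod]
    congr 1
    refine Finset.prod_congr rfl fun s _ => ?_
    refine Eq.trans ?_ (hx (u * T + t) (w s) s).symm
    rw [← hcast]
    have h3 : (u * T + t) / T = u := by
      rw [mul_comm, Nat.mul_add_div hTpos, Nat.div_eq_of_lt (by rw [hT, hB]; exact ht), add_zero]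
    have h4 : (u * T + t) % T = t := by
      rw [mul_comm, Nat.mul_add_mod, Nat.mod_eq_of_lt (by rw [hT, hB]; exact ht)]
    have h5 : pointValue n Q B (lev + 1) T (u * T + t) (w s) = fun m : ℕ => t ^ ∑ i ∈
        Finset.range (lev + 1), B ^ i * ((w s * n ^ m) % (1 + u / Q ^ i % Q)) := by
      funext m
      rw [pointValue, h3, h4]
    rw [h5]
  · rintro ⟨_, -, hq⟩ rfl
    exact hq (map_zero _)

end Table

/-! ## The program that prints the table -/

/- The variables of the program: `0`-`3` hold the input `p`, `n`, `r`, `d`; `4`-`17` hold the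
remaining members of `parameterList`; `18`-`23` are the indices `k`, `i`, `a`, `b`, `j`, `e` of the
numbers in the table; the variables from `24` on are bound in sums and products. -/

section Program

/-- A sum of values of an expression. -/
def FoldExpr.sum (x b : ℕ) (e : FoldExpr) : FoldExpr := .fold .add 0 x b e

/-- A product of values of an expression. -/
def FoldExpr.prod (x b : ℕ) (e : FoldExpr) : FoldExpr := .fold .mul 1 x b e

theorem FoldExpr.eval_sum (v : ℕ → ℤ) (x b : ℕ) (e : FoldExpr) : (FoldExpr.sum x b e).eval v =
    ∑ i ∈ Finset.range (v b).toNat, e.eval (Function.update v x (i : ℤ)) := by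
  rw [FoldExpr.sum, FoldExpr.eval]
  induction (v b).toNat with
  | zero => rfl
  | succ k ih => rw [foldl_range_succ, ih, Finset.sum_range_succ]; rfl

theorem FoldExpr.eval_prod (v : ℕ → ℤ) (x b : ℕ) (e : FoldExpr) : (FoldExpr.prod x b e).eval v =
    ∏ i ∈ Finset.range (v b).toNat, e.eval (Function.update v x (i : ℤ)) := by
  rw [FoldExpr.prod, FoldExpr.eval]
  induction (v b).toNat with
  | zero => rfl
  | succ k ih => rw [foldl_range_succ, ih, Finset.prod_range_succ]; rfl

instance : Add FoldExpr := ⟨.op .add⟩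
instance : Sub FoldExpr := ⟨.op .sub⟩
instance : Mul FoldExpr := ⟨.op .mul⟩
instance : Div FoldExpr := ⟨.op .div⟩
instance : Mod FoldExpr := ⟨.op .mod⟩

theorem FoldExpr.eval_add (v : ℕ → ℤ) (e f : FoldExpr) : (e + f).eval v = e.eval v + f.eval v := rfl
theorem FoldExpr.eval_sub (v : ℕ → ℤ) (e f : FoldExpr) : (e - f).eval v = e.eval v - f.eval v := rfl
theorem FoldExpr.eval_mul (v : ℕ → ℤ) (e f : FoldExpr) : (e * f).eval v = e.eval v * f.eval v := rfl
theorem FoldExpr.eval_div (v : ℕ → ℤ) (e f : FoldExpr) : (e / f).eval v = e.eval v / f.eval v := rfl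
theorem FoldExpr.eval_mod (v : ℕ → ℤ) (e f : FoldExpr) : (e % f).eval v = e.eval v % f.eval v := rfl
theorem FoldExpr.eval_const (v : ℕ → ℤ) (c : ℤ) : (FoldExpr.const c).eval v = c := rfl
theorem FoldExpr.eval_var (v : ℕ → ℤ) (x : ℕ) : (FoldExpr.var x).eval v = v x := rfl
theorem FoldExpr.eval_ite (v : ℕ → ℤ) (e f g : FoldExpr) :
    (FoldExpr.ite e f g).eval v = if 0 < e.eval v then f.eval v else g.eval v := rfl

/-- An expression that is positive when the value is zero. -/
def FoldExpr.isZero (e : FoldExpr) : FoldExpr := .const 1 - e * e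

theorem FoldExpr.eval_isZero_pos (v : ℕ → ℤ) (e : FoldExpr) :
    0 < e.isZero.eval v ↔ e.eval v = 0 := by
  rw [isZero, eval_sub, eval_mul, eval_const]
  constructor
  · intro h
    by_contra h0
    have : 0 < e.eval v * e.eval v := mul_self_pos.2 h0
    omega
  · intro h
    rw [h]
    norm_num

/-- A power with an exponent that is less than the value of the variable `b`. -/
def FoldExpr.boundedPow (x b : ℕ) (e f : FoldExpr) : FoldExpr :=
  .prod x b (.ite (f - .var x) e (.const 1))

theorem prod_range_ite_lt {M : Type*} [CommMonoid M] {m b : ℕ} (h : m ≤ b) (a : M) :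
    ∏ i ∈ Finset.range b, (if i < m then a else 1) = a ^ m := by
  rw [← Finset.prod_filter, Finset.prod_const]
  congr 1
  rw [show (Finset.range b).filter (· < m) = Finset.range m by ext i; simp; omega,
    Finset.card_range]

/-- Iterations run up to the value of a variable only. A power with a computed exponent is therefore
a longer product whose factors from `m` on are `1`. -/
theorem FoldExpr.eval_boundedPow {v : ℕ → ℤ} {x b m B : ℕ} {e f : FoldExpr} {a : ℤ}
    (he : ∀ i : ℕ, e.eval (Function.update v x (i : ℤ)) = a)
    (hf : ∀ i : ℕ, f.eval (Function.update v x (i : ℤ)) = m) (hb : v b = B) (hm : m ≤ B) :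
    (FoldExpr.boundedPow x b e f).eval v = a ^ m := by
  rw [boundedPow, eval_prod, hb, Int.toNat_natCast, ← prod_range_ite_lt hm a]
  refine Finset.prod_congr rfl fun i _ => ?_
  rw [eval_ite, eval_sub, eval_var, eval_const, he, hf, Function.update_self]
  exact if_congr (by omega) rfl rfl

theorem FoldExpr.eval_prod_const {v : ℕ → ℤ} {x b m : ℕ} {e : FoldExpr} {a : ℤ}
    (he : ∀ i : ℕ, e.eval (Function.update v x (i : ℤ)) = a) (hb : v b = m) :
    (FoldExpr.prod x b e).eval v = a ^ m := by
  rw [eval_prod, hb, Int.toNat_natCast, Finset.prod_congr rfl fun i _ => he i, Finset.prod_const,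
    Finset.card_range]

/-- The exponent in `pointValue`. -/
def weightExpr : FoldExpr :=
  .sum 27 6 (.prod 28 27 (.var 14) *
    ((.var 19 * .prod 28 25 (.var 1)) %
      (.const 1 + .var 18 / .var 15 / .prod 28 27 (.var 13) % .var 13)))

/-- The integer `N * T!` to which the root of unity is congruent. -/
def modulusExpr : FoldExpr := .var 12 * .prod 29 15 (.var 29 + .const 1)

/-- The expression that vanishes for the pairs `h`, `s` that count in `rowCoeff`. -/
def congruenceExpr : FoldExpr :=
  (.prod 27 4 (.var 24 * .prod 26 20 (.var 10)) - .prod 27 4 (.prod 26 25 (.var 10))) % .var 12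

/-- The expression for `rowCoeff`. -/
def rowExpr : FoldExpr :=
  .sum 24 12 (.sum 25 3 (.ite congruenceExpr.isZero
    (.boundedPow 26 15 (.var 18 % .var 15) weightExpr *
      .boundedPow 26 12 modulusExpr ((.const 0 - .var 24 * .var 23) % .var 12)) (.const 0)))

/-- The expression for `pointEntry`. -/
def entryExpr : FoldExpr :=
  .ite (.isZero (.var 21 + .var 11 * .var 22 - (.var 20 + .const 1))) rowExpr (.const 0)

theorem eval_modulusExpr {v : ℕ → ℤ} {N T : ℕ} (hN : v 12 = N) (hT : v 15 = T) :
    modulusExpr.eval v = (N * T.factorial : ℕ) := by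
  rw [modulusExpr, FoldExpr.eval_mul, FoldExpr.eval_var, FoldExpr.eval_prod, hN, hT,
    Int.toNat_natCast, ← Finset.prod_range_add_one_eq_factorial]
  push_cast
  simp [FoldExpr.eval_add, FoldExpr.eval_var, FoldExpr.eval_const]

theorem eval_weightExpr {v : ℕ → ℤ} {n lev Q B T k i s : ℕ} (h1 : v 1 = n) (h6 : v 6 = lev)
    (h13 : v 13 = Q) (h14 : v 14 = B) (h15 : v 15 = T) (h18 : v 18 = k) (h19 : v 19 = i)
    (h25 : v 25 = s) : weightExpr.eval v =
      (∑ j ∈ Finset.range lev, B ^ j * ((i * n ^ s) % (1 + k / T / Q ^ j % Q)) : ℕ) := by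
  rw [weightExpr, FoldExpr.eval_sum, h6, Int.toNat_natCast]
  push_cast
  refine Finset.sum_congr rfl fun j _ => ?_
  simp only [FoldExpr.eval_add, FoldExpr.eval_mul, FoldExpr.eval_div, FoldExpr.eval_mod,
    FoldExpr.eval_var, FoldExpr.eval_const]
  rw [FoldExpr.eval_prod_const (a := B) (m := j) (fun _ => by simp [FoldExpr.eval_var, h14])
      (by simp),
    FoldExpr.eval_prod_const (a := n) (m := s) (fun _ => by simp [FoldExpr.eval_var, h1])
      (by simp [h25]),
    FoldExpr.eval_prod_const (a := Q) (m := j) (fun _ => by simp [FoldExpr.eval_var, h13])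
      (by simp)]
  simp [h13, h15, h18, h19]

theorem eval_congruenceExpr {v : ℕ → ℤ} {p g N a h s : ℕ} (h4 : v 4 = (p - 1 : ℕ))
    (h10 : v 10 = g) (h12 : v 12 = N) (h20 : v 20 = a) (h24 : v 24 = h) (h25 : v 25 = s) :
    congruenceExpr.eval v =
      (((h : ℤ) * g ^ a) ^ (p - 1) - ((g : ℤ) ^ s) ^ (p - 1)) % N := by
  rw [congruenceExpr, FoldExpr.eval_mod, FoldExpr.eval_sub, FoldExpr.eval_var, h12,
    FoldExpr.eval_prod_const (a := (h : ℤ) * g ^ a) (m := p - 1) (fun _ => ?_) h4,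
    FoldExpr.eval_prod_const (a := (g : ℤ) ^ s) (m := p - 1) (fun _ => ?_) h4]
  · rw [FoldExpr.eval_prod_const (a := g) (m := s) (fun _ => by simp [FoldExpr.eval_var, h10])
      (by simp [h25])]
  · rw [FoldExpr.eval_mul, FoldExpr.eval_var, FoldExpr.eval_prod_const (a := g) (m := a)
      (fun _ => by simp [FoldExpr.eval_var, h10]) (by simp [h20])]
    simp [h24]

/-- Keeps the exponents of `t` within the range of the variable that holds `T = B ^ lev`. -/
theorem sum_weight_lt {B Q : ℕ} (hQB : Q ≤ B) (hQ : 0 < Q) (x y : ℕ → ℕ) (lev : ℕ) :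
    ∑ j ∈ Finset.range lev, B ^ j * (x j % (1 + y j % Q)) < B ^ lev := by
  induction lev with
  | zero => simp
  | succ l ih =>
    rw [Finset.sum_range_succ, pow_succ]
    have h1 : x l % (1 + y l % Q) + 1 ≤ B := by
      have h2 := Nat.mod_lt (x l) (show 0 < 1 + y l % Q by omega)
      have h3 := Nat.mod_lt (y l) hQ
      omega
    nlinarith [Nat.mul_le_mul_left (B ^ l) h1]

theorem eval_rowExpr {v : ℕ → ℤ} {p n d lev g N Q B T k i a e : ℕ} (h1 : v 1 = n) (h3 : v 3 = d)
    (h4 : v 4 = (p - 1 : ℕ)) (h6 : v 6 = lev) (h10 : v 10 = g) (h12 : v 12 = N) (h13 : v 13 = Q)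
    (h14 : v 14 = B) (h15 : v 15 = T) (h18 : v 18 = k) (h19 : v 19 = i) (h20 : v 20 = a)
    (h23 : v 23 = e) (hN : 0 < N) (hQ : 0 < Q) (hQB : Q ≤ B) (hT : T = B ^ lev) :
    rowExpr.eval v =
      rowCoeff p N g (N * T.factorial) d (pointValue n Q B lev T k i) a e := by
  rw [rowExpr, FoldExpr.eval_sum, h12, Int.toNat_natCast, rowCoeff]
  refine Finset.sum_congr rfl fun h _ => ?_
  rw [FoldExpr.eval_sum, Function.update_of_ne (by decide), h3, Int.toNat_natCast]
  refine Finset.sum_congr rfl fun s _ => ?_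
  rw [FoldExpr.eval_ite]
  refine if_congr ?_ ?_ rfl
  · rw [FoldExpr.eval_isZero_pos, eval_congruenceExpr (p := p) (g := g) (N := N) (a := a) (h := h)
      (s := s)] <;> simp [h4, h10, h12, h20]
  -- The remainder lies between `0` and `N`, so `toNat` loses nothing and the variable holding `N`
  -- bounds the exponent.
  · have hmod := Int.emod_lt_of_pos (-((h : ℤ) * e)) (show (0 : ℤ) < N by omega)
    have hmod' := Int.emod_nonneg (-((h : ℤ) * e)) (show (N : ℤ) ≠ 0 by omega)
    rw [FoldExpr.eval_mul, FoldExpr.eval_boundedPow (a := (k : ℤ) % T) (B := T)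
        (m := ∑ j ∈ Finset.range lev, B ^ j * ((i * n ^ s) % (1 + k / T / Q ^ j % Q))),
      FoldExpr.eval_boundedPow (a := (N * T.factorial : ℕ)) (B := N)
        (m := (-((h : ℤ) * e) % N).toNat), pointValue]
    · push_cast
      rfl
    · intro _
      exact eval_modulusExpr (by simp [h12]) (by simp [h15])
    · intro _
      simp [FoldExpr.eval_mod, FoldExpr.eval_sub, FoldExpr.eval_mul, FoldExpr.eval_var,
        FoldExpr.eval_const, h12, h23, hmod']
    · simp [h12]
    · omega
    · intro _
      simp [FoldExpr.eval_mod, FoldExpr.eval_var, h15, h18]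
    · intro _
      exact eval_weightExpr (by simp [h1]) (by simp [h6]) (by simp [h13]) (by simp [h14])
        (by simp [h15]) (by simp [h18]) (by simp [h19]) (by simp)
    · simp [h15]
    · rw [hT]
      exact (sum_weight_lt hQB hQ _ _ _).le

theorem eval_entryExpr {v : ℕ → ℤ} {p n d lev g ℓ N Q B T k i a b j e : ℕ} (h1 : v 1 = n)
    (h3 : v 3 = d) (h4 : v 4 = (p - 1 : ℕ)) (h6 : v 6 = lev) (h10 : v 10 = g) (h11 : v 11 = ℓ)
    (h12 : v 12 = N) (h13 : v 13 = Q) (h14 : v 14 = B) (h15 : v 15 = T) (h18 : v 18 = k)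
    (h19 : v 19 = i) (h20 : v 20 = a) (h21 : v 21 = b) (h22 : v 22 = j) (h23 : v 23 = e)
    (hN : 0 < N) (hQ : 0 < Q) (hQB : Q ≤ B) (hT : T = B ^ lev) :
    entryExpr.eval v = pointEntry p n N g (N * T.factorial) d ℓ Q B lev T k i a b j e := by
  rw [entryExpr, FoldExpr.eval_ite, pointEntry]
  refine if_congr ?_ (eval_rowExpr h1 h3 h4 h6 h10 h12 h13 h14 h15 h18 h19 h20 h23 hN hQ hQB hT) rfl
  rw [FoldExpr.eval_isZero_pos]
  simp only [FoldExpr.eval_add, FoldExpr.eval_sub, FoldExpr.eval_mul, FoldExpr.eval_var,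
    FoldExpr.eval_const, h11, h20, h21, h22]
  rw [sub_eq_zero]
  norm_cast

end Program

/-! ## The parameters and the output of the program -/

section Parameters

/-- The number of exponents `i < x` with `b ^ i ≤ x`, which is `⌊log_b x⌋ + 1`. -/
def logCount (b x : ℕ) : ℕ := ∑ i ∈ Finset.range x, if b ^ i ≤ x then 1 else 0

/-- The restriction to `i < x` is harmless, as `i < b ^ i ≤ x`; it makes the logarithm a sum with a
range known in advance. -/
theorem logCount_eq {b x : ℕ} (hb : 2 ≤ b) (hx : 1 ≤ x) : logCount b x = Nat.log b x + 1 := by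
  rw [logCount, ← Finset.sum_filter, Finset.sum_const, smul_eq_mul, mul_one]
  rw [show (Finset.range x).filter (fun i => b ^ i ≤ x) = Finset.range (Nat.log b x + 1) by
    ext i
    simp only [Finset.mem_filter, Finset.mem_range]
    rw [Nat.lt_succ_iff, Nat.le_log_iff_pow_le (by omega) (by omega)]
    refine ⟨fun h => h.2, fun h => ⟨?_, h⟩⟩
    exact (Nat.lt_pow_self (by omega)).trans_le h, Finset.card_range]

theorem lt_pow_logCount {b x : ℕ} (hb : 2 ≤ b) (hx : 1 ≤ x) : x < b ^ logCount b x := by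
  rw [logCount_eq hb hx]
  exact Nat.lt_pow_succ_log_self (by omega) x

theorem pow_logCount_le {b x : ℕ} (hb : 2 ≤ b) (hx : 1 ≤ x) : b ^ logCount b x ≤ b * x := by
  rw [logCount_eq hb hx, pow_succ']
  exact Nat.mul_le_mul_left _ (Nat.pow_log_le_self b (by omega))

/-- The bound for the moduli of the weights. -/
def weightBound (n r d : ℕ) : ℕ := 2 * (n * d * ((d + 1) ^ 2 * (n * (r ^ 2) ^ 2)) ^ 2 + 3)

/-- The number of the values of the parameter `t` of the points. -/
def parameterCount (n r d : ℕ) : ℕ := (d * weightBound n r d) ^ (logCount 2 d + 1)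

/-- The number of points. -/
def pointCount (n r d : ℕ) : ℕ :=
  weightBound n r d ^ (logCount 2 d + 1) * parameterCount n r d

/-- The exponent of the order `2 ^ τ` of the root of unity in the base field. -/
def twoExponent (p r : ℕ) : ℕ := 3 * p * logCount 2 r

/-- The exponent of `p` in the order of the root of unity `ζ`. -/
def rootExponent (p d : ℕ) : ℕ := oddExp p + logCount p d

/-- The values of the variables of the program. -/
def parameterList (p n r d : ℕ) : List ℕ :=
  [p, n, r, d, p - 1, logCount p d, logCount 2 d + 1, twoExponent p r, rootExponent p d,
    baseModulus p (twoExponent p r), 1 + baseModulus p (twoExponent p r), p ^ logCount p d,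
    2 ^ twoExponent p r * p ^ rootExponent p d, weightBound n r d,
    d * weightBound n r d, parameterCount n r d, pointCount n r d, 2]

/-! ### Binding the parameters to consecutive variables -/

/-- The environment in which the first variables have the given values. -/
def listEnv (l : List ℤ) : ℕ → ℤ := fun x => l.getD x 0

theorem update_listEnv (l : List ℤ) (a : ℤ) :
    Function.update (listEnv l) l.length a = listEnv (l ++ [a]) := by
  funext x
  rcases lt_trichotomy x l.length with h | rfl | h
  · rw [Function.update_of_ne h.ne, listEnv, listEnv, List.getD_append _ _ _ _ h]
  · simp [listEnv]
  · rw [Function.update_of_ne h.ne', listEnv, listEnv, List.getD_eq_default _ _ h.le,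
      List.getD_eq_default _ _ (by simpa using h)]

/-- Binding the values of a list of expressions to consecutive variables. -/
def Printer.bindList : List FoldExpr → ℕ → Printer → Printer
  | [], _, o => o
  | e :: es, x, o => .bind x e (bindList es (x + 1) o)

/-- The values are those of the expressions. -/
def EvalList : List FoldExpr → List ℤ → List ℤ → Prop
  | [], _, [] => True
  | e :: es, l, a :: as => e.eval (listEnv l) = a ∧ EvalList es (l ++ [a]) as
  | _, _, _ => False

theorem Printer.out_bindList (o : Printer) : ∀ (es : List FoldExpr) (l as : List ℤ),
    EvalList es l as → (bindList es l.length o).out (listEnv l) = o.out (listEnv (l ++ as))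
  | [], l, [], _ => by simp [bindList]
  | e :: es, l, a :: as, h => by
    rw [bindList, out, h.1, update_listEnv]
    have := out_bindList o es (l ++ [a]) as h.2
    simpa using this

theorem Printer.boundedBy_bindList (V : ℕ) (o : Printer) :
    ∀ (es : List FoldExpr) (l as : List ℤ), EvalList es l as → (∀ a ∈ as, a.natAbs ≤ V) →
      o.BoundedBy V (listEnv (l ++ as)) → (bindList es l.length o).BoundedBy V (listEnv l)
  | [], l, [], _, _, ho => by simpa [bindList] using ho
  | e :: es, l, a :: as, h, hV, ho => by
    rw [bindList, BoundedBy, h.1, update_listEnv]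
    refine ⟨hV a (by simp), ?_⟩
    have := boundedBy_bindList V o es (l ++ [a]) as h.2 (fun a ha => hV a (by simp [ha]))
      (by simpa using ho)
    simpa using this

/-- The logarithm to the base `c`, for a variable `x`. -/
def logCountExpr (c : FoldExpr) (x : ℕ) : FoldExpr :=
  .sum 24 x (.ite (.var x + .const 1 - .prod 25 24 c) (.const 1) (.const 0))

theorem eval_logCountExpr {v : ℕ → ℤ} {c : FoldExpr} {x b m : ℕ} (hx : v x = m) (hx24 : x ≠ 24)
    (hc : ∀ i j : ℤ, c.eval (Function.update (Function.update v 24 i) 25 j) = b) :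
    (logCountExpr c x).eval v = logCount b m := by
  rw [logCountExpr, FoldExpr.eval_sum, hx, Int.toNat_natCast, logCount]
  push_cast
  refine Finset.sum_congr rfl fun i _ => ?_
  rw [FoldExpr.eval_ite]
  refine if_congr ?_ rfl rfl
  rw [FoldExpr.eval_sub, FoldExpr.eval_add, FoldExpr.eval_var, Function.update_of_ne hx24, hx,
    FoldExpr.eval_const, FoldExpr.eval_prod_const (a := b) (m := i) (fun _ => hc _ _) (by simp)]
  rw [sub_pos, Int.lt_add_one_iff]
  norm_cast

/-- The expressions for the parameters. -/
def parameterExprs : List FoldExpr :=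
  [.var 0 - .const 1,
    logCountExpr (.var 0) 3,
    logCountExpr (.const 2) 3 + .const 1,
    .const 3 * .var 0 * logCountExpr (.const 2) 2,
    .ite (.var 0 - .const 2) (.const 1) (.const 0) + .var 5,
    .prod 24 7 (.const 2) * .ite (.var 0 - .const 2) (.var 0) (.const 1),
    .const 1 + .var 9,
    .prod 24 5 (.var 0),
    .var 9 * .var 11,
    .const 2 * (.var 1 * .var 3 *
      ((.var 3 + .const 1) * (.var 3 + .const 1) * (.var 1 * (.var 2 * .var 2 * (.var 2 * .var 2)))
        * ((.var 3 + .const 1) * (.var 3 + .const 1) *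
          (.var 1 * (.var 2 * .var 2 * (.var 2 * .var 2))))) + .const 3),
    .var 3 * .var 13,
    .prod 24 6 (.var 14),
    .prod 24 6 (.var 13) * .var 15,
    -- The number of powers of `z`, stored because the bound of a loop has to be a variable.
    .const 2]

theorem evalList_parameterExprs {p n r d : ℕ} (hp : 1 ≤ p) :
    EvalList parameterExprs [(p : ℤ), n, r, d]
      (((parameterList p n r d).drop 4).map Nat.cast) := by
  have hodd : (if 2 < p then (1 : ℤ) else 0) = oddExp p := by
    rw [oddExp]; push_cast; rfl
  have hodd' : (if 2 < p then (p : ℤ) else 1) = p ^ oddExp p := by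
    rw [oddExp]
    by_cases h : 2 < p
    · rw [if_pos h, if_pos h, pow_one]
    · rw [if_neg h, if_neg h, pow_zero]
  simp only [parameterExprs, parameterList, List.drop_succ_cons, List.drop_zero, List.map_cons,
    List.map_nil, EvalList, List.cons_append, List.nil_append, and_true]
  refine ⟨?_, ?_, ?_, ?_, ?_, ?_, ?_, ?_, ?_, ?_, ?_, ?_, ?_, ?_⟩
  · simp [FoldExpr.eval_sub, FoldExpr.eval_var, FoldExpr.eval_const, listEnv, Nat.cast_sub hp]
  · exact eval_logCountExpr rfl (by decide) fun _ _ => by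
      simp [FoldExpr.eval_var, listEnv]
  · rw [FoldExpr.eval_add, eval_logCountExpr (b := 2) (m := d) (by rfl) (by decide) fun _ _ => by rfl]
    simp [FoldExpr.eval_const]
  · rw [FoldExpr.eval_mul, eval_logCountExpr (b := 2) (m := r) (by rfl) (by decide) fun _ _ => by rfl]
    simp [FoldExpr.eval_const, FoldExpr.eval_mul, FoldExpr.eval_var, listEnv, twoExponent]
  · simp [FoldExpr.eval_add, FoldExpr.eval_ite, FoldExpr.eval_sub, FoldExpr.eval_const,
      FoldExpr.eval_var, listEnv, rootExponent, hodd]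
  · rw [FoldExpr.eval_mul, FoldExpr.eval_prod_const (a := 2) (m := twoExponent p r)
      (fun _ => by rfl) (by rfl)]
    simp [FoldExpr.eval_ite, FoldExpr.eval_sub, FoldExpr.eval_const,
      FoldExpr.eval_var, listEnv, baseModulus, hodd']
  · simp [FoldExpr.eval_add, FoldExpr.eval_const, FoldExpr.eval_var, listEnv]
  · rw [FoldExpr.eval_prod_const (a := p) (m := logCount p d)
      (fun _ => by simp [FoldExpr.eval_var, listEnv]) (by rfl)]
    push_cast
    rfl
  · rw [rootExponent, pow_add, ← mul_assoc, ← baseModulus]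
    simp [FoldExpr.eval_mul, FoldExpr.eval_var, listEnv]
  · rw [weightBound]
    push_cast
    change (2 : ℤ) * (n * d * ((d + 1) * (d + 1) * (n * (r * r * (r * r))) *
      ((d + 1) * (d + 1) * (n * (r * r * (r * r))))) + 3) = _
    ring
  · simp [FoldExpr.eval_mul, FoldExpr.eval_var, listEnv]
  · rw [FoldExpr.eval_prod_const (a := d * weightBound n r d) (m := logCount 2 d + 1)
      (fun _ => by simp [FoldExpr.eval_var, listEnv]) (by rfl), parameterCount]
    push_cast
    rfl
  · rw [FoldExpr.eval_mul, FoldExpr.eval_prod_const (a := weightBound n r d)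
      (m := logCount 2 d + 1) (fun _ => by simp [FoldExpr.eval_var, listEnv]) (by rfl), pointCount]
    simp [FoldExpr.eval_var, listEnv]
  · rfl

/-! ### The complete program and its output -/

/-- The program that prints the numbers of the table. -/
def tablePrinter : Printer :=
  .seq (.seq (.emit (.var 7)) (.seq (.emit (.var 8)) (.seq (.emit (.var 5))
    (.seq (.emit (.const 2)) (.emit (.var 16))))))
    (.forRange 18 16 (.forRange 19 1 (.forRange 20 11 (.forRange 21 11 (.forRange 22 17
      (.forRange 23 12 (.seq (.emit entryExpr) (.emit (.const 1)))))))))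

theorem List.flatMap_finRange_eq {α : Type*} {n : ℕ} {f : Fin n → List α} {g : ℕ → List α}
    (h : ∀ i : Fin n, f i = g i) : (List.finRange n).flatMap f = (List.range n).flatMap g := by
  rw [← List.map_coe_finRange_eq_range, List.flatMap_map]
  exact congrArg (List.flatMap · _) (funext h)

theorem weightBound_pos (n r d : ℕ) : 0 < weightBound n r d := by
  rw [weightBound]; omega

/-- The table of points. -/
def hittingTable (p n r d : ℕ) : PointTable (pointCount n r d) n (p ^ logCount p d) 2
    (2 ^ twoExponent p r * p ^ rootExponent p d) := fun k i a b j e =>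
  (pointEntry p n (2 ^ twoExponent p r * p ^ rootExponent p d)
    (1 + baseModulus p (twoExponent p r))
    (2 ^ twoExponent p r * p ^ rootExponent p d * (parameterCount n r d).factorial) d
    (p ^ logCount p d) (weightBound n r d) (d * weightBound n r d) (logCount 2 d + 1)
    (parameterCount n r d) k i a b j e, 1)

theorem out_tablePrinter {p n r d : ℕ} (hp : 1 ≤ p) (hd : 1 ≤ d) :
    tablePrinter.out (listEnv ((parameterList p n r d).map Nat.cast)) =
      [(twoExponent p r : ℤ), rootExponent p d, logCount p d, (2 : ℕ), pointCount n r d] ++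
        (hittingTable p n r d).toList := by
  rw [tablePrinter, Printer.out]
  refine congrArg₂ (· ++ ·) rfl ?_
  rw [PointTable.toList]
  symm
  refine List.flatMap_finRange_eq fun k => ?_
  refine List.flatMap_finRange_eq fun i => ?_
  refine List.flatMap_finRange_eq fun a => ?_
  refine List.flatMap_finRange_eq fun b => ?_
  refine List.flatMap_finRange_eq fun j => ?_
  refine List.flatMap_finRange_eq fun e => ?_
  rw [Printer.out, Printer.out, Printer.out, eval_entryExpr (p := p) (n := n) (d := d)
    (lev := logCount 2 d + 1) (g := 1 + baseModulus p (twoExponent p r)) (ℓ := p ^ logCount p d)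
    (N := 2 ^ twoExponent p r * p ^ rootExponent p d) (Q := weightBound n r d)
    (B := d * weightBound n r d) (T := parameterCount n r d) (k := k) (i := i) (a := a) (b := b)
    (j := j) (e := e)]
  · rfl
  all_goals first
    | rfl
    | skip
  · positivity
  · exact weightBound_pos n r d
  · exact Nat.le_mul_of_pos_left _ hd

/-- Counters of loops stay below variables that are bounded already; only `bind` imposes a
condition, and it does not occur here. -/
theorem boundedBy_tablePrinter (V : ℕ) (v : ℕ → ℤ) : tablePrinter.BoundedBy V v := by
  simp [tablePrinter, Printer.BoundedBy]

/-- The running time is polynomial in the values of the parameters. -/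
theorem exists_prints_hittingTable : ∃ (P : RamProg) (c : ℕ), ∀ p n r d V : ℕ, 1 ≤ p → 1 ≤ d →
    2 ≤ V → (∀ a ∈ parameterList p n r d, a ≤ V) → ∃ t ≤ V ^ c,
      P.Prints [(p : ℤ), n, r, d]
        ([(twoExponent p r : ℤ), rootExponent p d, logCount p d, (2 : ℕ), pointCount n r d] ++
          (hittingTable p n r d).toList) t := by
  obtain ⟨c, hc⟩ := (Printer.bindList parameterExprs 4 tablePrinter).exists_ramExec_compile 0
  refine ⟨(Printer.bindList parameterExprs 4 tablePrinter).compile 0, c, fun p n r d V hp hd hV hle => ?_⟩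
  have hl : [(p : ℤ), n, r, d] ++ ((parameterList p n r d).drop 4).map Nat.cast =
      (parameterList p n r d).map Nat.cast := rfl
  have hev := evalList_parameterExprs (n := n) (r := r) (d := d) hp
  obtain ⟨s', t, hrun, ht, -, hout, -⟩ := hc V hV (RamState.init [(p : ℤ), n, r, d])
    (fun x => by
      by_cases hx : x < 4
      · have := hle p (by simp [parameterList])
        have := hle n (by simp [parameterList])
        have := hle r (by simp [parameterList])
        have := hle d (by simp [parameterList])
        interval_cases x <;> simpa [RamState.init]
      · simp only [RamState.init]
        rw [List.getD_eq_default _ _ (by simpa using hx)]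
        simp)
    (Printer.boundedBy_bindList V _ _ _ _ hev (by
      intro a ha
      obtain ⟨b, hb, rfl⟩ := List.mem_map.1 ha
      simpa using hle b (List.mem_of_mem_drop hb)) (boundedBy_tablePrinter _ _))
  refine ⟨t, ht, s', hrun, ?_⟩
  rw [hout]
  have := Printer.out_bindList tablePrinter _ _ _ hev
  rw [hl, out_tablePrinter hp hd] at this
  exact this

end Parameters

/-! ## Bounds for the parameters -/

section Bounds

theorem logCount_le (b x : ℕ) : logCount b x ≤ x := by
  rw [logCount, ← Finset.sum_filter, Finset.sum_const, smul_eq_mul, mul_one]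
  exact (Finset.card_filter_le _ _).trans (Finset.card_range x).le

/-- The factors `n d`, `(d + 1)^4` and `(n r^4)^2` contribute 2, 8 and 10 to the exponent, and the
constants cost 3 more. -/
theorem weightBound_le {n r d b : ℕ} (hb : 2 ≤ b) (hn : n ≤ b) (hr : r ≤ b) (hd : d ≤ b) :
    weightBound n r d ≤ b ^ 23 := by
  have h1 : d + 1 ≤ b ^ 2 := by nlinarith
  calc weightBound n r d ≤ 2 * (b * b * ((b ^ 2) ^ 2 * (b * (b ^ 2) ^ 2)) ^ 2 + 3) := by
        rw [weightBound]; gcongr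
    _ = 2 * (b ^ 20 + 3) := by ring
    _ ≤ b * (b ^ 20 + b ^ 2) := by
        have : 2 ^ 2 ≤ b ^ 2 := Nat.pow_le_pow_left hb 2
        gcongr
        omega
    _ ≤ b * (b ^ 20 + b ^ 20) := by
        gcongr <;> omega
    _ = 2 * b ^ 21 := by ring
    _ ≤ b ^ 2 * b ^ 21 := by
        gcongr
        nlinarith
    _ = b ^ 23 := by ring

/-- All parameters are bounded by a power of `b ^ (p * log d)`. -/
theorem parameterList_le {p n r d : ℕ} (hp : p.Prime) (hn : 1 ≤ n) (hr : 1 ≤ r) (hd : 1 ≤ d) :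
    ∀ a ∈ parameterList p n r d, a ≤ ((n * r * max d 2) ^ (p * Nat.log 2 (max d 2))) ^ 144 := by
  set D := max d 2 with hD
  set b := n * r * D with hb
  set k := Nat.log 2 D with hk
  have hp2 := hp.two_le
  have hD2 : 2 ≤ D := le_max_right _ _
  have hdD : d ≤ D := le_max_left _ _
  have hk1 : 1 ≤ k := Nat.log_pos (by omega) hD2
  have hnr : 1 ≤ n * r := Nat.mul_pos hn hr
  have hDb : D ≤ b := Nat.le_mul_of_pos_left _ hnr
  have hb2 : 2 ≤ b := hD2.trans hDb
  have hnb : n ≤ b := by rw [hb, mul_assoc]; exact Nat.le_mul_of_pos_right _ (by positivity)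
  have hrb : 2 * r ≤ b := by
    calc 2 * r ≤ D * (n * r) := Nat.mul_le_mul hD2 (Nat.le_mul_of_pos_left _ hn)
      _ = b := by rw [hb]; ring
  have hdb : d ≤ b := hdD.trans hDb
  set W := b ^ (p * k) with hW
  have hpk : p ≤ p * k := Nat.le_mul_of_pos_right _ hk1
  have hbpW : b ^ p ≤ W := Nat.pow_le_pow_right (by omega) hpk
  have hbkW : b ^ k ≤ W := Nat.pow_le_pow_right (by omega) (Nat.le_mul_of_pos_left _ hp.pos)
  have hbW : b ^ 2 ≤ W := (Nat.pow_le_pow_right (by omega) hp2).trans hbpW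
  have hW4 : 4 ≤ W := by nlinarith
  have hbW' : b + 1 ≤ W := by nlinarith
  have hpW : p ≤ W := (Nat.lt_two_pow_self.le.trans (Nat.pow_le_pow_left hb2 p)).trans hbpW
  have hmono : ∀ {i x : ℕ}, x ≤ W ^ i → i ≤ 144 → x ≤ W ^ 144 := fun h hi =>
    h.trans (Nat.pow_le_pow_right (by omega) hi)
  have hone : ∀ {x : ℕ}, x ≤ W → x ≤ W ^ 144 := fun h => hmono (i := 1) (by simpa using h) (by omega)
  have hLd : logCount p d ≤ d := logCount_le p d
  have hlevd : logCount 2 d ≤ d := logCount_le 2 d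
  have hodd : oddExp p ≤ 1 := by rw [oddExp]; split <;> omega
  -- `2 ^ τ` is at most `(2 r) ^ (3 p)`, which the factor `p` in the exponent of `W` accounts for.
  have htwo : 2 ^ twoExponent p r ≤ W ^ 3 := by
    calc 2 ^ twoExponent p r = ((2 ^ logCount 2 r) ^ p) ^ 3 := by
          rw [← pow_mul, ← pow_mul, twoExponent]; congr 1; ring
      _ ≤ (b ^ p) ^ 3 := by
          gcongr
          exact (pow_logCount_le le_rfl hr).trans hrb
      _ ≤ W ^ 3 := by gcongr
  have hbase : baseModulus p (twoExponent p r) ≤ W ^ 4 := by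
    rw [baseModulus]
    calc _ ≤ W ^ 3 * p ^ 1 := Nat.mul_le_mul htwo (Nat.pow_le_pow_right hp.pos hodd)
      _ ≤ W ^ 3 * W := by rw [pow_one]; gcongr
      _ = W ^ 4 := by ring
  have hpL : p ^ logCount p d ≤ W ^ 2 := by
    calc _ ≤ p * d := pow_logCount_le hp2 hd
      _ ≤ W * W := Nat.mul_le_mul hpW (by omega)
      _ = W ^ 2 := by ring
  -- The number of levels is at most `k + 2`, and `k ≥ 1` because `D ≥ 2`.
  have hlev : logCount 2 d + 1 ≤ 3 * k := by
    rw [logCount_eq le_rfl hd]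
    have : Nat.log 2 d ≤ k := Nat.log_mono_right hdD
    omega
  have hQ : weightBound n r d ≤ b ^ 23 := weightBound_le hb2 hnb (by omega) hdb
  have hpowlev : ∀ {x i : ℕ}, x ≤ b ^ i → x ^ (logCount 2 d + 1) ≤ W ^ (3 * i) := by
    intro x i hx
    calc x ^ (logCount 2 d + 1) ≤ (b ^ i) ^ (logCount 2 d + 1) := Nat.pow_le_pow_left hx _
      _ ≤ (b ^ i) ^ (3 * k) := Nat.pow_le_pow_right (by positivity) hlev
      _ = (b ^ k) ^ (3 * i) := by rw [← pow_mul, ← pow_mul]; congr 1; ring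
      _ ≤ W ^ (3 * i) := by gcongr
  have hB : d * weightBound n r d ≤ b ^ 24 := by
    calc _ ≤ b * b ^ 23 := Nat.mul_le_mul hdb hQ
      _ = b ^ 24 := by ring
  have hT : parameterCount n r d ≤ W ^ 72 := hpowlev hB
  have hbi : ∀ {x i : ℕ}, x ≤ b ^ i → i ≤ 144 → x ≤ W ^ 144 := fun h hi =>
    hmono (h.trans (Nat.pow_le_pow_left (by omega) _)) hi
  intro a ha
  simp only [parameterList, List.mem_cons, List.not_mem_nil, or_false] at ha
  rcases ha with rfl | rfl | rfl | rfl | rfl | rfl | rfl | rfl | rfl | rfl | rfl | rfl | rfl |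
    rfl | rfl | rfl | rfl | rfl
  · exact hone hpW
  · exact hone (by omega)
  · exact hone (by omega)
  · exact hone (by omega)
  · exact hone (by omega)
  · exact hone (by omega)
  · exact hone (by omega)
  · refine hmono (i := 3) ?_ (by omega)
    exact Nat.lt_two_pow_self.le.trans htwo
  · exact hone (by rw [rootExponent]; omega)
  · exact hmono hbase (by omega)
  · refine hmono (i := 5) ?_ (by omega)
    have : 1 ≤ W ^ 4 := Nat.one_le_pow _ _ (by omega)
    calc _ ≤ W ^ 4 + W ^ 4 := Nat.add_le_add this hbase
      _ = 2 * W ^ 4 := by ring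
      _ ≤ W * W ^ 4 := Nat.mul_le_mul_right _ (by omega)
      _ = W ^ 5 := by ring
  · exact hmono hpL (by omega)
  · refine hmono (i := 6) ?_ (by omega)
    rw [rootExponent, pow_add, ← mul_assoc, ← baseModulus]
    calc _ ≤ W ^ 4 * W ^ 2 := Nat.mul_le_mul hbase hpL
      _ = W ^ 6 := by ring
  · exact hbi hQ (by omega)
  · exact hbi hB (by omega)
  · exact hmono hT (by omega)
  -- The largest exponent that occurs: `141 = 3 * 23 + 3 * 24`.
  · refine hmono (i := 141) ?_ (by omega)
    calc _ ≤ W ^ 69 * W ^ 72 := Nat.mul_le_mul (hpowlev hQ) hT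
      _ = W ^ 141 := by ring
  · exact hone (by omega)

theorem cast_pow_le_rpow {b p D e C : ℕ} (hb : 1 ≤ b) (he : e ≤ C) :
    (((b ^ (p * Nat.log 2 D)) ^ e : ℕ) : ℝ) ≤ (b : ℝ) ^ (C * p * Real.logb 2 D) := by
  have h1 : (((b ^ (p * Nat.log 2 D)) ^ e : ℕ) : ℝ) =
      (b : ℝ) ^ ((p * Nat.log 2 D * e : ℕ) : ℝ) := by
    rw [Real.rpow_natCast, ← pow_mul]
    push_cast
    rfl
  rw [h1]
  refine Real.rpow_le_rpow_of_exponent_le (by exact_mod_cast hb) ?_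
  have h2 : (Nat.log 2 D : ℝ) ≤ Real.logb 2 D := by exact_mod_cast Real.natLog_le_logb D 2
  have h3 : (e : ℝ) ≤ C := by exact_mod_cast he
  push_cast
  calc (p : ℝ) * Nat.log 2 D * e = e * p * Nat.log 2 D := by ring
    _ ≤ C * p * Real.logb 2 D := by gcongr

/-- The summand `1` in `⌊log_p d⌋ + 1` is not dominated by the logarithm if `p` is large compared
with `n d`. The factor `p` repairs this, since `2 ^ p ≥ p` gives `p * log_p 2 ≥ 1`. -/
theorem logCount_le_logb {p n d C : ℕ} (hp : p.Prime) (hn : 1 ≤ n) (hd : 1 ≤ d) (hC : 2 ≤ C) :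
    (logCount p d : ℝ) ≤ C * p * Real.logb p (n * max d 2 : ℕ) := by
  have hp2 : (2 : ℝ) ≤ p := by exact_mod_cast hp.two_le
  have hp1 : (1 : ℝ) < p := by linarith
  have hm : 2 ≤ n * max d 2 := (le_max_right d 2).trans (Nat.le_mul_of_pos_left _ hn)
  have hm' : d ≤ n * max d 2 := (le_max_left d 2).trans (Nat.le_mul_of_pos_left _ hn)
  set x := Real.logb p (n * max d 2 : ℕ) with hx
  have h1 : (Nat.log p d : ℝ) ≤ x := by
    refine (Real.natLog_le_logb d p).trans (Real.logb_le_logb_of_le hp1 ?_ ?_)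
    · exact_mod_cast hd
    · exact_mod_cast hm'
  have h2 : 1 ≤ p * x := by
    have h3 : Real.logb p 2 ≤ x :=
      Real.logb_le_logb_of_le hp1 (by norm_num) (by exact_mod_cast hm)
    have h4 : (p : ℝ) ≤ 2 ^ p := by exact_mod_cast Nat.lt_two_pow_self.le
    have h5 := Real.logb_le_logb_of_le hp1 (by linarith) h4
    rw [Real.logb_self_eq_one hp1, Real.logb_pow] at h5
    nlinarith
  have hx0 : 0 ≤ x := le_trans (Nat.cast_nonneg _) h1
  rw [logCount_eq hp.two_le hd]
  push_cast
  have hC' : (2 : ℝ) ≤ C := by exact_mod_cast hC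
  calc (Nat.log p d : ℝ) + 1 ≤ x + p * x := add_le_add h1 h2
    _ ≤ 2 * p * x := by nlinarith
    _ ≤ C * p * x := by gcongr

end Bounds

theorem mainTheorem8 :
    ∃ (P : RamProg) (C : ℕ) (L : ℕ → ℕ → ℕ → ℕ), ∀ p n d : ℕ, p.Prime → 1 ≤ n → 1 ≤ d →
      -- the exponent of the index depends on `p`, `n`, `d` only
      (L p n d : ℝ) ≤ C * p * Real.logb p (n * max d 2 : ℕ) ∧
      ∀ r : ℕ, 1 ≤ r → ∃ (τ m Z H t : ℕ)
        (c : PointTable H n (p ^ L p n d) Z (2 ^ τ * p ^ m)),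
        -- the size of the hitting set and the time of its construction
        (H : ℝ) ≤ ((n * r * max d 2 : ℕ) : ℝ) ^ (C * p * Real.logb 2 (max d 2 : ℕ)) ∧
        (t : ℝ) ≤ ((n * r * max d 2 : ℕ) : ℝ) ^ (C * p * Real.logb 2 (max d 2 : ℕ)) ∧
        P.Prints [(p : ℤ), n, r, d] ([(τ : ℤ), m, L p n d, Z, H] ++ c.toList) t ∧
        (∀ k i a b j e, (c k i a b j e).2 ≠ 0) ∧
        -- the order of the adjoined root of unity of 2-power order
        r ^ (3 * p) < 2 ^ τ ∧
        -- the cyclic division algebra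
        ∃ (K : IntermediateField (baseField τ) (RatFunc ℂ)) (σ : K ≃ₐ[baseField τ] K),
          K ≤ IntermediateField.adjoin (baseField τ) {rootOfUnity (2 ^ τ * p ^ m)} ∧
          IsCyclicDivisionAlgebra σ (p ^ L p n d) (baseZ τ) ∧
          -- the points lie in it and form a hitting set
          ∃ q : Fin H → Fin n → cyclicAlgebra σ (p ^ L p n d) (baseZ τ),
            (∀ k i a b, (((q k i).1 a b : K) : RatFunc ℂ) = entryValue (c k i a b)) ∧
            IsHittingSet (homABPClass (baseField τ) n r d) (Set.range q) := by
  obtain ⟨P, c, hP⟩ := exists_prints_hittingTable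
  -- All parameters are at most the 144-th power of `(n r d*)^{p ⌊log₂ d*⌋}`, and the running time
  -- is the `c`-th power of that bound; the constant covers both and is at least 2.
  refine ⟨P, 144 * (c + 1), fun p _ d => logCount p d, fun p n d hp hn hd =>
    ⟨logCount_le_logb hp hn hd (by omega), fun r hr => ?_⟩⟩
  have hb : 2 ≤ n * r * max d 2 :=
    (le_max_right d 2).trans (Nat.le_mul_of_pos_left _ (Nat.mul_pos hn hr))
  have hle := parameterList_le hp hn hr hd
  obtain ⟨t, ht, hprints⟩ := hP p n r d _ hp.one_le hd (hle 2 (by simp [parameterList])) hle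
  have hτ : 2 ≤ twoExponent p r := by
    rw [twoExponent, logCount_eq le_rfl hr]
    nlinarith [hp.two_le]
  refine ⟨twoExponent p r, rootExponent p d, 2, pointCount n r d, t, hittingTable p n r d,
    ?_, ?_, hprints, fun _ _ _ _ _ _ => one_ne_zero, ?_, ?_⟩
  · exact (Nat.cast_le.2 (hle _ (by simp [parameterList]))).trans
      (cast_pow_le_rpow (e := 144) (by omega) (by omega))
  · rw [← pow_mul _ 144] at ht
    exact (Nat.cast_le.2 ht).trans (cast_pow_le_rpow (e := 144 * c) (by omega) (by omega))
  · rw [twoExponent, mul_comm (3 * p), pow_mul 2]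
    exact Nat.pow_lt_pow_left (lt_pow_logCount le_rfl hr) (by have := hp.pos; omega)
  · have hN : 1 < 2 ^ twoExponent p r * p ^ rootExponent p d := by
      have h1 : 2 ^ 1 ≤ 2 ^ twoExponent p r := Nat.pow_le_pow_right (by omega) (by omega)
      have h2 : 1 ≤ p ^ rootExponent p d := Nat.one_le_pow _ _ hp.pos
      nlinarith
    -- Here `A = N * T!`, which is divisible by `N` and by every positive integer below `T`.
    refine exists_isHittingSet hp hτ ?_ hn hr hd (lt_pow_logCount hp.two_le hd) rfl le_rfl rfl
      (lt_pow_logCount le_rfl hd).le rfl rfl ?_ (Dvd.intro _ rfl) ?_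
    · rw [logCount_eq hp.two_le hd]
      omega
    · exact hN.trans_le (Nat.le_mul_of_pos_right _ (Nat.factorial_pos _))
    · exact fun e h1 h2 => (Nat.dvd_factorial h1 h2.le).mul_left _
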